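/- **Setting.** A coefficient function is a sequence $\mu=(\mu_1,\mu_2,\dots)$ of non-negative integers; $\beta^i$ is the one with a single nonzero entry $1$, at index $i$. Put $\mathrm{rev}_n(\mu)=(\mu_n,\dots,\mu_1,0,0,\dots)$. For $\mu\neq 0$ of finite support, $\mathrm{ord}(\mu)$ is the largest $n$ with $\mu_n\ne0$. Write $\mu<_a\mu'$ (resp. $\mu<_d\mu'$) if $\mu_k<\mu'_k$ at the largest (resp. smallest) index $k$ at which they differ. For a sequence $G$, $\sum\mu G:=\sum_k\mu_kG_k$. Let $L=(e_1,\dots,e_N)$ be a list of non-negative integers, $N\ge2$, $e_1\ne0$, and let $\beta^*=(e_1,\dots,e_N,e_1,\dots,e_N,\dots)$. For $1\le k\le p$, a proper $L$-block with support interval $[k,p]$ is a coefficient function $\zeta$ with $\zeta_j=\mathrm{rev}_p(\beta^*)_j$ for $j>k$, $\zeta_k<\mathrm{rev}_p(\beta^*)_k$, and $\zeta_j=0$ for $j<k$; the maximal $L$-block $\mathrm{rev}_p(\beta^*)$ has support interval $[1,p]$. Let $\mathcal E$ be the set of finite sums of $L$-blocks with pairwise disjoint support intervals, and $H$ its fundamental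 sequence: the unique increasing sequence of positive integers such that every positive integer is $\sum\mu H$ for exactly one $\mu\in\mathcal E$. Let $\bar\beta^n=(0,\dots,0,e_1,e_2,\dots)$ be $\beta^*$ shifted to start at index $n$. For $n\le k$, a proper $L^*$-block with support interval $[n,k]$ is a $\zeta$ with $\zeta_j=\bar\beta^n_j$ for $j<k$, $\zeta_k<\bar\beta^n_k$, and $\zeta_j=0$ for $j>k$. Let $\mathcal E^*$ be the set of nonzero finite or infinite sums of proper $L^*$-blocks with pairwise disjoint support intervals, and $Q$ its fundamental sequence: the unique decreasing sequence in $(0,1)$ for which $\epsilon\mapsto\sum\epsilon Q$ is a bijection $\mathcal E^*\to(0,1)$ that is increasing with respect to $<_d$. Let $\phi$ be the unique positive zero of $x^N-\sum_{k=1}^{N-1}e_kx^{N-k}-(1+e_N)$. Let $\widetilde L$ be a second such list, with corresponding $\widetilde{\mathcal E},\widetilde H,\widetilde{\mathcal E}^*,\widetilde Q,\widetilde\phi$, and assume that $\mathcal E\subsetneq\widetilde{\mathcal E}$. Put $\gamma=\log_{\widetilde\phi}\phi$ and $\widetilde\omega=\widetilde\phi^{-1}$. For a positive integer $x$ let $z(x)$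 be the number of non-negative integers less than $x$ of the form $\sum\epsilon\widetilde H$ with $\epsilon\in\mathcal E$, and let $\delta(x)=z(x)/x^\gamma$. For $\mu\neq0$ of finite support let $\bar\mu$ be the immediate successor in $\mathcal E$ (ordered by $<_a$) of the largest member of $\mathcal E$ that is $<_a\mu$. For $\epsilon\in\widetilde{\mathcal E}^*$ let $\overline{\mathrm{rev}}(\epsilon)=\bar\beta^1$ if $\bar\beta^1\le_d\epsilon$, and $\overline{\mathrm{rev}}(\epsilon)=\lim_{n\to\infty}\mathrm{rev}_n\big(\overline{\mathrm{rev}_n(\epsilon)}\big)$ (entrywise) if $\epsilon<_d\bar\beta^1$. For $\epsilon\in\widetilde{\mathcal E}^*$ with $y=\sum\epsilon\widetilde Q\in[\widetilde\omega,1)$ let $\delta_1^*(y)=\big(\sum\overline{\mathrm{rev}}(\epsilon)Q\big)/y^\gamma$, and for $y\in(0,1)$ let $\delta^*(y)=\delta_1^*(y/\widetilde\omega^{\,n-1})$, where $n\ge1$ is the integer with $y\in[\widetilde\omega^{\,n},\widetilde\omega^{\,n-1})$. **Statement.** The limits $\alpha=\lim_{n}H_n/\phi^{n-1}$ and $\widetilde\alpha=\lim_{n}\widetilde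 H_n/\widetilde\phi^{\,n-1}$ exist and are positive. For each positive integer $x$ write $x=\sum\mu\widetilde H$ with $\mu\in\widetilde{\mathcal E}$ and let $n=\mathrm{ord}(\mu)$. Then, as $x\to\infty$ through the positive integers, $$\delta(x)\sim\frac{\alpha}{\widetilde\alpha^{\gamma}}\,\delta^*\Big(\sum\mathrm{rev}_n(\mu)\,\widetilde Q\Big) \qquad\text{and}\qquad \delta(x)\sim\frac{\alpha}{\widetilde\alpha^{\gamma}}\,\delta^*\Big(\widetilde\phi^{\,\{\log_{\widetilde\phi}(x/\widetilde\alpha)\}-1}\Big),$$ where $\{t\}$ denotes the fractional part of $t$. -/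

import Mathlib

open Filter Topology Asymptotics

noncomputable section

namespace Zeckendorf

/-- Coefficient functions `(μ₁, μ₂, …)`. Indices are shifted by one throughout:
the value `μ k` is the entry `μ_{k+1}` of the tuple, and likewise for sequences. -/
abbrev Coeff := ℕ → ℕ

/-- The order `μ <_a μ'` (comparison at the largest index where they differ). -/
def LtA (μ μ' : Coeff) : Prop := ∃ k, (∀ j, k < j → μ j = μ' j) ∧ μ k < μ' k

/-- The order `μ <_d μ'` (comparison at the smallest index where they differ). -/
def LtD (μ μ' : Coeff) : Prop := ∃ k, (∀ j, j < k → μ j = μ' j) ∧ μ k < μ' k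

/-- `rev_n(μ) = (μ_n, …, μ_1, 0, 0, …)`. -/
def rev (n : ℕ) (μ : Coeff) : Coeff := fun k => if k < n then μ (n - 1 - k) else 0

/-- The largest (one-based) index at which `μ` is nonzero; `0` for `μ = 0`. -/
def ord (μ : Coeff) : ℕ := sSup {n | ∃ k, n = k + 1 ∧ μ k ≠ 0}

/-- `L = (e_1, …, e_N)` with `N ≥ 2` and `e_1 ≠ 0`. -/
def IsAdmissible (L : List ℕ) : Prop := 2 ≤ L.length ∧ L.getD 0 0 ≠ 0

/-- The purely periodic coefficient function `(e_1, …, e_N, e_1, …, e_N, …)`. -/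
def betaStar (L : List ℕ) : Coeff := fun k => L.getD (k % L.length) 0

/-! ### Collections for the positive integers -/

/-- `ζ` is a proper `L`-block whose support interval consists of the (zero-based) indices
`a ≤ j < p`, i.e. it is the one-based interval `[a + 1, p]`. -/
def IsProperBlock (L : List ℕ) (ζ : Coeff) (a p : ℕ) : Prop :=
  a < p ∧ (∀ j, a < j → ζ j = rev p (betaStar L) j) ∧ ζ a < rev p (betaStar L) a ∧
    ∀ j, j < a → ζ j = 0

/-- `ζ` is the maximal `L`-block `rev_p(β*)`, with support interval the zero-based `0 ≤ j < p`. -/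
def IsMaximalBlock (L : List ℕ) (ζ : Coeff) (a p : ℕ) : Prop :=
  a = 0 ∧ 0 < p ∧ ζ = rev p (betaStar L)

def IsBlock (L : List ℕ) (ζ : Coeff) (a p : ℕ) : Prop :=
  IsProperBlock L ζ a p ∨ IsMaximalBlock L ζ a p

/-- The periodic Zeckendorf collection for positive integers determined by `L`:
the sums of finitely many disjoint `L`-blocks. -/
def collection (L : List ℕ) : Set Coeff :=
  {μ | ∃ (s : ℕ) (ζ : Fin s → Coeff) (a p : Fin s → ℕ),
    (∀ i, IsBlock L (ζ i) (a i) (p i)) ∧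
    (∀ i j, i ≠ j → Disjoint (Set.Ico (a i) (p i)) (Set.Ico (a j) (p j))) ∧
    μ = ∑ i, ζ i}

/-- `∑ μ H` for an integer sequence `H` and `μ` of finite support. -/
def evalNat (H : ℕ → ℕ) (μ : Coeff) : ℕ := ∑ᶠ k, μ k * H k

/-- `H` is a fundamental sequence of `E`: an increasing sequence of positive integers such that
every positive integer is `∑ μ H` for exactly one `μ ∈ E`. -/
def IsFundamentalSeq (E : Set Coeff) (H : ℕ → ℕ) : Prop :=
  StrictMono H ∧ (∀ k, 0 < H k) ∧ ∀ n : ℕ, 0 < n → ∃! μ, μ ∈ E ∧ evalNat H μ = n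

/-- The fundamental sequence of the periodic collection determined by `L`. -/
def fundSeq (L : List ℕ) : ℕ → ℕ := Classical.epsilon (IsFundamentalSeq (collection L))

/-! ### Collections for the unit interval -/

/-- The maximal `L*`-block starting at the zero-based index `m`. -/
def maxBlockStar (L : List ℕ) (m : ℕ) : Coeff := fun k => if k < m then 0 else betaStar L (k - m)

/-- `ζ` is a proper `L*`-block whose support interval is the zero-based `m ≤ j ≤ k`. -/
def IsProperBlockStar (L : List ℕ) (ζ : Coeff) (m k : ℕ) : Prop :=
  m ≤ k ∧ (∀ j, j < k → ζ j = maxBlockStar L m j) ∧ ζ k < maxBlockStar L m k ∧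
    ∀ j, k < j → ζ j = 0

/-- The periodic Zeckendorf collection for `(0,1)` determined by `L`: the nonzero finite or
infinite sums of disjoint proper `L*`-blocks (the summands are indexed by a set `S`
of natural numbers, finite or infinite). -/
def collectionStar (L : List ℕ) : Set Coeff :=
  {ε | ε ≠ 0 ∧ ∃ (S : Set ℕ) (ζ : ℕ → Coeff) (m k : ℕ → ℕ),
    (∀ i ∈ S, IsProperBlockStar L (ζ i) (m i) (k i)) ∧
    (∀ i ∈ S, ∀ j ∈ S, i ≠ j → Disjoint (Set.Icc (m i) (k i)) (Set.Icc (m j) (k j))) ∧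
    ∀ t, ε t = ∑ᶠ i ∈ S, ζ i t}

/-- `∑ ε Q` for a real sequence `Q`. -/
def evalReal (Q : ℕ → ℝ) (ε : Coeff) : ℝ := ∑' k, (ε k : ℝ) * Q k

/-- `Q` is a fundamental sequence of `F` for `(0,1)`: a decreasing sequence in `(0,1)` whose
evaluation map is an increasing bijection from `F` (ordered by `<_d`) onto `(0,1)`. -/
def IsFundamentalSeqStar (F : Set Coeff) (Q : ℕ → ℝ) : Prop :=
  StrictAnti Q ∧ (∀ k, Q k ∈ Set.Ioo (0 : ℝ) 1) ∧
    Set.BijOn (evalReal Q) F (Set.Ioo (0 : ℝ) 1) ∧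
    ∀ ε ∈ F, ∀ ε' ∈ F, (LtD ε ε' ↔ evalReal Q ε < evalReal Q ε')

/-- The fundamental sequence of the periodic collection for `(0,1)` determined by `L`. -/
def fundSeqStar (L : List ℕ) : ℕ → ℝ :=
  Classical.epsilon (IsFundamentalSeqStar (collectionStar L))

/-! ### Constants -/

/-- `x^N - ∑_{k=1}^{N-1} e_k x^{N-k} - (1 + e_N)`. -/
def charPoly (L : List ℕ) : Polynomial ℝ :=
  Polynomial.X ^ L.length
    - ∑ k ∈ Finset.Icc 1 (L.length - 1),
        Polynomial.C (L.getD (k - 1) 0 : ℝ) * Polynomial.X ^ (L.length - k)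
    - Polynomial.C (1 + (L.getD (L.length - 1) 0 : ℝ))

/-- The positive real zero `φ` of the characteristic polynomial. -/
def phi (L : List ℕ) : ℝ := Classical.epsilon fun x : ℝ => 0 < x ∧ (charPoly L).IsRoot x

/-- `γ = log_{φ̃} φ`, where `L` determines `φ` and `L'` determines `φ̃`. -/
def gam (L L' : List ℕ) : ℝ := Real.logb (phi L') (phi L)

/-! ### The counting function -/

/-- `z(x)`: the number of nonnegative integers `∑ ε H̃ < x` with `ε ∈ E`. -/
def zCount (L L' : List ℕ) (x : ℕ) : ℕ :=
  Set.ncard {m : ℕ | m < x ∧ ∃ ε ∈ collection L, evalNat (fundSeq L') ε = m}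

/-- `δ(x) = z(x) / x^γ`. -/
def delta (L L' : List ℕ) (x : ℕ) : ℝ := (zCount L L' x : ℝ) / (x : ℝ) ^ gam L L'

/-! ### The function `δ*` -/

/-- `ν` is the largest member of `E` that is `<_a μ`. -/
def IsLargestBelow (E : Set Coeff) (μ ν : Coeff) : Prop :=
  ν ∈ E ∧ LtA ν μ ∧ ∀ ν' ∈ E, LtA ν' μ → ν' = ν ∨ LtA ν' ν

/-- `ν'` is the immediate successor of `ν` in `E`. -/
def IsImmediateSucc (E : Set Coeff) (ν ν' : Coeff) : Prop :=
  ν' ∈ E ∧ LtA ν ν' ∧ ∀ τ ∈ E, LtA ν τ → τ = ν' ∨ LtA ν' τ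

/-- `μ̄`: the immediate successor in `E` of the largest member of `E` that is `<_a μ`. -/
def bar (E : Set Coeff) (μ : Coeff) : Coeff :=
  Classical.epsilon fun ν' => ∃ ν, IsLargestBelow E μ ν ∧ IsImmediateSucc E ν ν'

open Classical in
/-- `rev̄(ε)`: it is `lim_n rev_n(bar(rev_n ε))` (entrywise limit) if `ε <_d β̄¹`, and it is the
maximal `L*`-block `β̄¹` if `β̄¹ ≤_d ε`. -/
def revBar (L : List ℕ) (ε : Coeff) : Coeff :=
  if LtD ε (maxBlockStar L 0) then
    limUnder atTop fun n : ℕ => rev n (bar (collection L) (rev n ε))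
  else maxBlockStar L 0

/-- The member `ε` of the collection for `(0,1)` determined by `L` with `y = ∑ ε Q`. -/
def expansion (L : List ℕ) (y : ℝ) : Coeff :=
  Classical.epsilon fun ε => ε ∈ collectionStar L ∧ evalReal (fundSeqStar L) ε = y

/-- `δ₁*(∑ ε Q̃) = (∑ rev̄(ε) Q) / (∑ ε Q̃)^γ`, meant for arguments in `[φ̃⁻¹, 1)`. -/
def deltaStarOne (L L' : List ℕ) (y : ℝ) : ℝ :=
  evalReal (fundSeqStar L) (revBar L (expansion L' y)) / y ^ gam L L'

/-- For `y ∈ (0,1)`, the positive integer `n` with `ω̃^n ≤ y < ω̃^(n-1)`, where `ω̃ = φ̃⁻¹`. -/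
def scaleIndex (L' : List ℕ) (y : ℝ) : ℕ :=
  Classical.epsilon fun n : ℕ => 1 ≤ n ∧ (phi L')⁻¹ ^ n ≤ y ∧ y < (phi L')⁻¹ ^ (n - 1)

/-- `δ*(y) = δ₁*(y / ω̃^(n-1))` for `y ∈ (0,1)` with `ω̃^n ≤ y < ω̃^(n-1)`. -/
def deltaStar (L L' : List ℕ) (y : ℝ) : ℝ :=
  deltaStarOne L L' (y / (phi L')⁻¹ ^ (scaleIndex L' y - 1))

end Zeckendorf

end

/-! Read the digits of a member of `collection L` from the leading one, while an automaton records
how many digits of `betaStar L` have just been matched. Sums of disjoint blocks are exactly the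
words in which no digit exceeds the prescribed one (`mem_collection_iff`); for the unit interval
they are the nonzero legal sequences with infinitely many mismatches (`mem_collectionStar_iff`).
Adding to the value of a prefix the largest value its continuation can have (`Potential`) gives a
quantity that never increases, so evaluation respects the lexicographic order. It follows that
H_{n+1} is the number of legal words of length n (`fundSeq_eq`) and that Q_n = φ^{-n}
(`fundSeqStar_eq`). After division by φ^n the recurrence for the counts becomes an averaging
recurrence, which yields the limit α (`exists_tendsto_fundSeq`).

Let x have expansion μ of order n in the larger collection, and let y be the value of rev_n(μ) in
Q̃. Then x ~ α̃ φ̃^n y. Since evaluation is an order isomorphism, z(x) is the H-value of the least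
member of the smaller collection that is not below μ (`zCount_eq_of_isCeil`). This ceiling and the
largest legal sequence below rev_n(μ) (`clip`) differ, if at all, by a carry replacing a tail `β`,
and both have the same real value because `β` expands 1 (`FailsAt.evalReal_carry`). Hence z(x) ~ α
φ^n c(y), where c is `clipValue`. The same remark identifies the value of `revBar` with that of the
clip, so δ*(y) = c(y)/y^γ, and φ̃^γ = φ gives the first formula.

For the second formula, c is monotone and maps (0,1) onto (0,1), hence is uniformly continuous
there, and scaling y by φ̃^{-1} scales c by φ^{-1}. Thus c(y)/y^γ depends only on log y modulo log
φ̃, and y may be replaced by its approximation from x/α̃ (`ratio_leading_isEquivalent`). -/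

noncomputable section

namespace Zeckendorf

/-! ### The automaton reading digits against a reference sequence -/

/-- The state after reading `k` digits of `ε` from the state `s`: the length of the current partial
match with `β`. -/
def state (β ε : Coeff) (s : ℕ) : ℕ → ℕ
  | 0 => s
  | k + 1 => if ε k = β (state β ε s k) then state β ε s k + 1 else 0

/-- No digit of `ε` exceeds the digit of `β` prescribed by the current state. -/
def Legal (β : Coeff) (s : ℕ) (ε : Coeff) : Prop := ∀ k, ε k ≤ β (state β ε s k)

/-- The sequence `ε` preceded by the digit `d`. -/
def cons (d : ℕ) (ε : Coeff) : Coeff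
  | 0 => d
  | k + 1 => ε k

/-- The sequence `ε` without its first `n` digits. -/
def shift (n : ℕ) (ε : Coeff) : Coeff := fun k => ε (n + k)

section Automaton

variable {β ε ε' : Coeff} {s : ℕ}

@[simp] theorem state_zero : state β ε s 0 = s := rfl

theorem state_succ (k : ℕ) : state β ε s (k + 1) =
    if ε k = β (state β ε s k) then state β ε s k + 1 else 0 := rfl

theorem state_succ_of_eq {k : ℕ} (h : ε k = β (state β ε s k)) :
    state β ε s (k + 1) = state β ε s k + 1 := by rw [state_succ, if_pos h]

theorem state_succ_of_lt {k : ℕ} (h : ε k < β (state β ε s k)) :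
    state β ε s (k + 1) = 0 := by rw [state_succ, if_neg h.ne]

theorem state_congr {k : ℕ} (h : ∀ i < k, ε i = ε' i) : state β ε s k = state β ε' s k := by
  induction k with
  | zero => rfl
  | succ k ih =>
    rw [state_succ, state_succ, ih fun i hi => h i (by omega), h k (by omega)]

theorem state_add (m k : ℕ) :
    state β ε s (m + k) = state β (shift m ε) (state β ε s m) k := by
  induction k with
  | zero => rfl
  | succ k ih => rw [← add_assoc, state_succ, state_succ, ih]; rfl

theorem Legal.shift (h : Legal β s ε) (m : ℕ) :
    Legal β (state β ε s m) (shift m ε) := fun k => by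
  rw [← state_add]; exact h (m + k)

theorem legal_of_shift {m : ℕ} (h : ∀ i < m, ε i ≤ β (state β ε s i))
    (h' : Legal β (state β ε s m) (Zeckendorf.shift m ε)) : Legal β s ε := fun k => by
  rcases lt_or_ge k m with hk | hk
  · exact h k hk
  · obtain ⟨i, rfl⟩ := Nat.exists_eq_add_of_le hk
    rw [state_add]; exact h' i

@[simp] theorem shift_one_cons (d : ℕ) (ε : Coeff) : Zeckendorf.shift 1 (cons d ε) = ε := by
  funext k; simp [Zeckendorf.shift, Nat.add_comm 1 k, cons]

theorem legal_cons_of_lt {d : ℕ} (hd : d < β s) (h : Legal β 0 ε) : Legal β s (cons d ε) := by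
  refine legal_of_shift (m := 1) (fun i hi => ?_) ?_
  · obtain rfl : i = 0 := by omega
    exact hd.le
  · rw [shift_one_cons]
    rwa [state_succ_of_lt (k := 0) hd]

theorem legal_cons_of_eq {d : ℕ} (hd : d = β s) (h : Legal β (s + 1) ε) :
    Legal β s (cons d ε) := by
  refine legal_of_shift (m := 1) (fun i hi => ?_) ?_
  · obtain rfl : i = 0 := by omega
    exact hd.le
  · rw [shift_one_cons]
    rwa [state_succ_of_eq (k := 0) hd]

theorem legal_zero : Legal β s 0 := fun _ => Nat.zero_le _

theorem state_self (k : ℕ) : state β β 0 k = k := by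
  induction k with
  | zero => rfl
  | succ k ih => rw [state_succ_of_eq (by rw [ih]), ih]

theorem legal_self : Legal β 0 β := fun k => by rw [state_self]

/-- The digits read since the last reset agree with `β`. -/
theorem state_run (k : ℕ) : state β ε 0 k ≤ k ∧ ∀ t, k - state β ε 0 k ≤ t → t < k →
    ε t = β (t - (k - state β ε 0 k)) ∧ state β ε 0 t = t - (k - state β ε 0 k) := by
  induction k with
  | zero => exact ⟨le_rfl, fun t _ h => absurd h (by omega)⟩
  | succ k ih =>
    obtain ⟨h1, h2⟩ := ih
    by_cases h : ε k = β (state β ε 0 k)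
    · rw [state_succ_of_eq h]
      refine ⟨by omega, fun t ht htk => ?_⟩
      have e : k + 1 - (state β ε 0 k + 1) = k - state β ε 0 k := by omega
      rw [e] at ht ⊢
      rcases Nat.lt_succ_iff_lt_or_eq.1 htk with h' | rfl
      · exact h2 t ht h'
      · rw [Nat.sub_sub_self h1]; exact ⟨h, rfl⟩
    · rw [state_succ, if_neg h]
      exact ⟨Nat.zero_le _, fun t ht htk => absurd htk (by omega)⟩

theorem state_le (k : ℕ) : state β ε 0 k ≤ k := (state_run k).1

/-- The matching restarts after the reset at `k`, so a later match cannot reach back across it. This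
is what makes distinct runs disjoint. -/
theorem state_le_of_reset {k m : ℕ} (h : ε k < β (state β ε 0 k)) (hkm : k < m) :
    state β ε 0 m ≤ m - (k + 1) := by
  obtain ⟨i, rfl⟩ := Nat.exists_eq_add_of_lt hkm
  have : k + i + 1 = (k + 1) + i := by omega
  rw [this, state_add, state_succ_of_lt h]
  have := state_le (β := β) (ε := Zeckendorf.shift (k + 1) ε) i
  omega

theorem state_of_no_reset {k i : ℕ} (h : ∀ t, k ≤ t → t < k + i → ε t = β (state β ε s t)) :
    state β ε s (k + i) = state β ε s k + i := by
  induction i with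
  | zero => rfl
  | succ i ih =>
    rw [← add_assoc, state_succ_of_eq (h _ (by omega) (by omega)),
      ih fun t h1 h2 => h t h1 (by omega), add_assoc]

/-! ### Lexicographic comparison -/

theorem ltD_trichotomy (ε ε' : Coeff) : LtD ε ε' ∨ ε = ε' ∨ LtD ε' ε := by
  rcases lt_trichotomy (toLex ε) (toLex ε') with h | h | h
  · exact Or.inl h
  · exact Or.inr (Or.inl (toLex.injective h))
  · exact Or.inr (Or.inr h)

/-- A legal sequence is at most the reference sequence. -/
theorem Legal.le_self (h : Legal β 0 ε) : toLex ε ≤ toLex β := by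
  by_contra hlt
  obtain ⟨k, hk, hlt⟩ : LtD β ε := not_le.1 hlt
  have := h k
  rw [← state_congr hk, state_self] at this
  omega

/-! ### Potentials -/

/-- Weights `w` and the total weights `c s k` that remain below position `k` in the state `s`,
for the first `n` positions. -/
structure Potential (β : Coeff) (w : ℕ → ℝ) (c : ℕ → ℕ → ℝ) (n : ℕ) : Prop where
  step : ∀ s k, k < n → c s k = β s * w k + c (s + 1) (k + 1)
  zero : ∀ k, k < n → c 0 (k + 1) = w k
  nonneg : ∀ s k, 0 ≤ c s k

/-- The weight of the first `k` digits plus the largest weight the remaining digits can have. -/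
def potential (β : Coeff) (w : ℕ → ℝ) (c : ℕ → ℕ → ℝ) (ε : Coeff) (k : ℕ) : ℝ :=
  ∑ i ∈ Finset.range k, ε i * w i + c (state β ε 0 k) k

variable {w : ℕ → ℝ} {c : ℕ → ℕ → ℝ} {n : ℕ}

theorem Potential.weight_nonneg (P : Potential β w c n) {k : ℕ} (hk : k < n) : 0 ≤ w k :=
  P.zero k hk ▸ P.nonneg 0 (k + 1)

theorem Potential.succ_of_eq (P : Potential β w c n) {k : ℕ} (hk : k < n)
    (h : ε k = β (state β ε 0 k)) : potential β w c ε (k + 1) = potential β w c ε k := by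
  rw [potential, potential, Finset.sum_range_succ, state_succ_of_eq h, P.step _ k hk, h, add_assoc]

/-- A digit below the prescribed one loses at least `w k`, and by `zero` the reset regains exactly
`w k`. The abandoned continuation `c (s + 1) (k + 1)` is therefore a net loss; it is the source of
strict inequalities for real expansions. -/
theorem Potential.succ_of_lt (P : Potential β w c n) {k : ℕ} (hk : k < n)
    (h : ε k < β (state β ε 0 k)) :
    potential β w c ε (k + 1) + c (state β ε 0 k + 1) (k + 1) ≤ potential β w c ε k := by
  rw [potential, potential, Finset.sum_range_succ, state_succ_of_lt h, P.step _ k hk, P.zero k hk]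
  have h1 : (ε k : ℝ) + 1 ≤ β (state β ε 0 k) := by exact_mod_cast h
  have := mul_le_mul_of_nonneg_right h1 (P.weight_nonneg hk)
  linarith

theorem Potential.succ_le (P : Potential β w c n) (hε : Legal β 0 ε) {k : ℕ} (hk : k < n) :
    potential β w c ε (k + 1) ≤ potential β w c ε k := by
  rcases (hε k).lt_or_eq with h | h
  · exact (le_add_of_nonneg_right (P.nonneg _ _)).trans (P.succ_of_lt hk h)
  · exact (P.succ_of_eq hk h).le

theorem Potential.antitone (P : Potential β w c n) (hε : Legal β 0 ε) {m m' : ℕ} (h : m ≤ m')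
    (h' : m' ≤ n) : potential β w c ε m' ≤ potential β w c ε m := by
  induction m', h using Nat.le_induction with
  | base => exact le_rfl
  | succ k hk ih => exact (P.succ_le hε (by omega)).trans (ih (by omega))

/-- At the first difference the smaller sequence resets, so everything it can still gain is worth
one unit of the digit at `k`, which the larger sequence already has. -/
theorem Potential.le_of_lt (P : Potential β w c n) (hε' : Legal β 0 ε') {k : ℕ} (hk : k < n)
    (h : ∀ j < k, ε j = ε' j) (hlt : ε k < ε' k) :
    potential β w c ε (k + 1) ≤ ∑ i ∈ Finset.range (k + 1), ε' i * w i := by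
  have h1 : ε k < β (state β ε 0 k) := by
    rw [state_congr h]; exact hlt.trans_le (hε' k)
  rw [potential, state_succ_of_lt h1, P.zero k hk, Finset.sum_range_succ, Finset.sum_range_succ,
    Finset.sum_congr rfl fun i hi => by rw [h i (Finset.mem_range.1 hi)]]
  have h2 : (ε k : ℝ) + 1 ≤ ε' k := by exact_mod_cast hlt
  have := mul_le_mul_of_nonneg_right h2 (P.weight_nonneg hk)
  linarith

end Automaton

/-! ### Counting finite words -/

/-- The number of legal words of length `m` read from the state `s`. -/
def cnt (β : Coeff) : ℕ → ℕ → ℕ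
  | 0, _ => 1
  | m + 1, s => β s * cnt β m 0 + cnt β m (s + 1)

section Count

variable {β ε ε' : Coeff}

theorem cnt_pos (m s : ℕ) : 0 < cnt β m s := by
  induction m generalizing s with
  | zero => exact Nat.one_pos
  | succ m ih => exact Nat.add_pos_right _ (ih _)

theorem cnt_strictMono (h0 : 0 < β 0) : StrictMono fun m => cnt β m 0 :=
  strictMono_nat_of_lt_succ fun m => by
    have h1 := cnt_pos (β := β) m 1
    have h2 := Nat.le_mul_of_pos_left (cnt β m 0) h0
    simp only [cnt, zero_add]
    omega

theorem cnt_potential (β : Coeff) (n : ℕ) :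
    Potential β (fun k => (cnt β (n - 1 - k) 0 : ℝ)) (fun s k => (cnt β (n - k) s : ℝ)) n where
  step s k hk := by
    have e : n - k = n - 1 - k + 1 := by omega
    rw [e, cnt, show n - (k + 1) = n - 1 - k by omega]
    push_cast; rfl
  zero k hk := by rw [show n - (k + 1) = n - 1 - k by omega]
  nonneg s k := Nat.cast_nonneg _

/-- The value of the first `n` digits of `ε`, with weights the numbers of shorter words. -/
def wordValue (β : Coeff) (n : ℕ) (ε : Coeff) : ℕ :=
  ∑ i ∈ Finset.range n, ε i * cnt β (n - 1 - i) 0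

/-- The extra 1 is the remaining potential at the end of the word: there is one empty word. -/
theorem wordValue_add_one_le (hε : Legal β 0 ε) {n k : ℕ} (hk : k ≤ n) :
    (wordValue β n ε : ℝ) + 1 ≤ potential β (fun k => (cnt β (n - 1 - k) 0 : ℝ))
      (fun s k => (cnt β (n - k) s : ℝ)) ε k := by
  refine le_trans (le_of_eq ?_) ((cnt_potential β n).antitone hε hk le_rfl)
  simp [wordValue, potential, cnt]

theorem wordValue_lt (hε : Legal β 0 ε) (n : ℕ) : wordValue β n ε < cnt β n 0 := by
  have := wordValue_add_one_le hε (Nat.zero_le n)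
  simp only [potential, Finset.range_zero, Finset.sum_empty, zero_add, state_zero,
    Nat.sub_zero] at this
  exact_mod_cast this

theorem wordValue_lt_wordValue (hε : Legal β 0 ε) (hε' : Legal β 0 ε') {n k : ℕ} (hk : k < n)
    (h : ∀ j < k, ε j = ε' j) (hlt : ε k < ε' k) : wordValue β n ε < wordValue β n ε' := by
  have h1 := wordValue_add_one_le hε (n := n) (k := k + 1) hk
  have h2 := (cnt_potential β n).le_of_lt hε' hk h hlt
  have h3 : ∑ i ∈ Finset.range (k + 1), (ε' i : ℝ) * (cnt β (n - 1 - i) 0 : ℝ) ≤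
      wordValue β n ε' := by
    rw [wordValue]
    push_cast
    exact Finset.sum_le_sum_of_subset_of_nonneg (Finset.range_subset_range.2 hk)
      fun _ _ _ => by positivity
  have : (wordValue β n ε : ℝ) + 1 ≤ wordValue β n ε' := by linarith
  exact_mod_cast this

theorem wordValue_cons (n d : ℕ) (ε : Coeff) :
    wordValue β (n + 1) (cons d ε) = d * cnt β n 0 + wordValue β n ε := by
  rw [wordValue, Finset.sum_range_succ', add_comm]
  refine congrArg₂ (· + ·) (by simp [cons]) (Finset.sum_congr rfl fun i _ => ?_)
  rw [cons, show n + 1 - 1 - (i + 1) = n - 1 - i by omega]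

/-- The construction follows the recursion of `cnt`: below `β s * cnt β n 0` division with remainder
gives a smaller first digit and a reset, and the other values take the digit `β s` and advance the
state. -/
theorem exists_wordValue_eq (n s x : ℕ) (hx : x < cnt β n s) :
    ∃ ε, Legal β s ε ∧ (∀ k, n ≤ k → ε k = 0) ∧ wordValue β n ε = x := by
  induction n generalizing s x with
  | zero =>
    exact ⟨0, legal_zero, fun _ _ => rfl, by simp only [cnt] at hx; simp [wordValue]; omega⟩
  | succ n ih =>
    have key : ∀ d s' y, y < cnt β n s' → d * cnt β n 0 + y = x →
        (∀ ε, Legal β s' ε → Legal β s (cons d ε)) →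
        ∃ ε, Legal β s ε ∧ (∀ k, n + 1 ≤ k → ε k = 0) ∧ wordValue β (n + 1) ε = x := by
      intro d s' y hy hxy hl
      obtain ⟨ε, h1, h2, h3⟩ := ih s' y hy
      refine ⟨cons d ε, hl ε h1, fun k hk => ?_, by rw [wordValue_cons, h3, hxy]⟩
      obtain ⟨k, rfl⟩ := Nat.exists_eq_add_of_le' (show 1 ≤ k by omega)
      exact h2 k (by omega)
    rw [cnt] at hx
    rcases lt_or_ge x (β s * cnt β n 0) with h | h
    · exact key (x / cnt β n 0) 0 (x % cnt β n 0) (Nat.mod_lt _ (cnt_pos n 0))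
        (by rw [mul_comm]; exact Nat.div_add_mod _ _)
        fun ε => legal_cons_of_lt (Nat.div_lt_of_lt_mul (by rwa [mul_comm]))
    · exact key (β s) (s + 1) (x - β s * cnt β n 0) (by omega) (by omega)
        fun ε => legal_cons_of_eq rfl

end Count

/-! ### Decomposition into blocks -/

section Runs

variable {β ε : Coeff}

/-- The digits of `ε` read since the last reset before `k`, up to position `k`. -/
def run (β ε : Coeff) (k : ℕ) : Coeff := fun t => if k - state β ε 0 k ≤ t ∧ t ≤ k then ε t else 0

theorem run_disjoint {S : Set ℕ} (hS : ∀ k ∈ S, ∀ k' ∈ S, k < k' → ε k < β (state β ε 0 k))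
    {k k' : ℕ} (hk : k ∈ S) (hk' : k' ∈ S) (hne : k ≠ k') :
    Disjoint (Set.Icc (k - state β ε 0 k) k) (Set.Icc (k' - state β ε 0 k') k') := by
  wlog h : k < k' generalizing k k'
  · exact (this hk' hk hne.symm (by omega)).symm
  have h1 := state_le_of_reset (hS k hk k' hk' h) h
  rw [Set.disjoint_left]
  rintro t ⟨_, h2⟩ ⟨h3, _⟩
  omega

/-- Between `t` and the first element of `S` at or after `t` there is no reset, so the run ending at
that element reaches back over `t`. -/
theorem exists_mem_run {S : Set ℕ} (hε : Legal β 0 ε)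
    (hS : ∀ k, ε k < β (state β ε 0 k) → (∃ k' ∈ S, k ≤ k') → k ∈ S) {t : ℕ}
    (ht : ∃ k ∈ S, t ≤ k) :
    ∃ k ∈ S, k - state β ε 0 k ≤ t ∧ t ≤ k := by
  classical
  have ht' : ∃ k, k ∈ S ∧ t ≤ k := ht
  obtain ⟨h1, h2⟩ := Nat.find_spec ht'
  refine ⟨Nat.find ht', h1, ?_, h2⟩
  obtain ⟨i, hi⟩ := Nat.exists_eq_add_of_le h2
  rw [hi, state_of_no_reset]
  · have := state_le (β := β) (ε := ε) t
    omega
  · intro u hu hu'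
    by_contra hne
    exact Nat.find_min ht' (m := u) (by omega)
      ⟨hS u (lt_of_le_of_ne (hε u) hne) ⟨_, h1, by omega⟩, hu⟩

theorem run_eq {k t : ℕ} (h1 : k - state β ε 0 k ≤ t) (h2 : t < k) :
    run β ε k t = β (t - (k - state β ε 0 k)) := by
  rw [run, if_pos ⟨h1, h2.le⟩]; exact ((state_run k).2 t h1 h2).1

theorem run_self (k : ℕ) : run β ε k k = ε k := if_pos ⟨by omega, le_rfl⟩

end Runs

/-! ### The periodic reference sequence and the reversal of digits -/

theorem betaStar_zero_pos {L : List ℕ} (hL : IsAdmissible L) : 0 < betaStar L 0 := by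
  simpa [betaStar] using Nat.pos_of_ne_zero hL.2

theorem betaStar_add_length (L : List ℕ) (k : ℕ) :
    betaStar L (k + L.length) = betaStar L k := by simp [betaStar]

theorem exists_betaStar_pos {L : List ℕ} (hL : IsAdmissible L) (n : ℕ) :
    ∃ k ≥ n, 0 < betaStar L k := by
  refine ⟨n * L.length, Nat.le_mul_of_pos_right n (by have := hL.1; omega), ?_⟩
  have := betaStar_zero_pos hL
  simpa [betaStar] using this

theorem rev_apply_of_lt {n k : ℕ} (μ : Coeff) (h : k < n) : rev n μ k = μ (n - 1 - k) := if_pos h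

theorem rev_apply_of_le {n k : ℕ} (μ : Coeff) (h : n ≤ k) : rev n μ k = 0 := if_neg h.not_gt

theorem rev_rev (n : ℕ) (μ : Coeff) : rev n (rev n μ) = fun k => if k < n then μ k else 0 := by
  funext k
  rcases lt_or_ge k n with h | h
  · rw [rev_apply_of_lt _ h, rev_apply_of_lt _ (by omega), if_pos h]; congr 1; omega
  · rw [rev_apply_of_le _ h, if_neg h.not_gt]

theorem rev_rev_of_support {n : ℕ} {μ : Coeff} (h : ∀ k, n ≤ k → μ k = 0) :
    rev n (rev n μ) = μ := by
  rw [rev_rev]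
  funext k
  split_ifs with hk
  · rfl
  · exact (h k (by omega)).symm

theorem rev_succ {n : ℕ} {μ : Coeff} (h : μ n = 0) : rev (n + 1) μ = cons 0 (rev n μ) := by
  funext k
  cases k with
  | zero => simp [rev, cons, h]
  | succ k =>
    simp only [rev, cons, Nat.add_lt_add_iff_right]
    congr 2
    omega

theorem legal_cons_zero {β ε : Coeff} (h0 : 0 < β 0) : Legal β 0 (cons 0 ε) ↔ Legal β 0 ε := by
  refine ⟨fun h => ?_, legal_cons_of_lt h0⟩
  have := h.shift 1
  rwa [shift_one_cons, state_succ_of_lt (k := 0) h0] at this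

/-- A leading zero is itself a reset because `β 0` is positive, so padding does not affect legality.
-/
theorem legal_rev_iff {β μ : Coeff} (h0 : 0 < β 0) {n m : ℕ} (h : ∀ k, n ≤ k → μ k = 0)
    (hm : n ≤ m) : Legal β 0 (rev m μ) ↔ Legal β 0 (rev n μ) := by
  induction m, hm using Nat.le_induction with
  | base => rfl
  | succ m hm ih => rw [rev_succ (h m hm), legal_cons_zero h0, ih]

/-! ### Sums of blocks as reversed legal words -/

section Blocks

variable {L : List ℕ} {ζ : Coeff} {a p : ℕ}

theorem IsBlock.lt (h : IsBlock L ζ a p) : a < p := by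
  rcases h with h | h
  · exact h.1
  · rw [h.1]; exact h.2.1

theorem IsBlock.eq_zero (h : IsBlock L ζ a p) {t : ℕ} (ht : ¬ (a ≤ t ∧ t < p)) : ζ t = 0 := by
  have hap := h.lt
  rcases h with h | h
  · rcases lt_or_ge t a with h' | h'
    · exact h.2.2.2 t h'
    · rw [h.2.1 t (by omega), rev_apply_of_le _ (by omega)]
  · rw [h.2.2, rev_apply_of_le _ (by have := h.1; omega)]

theorem IsBlock.eq_of_lt (h : IsBlock L ζ a p) {t : ℕ} (h1 : a < t) (h2 : t < p) :
    ζ t = betaStar L (p - 1 - t) := by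
  rcases h with h | h
  · rw [h.2.1 t h1, rev_apply_of_lt _ h2]
  · rw [h.2.2, rev_apply_of_lt _ h2]

theorem IsBlock.apply_left (h : IsBlock L ζ a p) :
    ζ a < betaStar L (p - 1 - a) ∨ a = 0 ∧ ζ a = betaStar L (p - 1 - a) := by
  have hap := h.lt
  rcases h with h | h
  · left; have := h.2.2.1; rwa [rev_apply_of_lt _ hap] at this
  · right; exact ⟨h.1, by rw [h.2.2, rev_apply_of_lt _ hap]⟩

theorem IsBlock.apply_le (h : IsBlock L ζ a p) {t : ℕ} (h1 : a ≤ t) (h2 : t < p) :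
    ζ t ≤ betaStar L (p - 1 - t) := by
  rcases h1.eq_or_lt with rfl | h1
  · rcases h.apply_left with h | h
    · exact h.le
    · exact h.2.le
  · exact (h.eq_of_lt h1 h2).le

theorem legal_of_blocks (hL : IsAdmissible L) {s : ℕ} {ζ : Fin s → Coeff} {a p : Fin s → ℕ}
    (hb : ∀ i, IsBlock L (ζ i) (a i) (p i))
    (hd : ∀ i j, i ≠ j → Disjoint (Set.Ico (a i) (p i)) (Set.Ico (a j) (p j))) {n : ℕ}
    (hn : ∀ i, p i ≤ n) : Legal (betaStar L) 0 (rev n (∑ i, ζ i)) := by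
  have hin : ∀ i t, a i ≤ t → t < p i → (∑ i, ζ i) t = ζ i t := by
    intro i t h1 h2
    rw [Finset.sum_apply]
    refine Finset.sum_eq_single i (fun j _ hj => (hb j).eq_zero fun h => ?_) (by simp)
    exact Set.disjoint_left.1 (hd i j hj.symm) ⟨h1, h2⟩ h
  have hout : ∀ t, (∀ i, ¬ (a i ≤ t ∧ t < p i)) → (∑ i, ζ i) t = 0 := by
    intro t h
    rw [Finset.sum_apply]
    exact Finset.sum_eq_zero fun i _ => (hb i).eq_zero (h i)
  -- The automaton follows the blocks: inside a block the state counts the digits of that block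
  -- already read, and outside all blocks it is 0.
  have hst : ∀ k, k < n →
      (∀ i, a i ≤ n - 1 - k → n - 1 - k < p i →
        state (betaStar L) (rev n (∑ i, ζ i)) 0 k = p i - 1 - (n - 1 - k)) ∧
      ((∀ i, ¬ (a i ≤ n - 1 - k ∧ n - 1 - k < p i)) →
        state (betaStar L) (rev n (∑ i, ζ i)) 0 k = 0) := by
    intro k
    induction k with
    | zero =>
      intro hk
      refine ⟨fun i h1 h2 => ?_, fun _ => rfl⟩
      have := hn i
      rw [state_zero]; omega
    | succ k ih =>
      intro hk
      obtain ⟨ih1, ih2⟩ := ih (by omega)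
      have hrev := rev_apply_of_lt (∑ i, ζ i) (show k < n by omega)
      set t := n - 1 - (k + 1) with ht
      have et : n - 1 - k = t + 1 := by omega
      rw [et] at ih1 ih2 hrev
      have hreset : (∀ i, a i ≤ t + 1 → t + 1 < p i → ¬ a i ≤ t) →
          state (betaStar L) (rev n (∑ i, ζ i)) 0 (k + 1) = 0 := by
        intro h
        apply state_succ_of_lt
        rw [hrev]
        by_cases hc : ∃ i, a i ≤ t + 1 ∧ t + 1 < p i
        · obtain ⟨i, h1, h2⟩ := hc
          rw [ih1 i h1 h2, hin i _ h1 h2]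
          have h3 := h i h1 h2
          have h4 : a i = t + 1 := by omega
          rcases (hb i).apply_left with h5 | h5
          · rwa [h4] at h5
          · omega
        · rw [hout _ fun i hi => hc ⟨i, hi⟩, ih2 fun i hi => hc ⟨i, hi⟩]
          exact betaStar_zero_pos hL
      refine ⟨fun i h1 h2 => ?_, fun h => hreset fun i _ h2 h3 => h i ⟨h3, by omega⟩⟩
      rcases eq_or_ne (t + 1) (p i) with h3 | h3
      · rw [hreset fun j hj1 hj2 hj3 => ?_]
        · omega
        · have : j ≠ i := by rintro rfl; omega
          exact Set.disjoint_left.1 (hd j i this) (show t ∈ _ from ⟨hj3, by omega⟩) ⟨h1, h2⟩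
      · have h4 := ih1 i (by omega) (by omega)
        rw [state_succ_of_eq, h4]
        · omega
        · rw [hrev, h4, hin i _ (by omega) (by omega), (hb i).eq_of_lt (by omega) (by omega)]
  intro k
  rcases lt_or_ge k n with hk | hk
  · rw [rev_apply_of_lt _ hk]
    by_cases hc : ∃ i, a i ≤ n - 1 - k ∧ n - 1 - k < p i
    · obtain ⟨i, h1, h2⟩ := hc
      rw [hin i _ h1 h2, (hst k hk).1 i h1 h2]
      exact (hb i).apply_le h1 h2
    · rw [hout _ fun i hi => hc ⟨i, hi⟩]; exact Nat.zero_le _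
  · rw [rev_apply_of_le _ hk]; exact Nat.zero_le _

/-- The blocks are the runs between resets. A run ending in a reset is a proper block; the last run
may end without one, and since it then reaches the lowest index it is the maximal block. -/
theorem mem_collection_of_legal {n : ℕ} {μ : Coeff} (hμ : ∀ k, n ≤ k → μ k = 0)
    (h : Legal (betaStar L) 0 (rev n μ)) : μ ∈ collection L := by
  classical
  set β := betaStar L with hβ
  set ε := rev n μ with hε
  set S : Finset ℕ := (Finset.range n).filter fun k => ε k < β (state β ε 0 k) ∨ k + 1 = n with hS
  have hmem : ∀ k, k ∈ S ↔ k < n ∧ (ε k < β (state β ε 0 k) ∨ k + 1 = n) := by simp [hS]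
  have hS1 : ∀ k ∈ (S : Set ℕ), ∀ k' ∈ (S : Set ℕ), k < k' → ε k < β (state β ε 0 k) := by
    intro k hk k' hk' hlt
    rw [Finset.mem_coe, hmem] at hk hk'
    rcases hk.2 with h | h
    · exact h
    · omega
  have hS2 : ∀ k, ε k < β (state β ε 0 k) → (∃ k' ∈ (S : Set ℕ), k ≤ k') → k ∈ (S : Set ℕ) := by
    rintro k hk ⟨k', hk', hle⟩
    rw [Finset.mem_coe, hmem] at hk' ⊢
    exact ⟨by omega, Or.inl hk⟩
  let e := S.equivFin.symm
  refine ⟨S.card, fun i => rev n (run β ε (e i)), fun i => n - 1 - (e i : ℕ),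
    fun i => n - ((e i : ℕ) - state β ε 0 (e i)), fun i => ?_, fun i j hij => ?_, ?_⟩
  · have hi := (hmem _).1 (e i).2
    dsimp only
    generalize (e i : ℕ) = k at hi ⊢
    have hle := state_le (β := β) (ε := ε) k
    have hout : ∀ j, ¬ (n - 1 - k ≤ j ∧ j < n - (k - state β ε 0 k)) →
        rev n (run β ε k) j = 0 := by
      intro j hj
      rw [rev]
      split_ifs with hjn
      · exact if_neg (by omega)
      · rfl
    have hin : ∀ j, n - 1 - k < j → rev n (run β ε k) j =
        rev (n - (k - state β ε 0 k)) β j := by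
      intro j hj
      rcases lt_or_ge j (n - (k - state β ε 0 k)) with h' | h'
      · rw [rev_apply_of_lt _ h', rev_apply_of_lt _ (by omega), run_eq (by omega) (by omega)]
        congr 1; omega
      · rw [rev_apply_of_le _ h', hout j (by omega)]
    have hk : rev n (run β ε k) (n - 1 - k) = ε k := by
      rw [rev_apply_of_lt _ (by omega), show n - 1 - (n - 1 - k) = k by omega, run_self]
    have hst : rev (n - (k - state β ε 0 k)) β (n - 1 - k) = β (state β ε 0 k) := by
      rw [rev_apply_of_lt _ (by omega)]; congr 1; omega
    by_cases hr : ε k < β (state β ε 0 k)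
    · exact Or.inl ⟨by omega, hin, by rw [hk, hst]; exact hr, fun j hj => hout j (by omega)⟩
    · have hkn : k + 1 = n := by tauto
      refine Or.inr ⟨by omega, by omega, funext fun j => ?_⟩
      rcases Nat.eq_zero_or_pos j with rfl | hj
      · have e0 : n - 1 - k = 0 := by omega
        rw [e0] at hk hst
        rw [hk, hst]
        exact le_antisymm (h k) (not_lt.1 hr)
      · exact hin j (by omega)
  · have hne : (e i : ℕ) ≠ e j := fun h' => hij (e.injective (Subtype.ext h'))
    have h1 := run_disjoint hS1 (e i).2 (e j).2 hne
    have hi := ((hmem _).1 (e i).2).1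
    have hj := ((hmem _).1 (e j).2).1
    dsimp only
    rw [Set.disjoint_left] at h1 ⊢
    rintro t ⟨ht1, ht2⟩ ⟨ht3, ht4⟩
    refine h1 (a := n - 1 - t) ⟨by omega, by omega⟩ ⟨by omega, by omega⟩
  · funext t
    have hsum : (∑ i, rev n (run β ε (e i))) t = ∑ k ∈ S, rev n (run β ε k) t := by
      rw [Finset.sum_apply, ← Finset.sum_coe_sort S]
      exact Equiv.sum_comp e fun k : S => rev n (run β ε k) t
    rw [hsum]
    rcases lt_or_ge t n with ht | ht
    · obtain ⟨k, hk, h1, h2⟩ := exists_mem_run (t := n - 1 - t) h hS2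
        ⟨n - 1, by rw [Finset.mem_coe, hmem]; omega, by omega⟩
      rw [Finset.sum_eq_single k]
      · rw [rev_apply_of_lt _ ht, run, if_pos ⟨h1, h2⟩, hε, rev_apply_of_lt _ (by omega)]
        congr 1; omega
      · intro k' hk' hne
        rw [rev_apply_of_lt _ ht]
        exact if_neg fun h' => Set.disjoint_left.1 (run_disjoint hS1 hk' hk hne) h' ⟨h1, h2⟩
      · exact fun h' => absurd hk h'
    · rw [hμ t ht]
      exact (Finset.sum_eq_zero fun k _ => rev_apply_of_le _ ht).symm

theorem mem_collection_iff (hL : IsAdmissible L) {μ : Coeff} :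
    μ ∈ collection L ↔ ∃ n, (∀ k, n ≤ k → μ k = 0) ∧ Legal (betaStar L) 0 (rev n μ) := by
  refine ⟨?_, fun ⟨n, h1, h2⟩ => mem_collection_of_legal h1 h2⟩
  rintro ⟨s, ζ, a, p, hb, hd, rfl⟩
  have hn : ∀ i, p i ≤ Finset.univ.sup p := fun i => Finset.le_sup (Finset.mem_univ i)
  refine ⟨_, fun k hk => ?_, legal_of_blocks hL hb hd hn⟩
  rw [Finset.sum_apply]
  exact Finset.sum_eq_zero fun i _ => (hb i).eq_zero (by have := hn i; omega)

theorem legal_rev_of_mem (hL : IsAdmissible L) {μ : Coeff} (h : μ ∈ collection L) {n : ℕ}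
    (hn : ∀ k, n ≤ k → μ k = 0) : Legal (betaStar L) 0 (rev n μ) := by
  obtain ⟨m, h1, h2⟩ := (mem_collection_iff hL).1 h
  have h0 := betaStar_zero_pos hL
  rw [← legal_rev_iff h0 hn (le_max_left n m), legal_rev_iff h0 h1 (le_max_right n m)]
  exact h2

theorem exists_support_bound (hL : IsAdmissible L) {μ : Coeff} (h : μ ∈ collection L) :
    ∃ n, ∀ k, n ≤ k → μ k = 0 :=
  let ⟨n, h1, _⟩ := (mem_collection_iff hL).1 h
  ⟨n, h1⟩

/-! ### Blocks for the unit interval -/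

/-- Every proper block ends in a reset and a zero outside the blocks is also a reset, so resets
never stop. Conversely, if they never stop, every position lies in a run that ends in a reset, and
these runs are the blocks. -/
theorem mem_collectionStar_iff (hL : IsAdmissible L) {ε : Coeff} :
    ε ∈ collectionStar L ↔ ε ≠ 0 ∧ Legal (betaStar L) 0 ε ∧
      ∀ n, ∃ k ≥ n, ε k < betaStar L (state (betaStar L) ε 0 k) := by
  set β := betaStar L with hβ
  refine and_congr_right fun _ => ⟨?_, ?_⟩
  · rintro ⟨S, ζ, m, k, hb, hd, hsum⟩
    have hblk : ∀ i ∈ S, ∀ t, m i ≤ t → t < k i → ζ i t = β (t - m i) := fun i hi t h1 h2 => by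
      rw [(hb i hi).2.1 t h2, maxBlockStar, if_neg h1.not_gt]
    have hlast : ∀ i ∈ S, ζ i (k i) < β (k i - m i) := fun i hi => by
      have := (hb i hi).2.2.1
      rwa [maxBlockStar, if_neg (hb i hi).1.not_gt] at this
    have hzero : ∀ i ∈ S, ∀ t, ¬ (m i ≤ t ∧ t ≤ k i) → ζ i t = 0 := fun i hi t ht => by
      rcases lt_or_ge (k i) t with h | h
      · exact (hb i hi).2.2.2 t h
      · rw [(hb i hi).2.1 t (by have := (hb i hi).1; omega), maxBlockStar, if_pos (by omega)]
    have hin : ∀ i ∈ S, ∀ t, m i ≤ t → t ≤ k i → ε t = ζ i t := fun i hi t h1 h2 => by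
      rw [hsum, finsum_eq_single _ i]
      · simp [hi]
      · intro j hj
        by_cases hjS : j ∈ S
        · simp only [hjS, finsum_true]
          exact hzero j hjS t fun h => Set.disjoint_left.1 (hd i hi j hjS hj.symm) ⟨h1, h2⟩ h
        · simp [hjS]
    have hout : ∀ t, (∀ i ∈ S, ¬ (m i ≤ t ∧ t ≤ k i)) → ε t = 0 := fun t h => by
      rw [hsum]
      exact finsum_mem_eq_zero_of_forall_eq_zero fun i hi => hzero i hi t (h i hi)
    have hst : ∀ t, (∀ i ∈ S, m i ≤ t → t ≤ k i → state β ε 0 t = t - m i) ∧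
        ((∀ i ∈ S, ¬ (m i ≤ t ∧ t ≤ k i)) → state β ε 0 t = 0) := by
      intro t
      induction t with
      | zero => exact ⟨fun i _ h1 _ => by rw [state_zero]; omega, fun _ => rfl⟩
      | succ t ih =>
        obtain ⟨ih1, ih2⟩ := ih
        have hreset : (∀ i ∈ S, m i ≤ t → t ≤ k i → t = k i) → state β ε 0 (t + 1) = 0 := by
          intro h
          apply state_succ_of_lt
          by_cases hc : ∃ i ∈ S, m i ≤ t ∧ t ≤ k i
          · obtain ⟨i, hi, h1, h2⟩ := hc
            rw [ih1 i hi h1 h2, hin i hi t h1 h2, h i hi h1 h2]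
            exact hlast i hi
          · rw [hout t fun i hi h' => hc ⟨i, hi, h'⟩, ih2 fun i hi h' => hc ⟨i, hi, h'⟩]
            exact betaStar_zero_pos hL
        refine ⟨fun i hi h1 h2 => ?_, fun h => hreset fun i hi h1 h2 => ?_⟩
        · rcases eq_or_lt_of_le h1 with h3 | h3
          · rw [hreset fun j hj hj1 hj2 => ?_]
            · omega
            · by_contra hne
              have : j ≠ i := by rintro rfl; omega
              exact Set.disjoint_left.1 (hd j hj i hi this)
                (show t + 1 ∈ _ from ⟨by omega, by omega⟩) ⟨h1, h2⟩
          · have h4 := ih1 i hi (by omega) (by omega)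
            rw [state_succ_of_eq, h4]
            · omega
            · rw [h4, hin i hi t (by omega) (by omega), hblk i hi t (by omega) (by omega)]
        · by_contra hne
          exact h i hi ⟨by omega, by omega⟩
    refine ⟨fun t => ?_, fun n => ?_⟩
    · by_cases hc : ∃ i ∈ S, m i ≤ t ∧ t ≤ k i
      · obtain ⟨i, hi, h1, h2⟩ := hc
        rw [(hst t).1 i hi h1 h2, hin i hi t h1 h2]
        rcases h2.eq_or_lt with rfl | h2
        · exact (hlast i hi).le
        · exact (hblk i hi t h1 h2).le
      · rw [hout t fun i hi h' => hc ⟨i, hi, h'⟩]; exact Nat.zero_le _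
    · by_cases hc : ∃ i ∈ S, m i ≤ n ∧ n ≤ k i
      · obtain ⟨i, hi, h1, h2⟩ := hc
        refine ⟨k i, h2, ?_⟩
        rw [(hst (k i)).1 i hi (by omega) le_rfl, hin i hi _ (by omega) le_rfl]
        exact hlast i hi
      · refine ⟨n, le_rfl, ?_⟩
        rw [hout n fun i hi h' => hc ⟨i, hi, h'⟩, (hst n).2 fun i hi h' => hc ⟨i, hi, h'⟩]
        exact betaStar_zero_pos hL
  · rintro ⟨h, hfreq⟩
    set S : Set ℕ := {k | ε k < β (state β ε 0 k)} with hS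
    have hS1 : ∀ k ∈ S, ∀ k' ∈ S, k < k' → ε k < β (state β ε 0 k) := fun k hk _ _ _ => hk
    refine ⟨S, run β ε, fun k => k - state β ε 0 k, fun k => k, fun k hk => ?_,
      fun i hi j hj => run_disjoint hS1 hi hj, fun t => ?_⟩
    · have hle := state_le (β := β) (ε := ε) k
      dsimp only
      refine ⟨by omega, fun j hj => ?_, ?_, fun j hj => if_neg (by omega)⟩
      · rw [maxBlockStar]
        split_ifs with h'
        · exact if_neg (by omega)
        · exact run_eq (by omega) hj
      · rw [run_self, maxBlockStar, if_neg (by omega), Nat.sub_sub_self hle]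
        exact hk
    · obtain ⟨k₀, hk₀, hk₀'⟩ := hfreq t
      obtain ⟨k, hk, h1, h2⟩ := exists_mem_run (S := S) h (fun k hk _ => hk) ⟨k₀, hk₀', hk₀⟩
      rw [finsum_eq_single _ k]
      · simp [hk, run, h1, h2]
      · intro k' hne
        by_cases hk' : k' ∈ S
        · simp only [hk', finsum_true]
          exact if_neg fun h' => Set.disjoint_left.1 (run_disjoint hS1 hk' hk hne) h' ⟨h1, h2⟩
        · simp [hk']

end Blocks

/-! ### The order of the collection for the positive integers -/

theorem ltA_iff_ltD_rev {n : ℕ} {μ ν : Coeff} (hμ : ∀ k, n ≤ k → μ k = 0)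
    (hν : ∀ k, n ≤ k → ν k = 0) : LtA μ ν ↔ LtD (rev n μ) (rev n ν) := by
  constructor
  · rintro ⟨k, hk, hlt⟩
    have hkn : k < n := by
      by_contra h
      rw [hν k (by omega)] at hlt
      omega
    refine ⟨n - 1 - k, fun j hj => ?_, ?_⟩
    · rw [rev_apply_of_lt _ (by omega), rev_apply_of_lt _ (by omega), hk _ (by omega)]
    · rw [rev_apply_of_lt _ (by omega), rev_apply_of_lt _ (by omega),
        show n - 1 - (n - 1 - k) = k by omega]
      exact hlt
  · rintro ⟨k, hk, hlt⟩
    have hkn : k < n := by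
      by_contra h
      rw [rev_apply_of_le ν (by omega)] at hlt
      omega
    rw [rev_apply_of_lt _ hkn, rev_apply_of_lt _ hkn] at hlt
    refine ⟨n - 1 - k, fun j hj => ?_, hlt⟩
    rcases lt_or_ge j n with hjn | hjn
    · have := hk (n - 1 - j) (by omega)
      rwa [rev_apply_of_lt _ (by omega), rev_apply_of_lt _ (by omega),
        show n - 1 - (n - 1 - j) = j by omega] at this
    · rw [hμ j hjn, hν j hjn]

theorem rev_injOn {n : ℕ} {μ ν : Coeff} (hμ : ∀ k, n ≤ k → μ k = 0)
    (hν : ∀ k, n ≤ k → ν k = 0) (h : rev n μ = rev n ν) : μ = ν := by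
  rw [← rev_rev_of_support hμ, ← rev_rev_of_support hν, h]

theorem ltA_asymm {μ ν : Coeff} (h : LtA μ ν) : ¬ LtA ν μ := by
  rintro ⟨k', hk', hlt'⟩
  obtain ⟨k, hk, hlt⟩ := h
  rcases lt_trichotomy k k' with h | rfl | h
  · have := hk k' h; omega
  · omega
  · have := hk' k h; omega

theorem evalNat_eq_sum {n : ℕ} {μ : Coeff} (H : ℕ → ℕ) (h : ∀ k, n ≤ k → μ k = 0) :
    evalNat H μ = ∑ k ∈ Finset.range n, μ k * H k := by
  refine finsum_eq_sum_of_support_subset _ fun k hk => ?_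
  by_contra hkn
  exact hk (by simp [h k (by simpa using hkn)])

theorem evalNat_zero (H : ℕ → ℕ) : evalNat H 0 = 0 := by
  rw [evalNat_eq_sum (n := 0) (μ := 0) H fun _ _ => rfl]; rfl

theorem evalNat_cnt {n : ℕ} {μ : Coeff} (β : Coeff) (h : ∀ k, n ≤ k → μ k = 0) :
    evalNat (fun m => cnt β m 0) μ = wordValue β n (rev n μ) := by
  rw [evalNat_eq_sum _ h, ← Finset.sum_range_reflect, wordValue]
  refine Finset.sum_congr rfl fun i hi => ?_
  rw [rev_apply_of_lt _ (Finset.mem_range.1 hi)]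

section Collection

variable {L : List ℕ}

theorem exists_common_bound (hL : IsAdmissible L) {μ ν : Coeff} (hμ : μ ∈ collection L)
    (hν : ν ∈ collection L) :
    ∃ n, (∀ k, n ≤ k → μ k = 0) ∧ ∀ k, n ≤ k → ν k = 0 := by
  obtain ⟨n, hn⟩ := exists_support_bound hL hμ
  obtain ⟨m, hm⟩ := exists_support_bound hL hν
  exact ⟨max n m, fun k hk => hn k (by omega), fun k hk => hm k (by omega)⟩

theorem ltA_trichotomy (hL : IsAdmissible L) {μ ν : Coeff} (hμ : μ ∈ collection L)
    (hν : ν ∈ collection L) : LtA μ ν ∨ μ = ν ∨ LtA ν μ := by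
  obtain ⟨n, h1, h2⟩ := exists_common_bound hL hμ hν
  rw [ltA_iff_ltD_rev h1 h2, ltA_iff_ltD_rev h2 h1]
  rcases ltD_trichotomy (rev n μ) (rev n ν) with h | h | h
  · exact Or.inl h
  · exact Or.inr (Or.inl (rev_injOn h1 h2 h))
  · exact Or.inr (Or.inr h)

theorem evalNat_lt_of_ltA (hL : IsAdmissible L) {μ ν : Coeff} (hμ : μ ∈ collection L)
    (hν : ν ∈ collection L) (h : LtA μ ν) :
    evalNat (fun m => cnt (betaStar L) m 0) μ < evalNat (fun m => cnt (betaStar L) m 0) ν := by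
  obtain ⟨n, h1, h2⟩ := exists_common_bound hL hμ hν
  obtain ⟨k, hk, hlt⟩ := (ltA_iff_ltD_rev h1 h2).1 h
  rw [evalNat_cnt _ h1, evalNat_cnt _ h2]
  refine wordValue_lt_wordValue (legal_rev_of_mem hL hμ h1) (legal_rev_of_mem hL hν h2) ?_ hk hlt
  by_contra hkn
  rw [rev_apply_of_le ν (by omega)] at hlt
  omega

theorem evalNat_lt_iff (hL : IsAdmissible L) {μ ν : Coeff} (hμ : μ ∈ collection L)
    (hν : ν ∈ collection L) :
    evalNat (fun m => cnt (betaStar L) m 0) μ < evalNat (fun m => cnt (betaStar L) m 0) ν ↔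
      LtA μ ν := by
  refine ⟨fun h => ?_, evalNat_lt_of_ltA hL hμ hν⟩
  rcases ltA_trichotomy hL hμ hν with h' | rfl | h'
  · exact h'
  · exact absurd h (lt_irrefl _)
  · exact absurd h (evalNat_lt_of_ltA hL hν hμ h').asymm

theorem evalNat_injOn (hL : IsAdmissible L) :
    Set.InjOn (evalNat fun m => cnt (betaStar L) m 0) (collection L) := by
  intro μ hμ ν hν h
  rcases ltA_trichotomy hL hμ hν with h' | h' | h'
  · exact absurd h (evalNat_lt_of_ltA hL hμ hν h').ne
  · exact h'
  · exact absurd h (evalNat_lt_of_ltA hL hν hμ h').ne'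

theorem exists_evalNat_eq (hL : IsAdmissible L) (x : ℕ) :
    ∃ μ ∈ collection L, evalNat (fun m => cnt (betaStar L) m 0) μ = x := by
  have hx : x < cnt (betaStar L) (x + 1) 0 :=
    Nat.lt_of_succ_le ((cnt_strictMono (betaStar_zero_pos hL)).id_le (x + 1))
  obtain ⟨ε, h1, h2, h3⟩ := exists_wordValue_eq (x + 1) 0 x hx
  have h4 : ∀ k, x + 1 ≤ k → rev (x + 1) ε k = 0 := fun k hk => rev_apply_of_le _ hk
  refine ⟨rev (x + 1) ε, mem_collection_of_legal h4 ?_, ?_⟩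
  · rwa [rev_rev_of_support h2]
  · rw [evalNat_cnt _ h4, rev_rev_of_support h2, h3]

theorem isFundamentalSeq_cnt (hL : IsAdmissible L) :
    IsFundamentalSeq (collection L) fun m => cnt (betaStar L) m 0 := by
  refine ⟨cnt_strictMono (betaStar_zero_pos hL), fun k => cnt_pos k 0, fun x _ => ?_⟩
  obtain ⟨μ, hμ, h⟩ := exists_evalNat_eq hL x
  exact ⟨μ, ⟨hμ, h⟩, fun ν hν => evalNat_injOn hL hν.1 hμ (hν.2.trans h.symm)⟩

theorem legal_single {β : Coeff} (h0 : 0 < β 0) : Legal β 0 (cons 1 0) := by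
  refine legal_of_shift (m := 1) (fun i hi => ?_) ?_
  · obtain rfl : i = 0 := by omega
    exact h0
  · rw [shift_one_cons]; exact legal_zero

theorem single_mem_collection (hL : IsAdmissible L) (k : ℕ) :
    (Pi.single k 1 : Coeff) ∈ collection L := by
  refine mem_collection_of_legal (n := k + 1) (fun j hj => ?_) ?_
  · exact Pi.single_eq_of_ne (by omega) _
  · convert legal_single (betaStar_zero_pos hL) using 1
    funext j
    cases j with
    | zero => simp [rev, cons]
    | succ j =>
      rw [cons, Pi.zero_apply, rev]
      split_ifs with h
      · exact Pi.single_eq_of_ne (by omega) _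
      · rfl

theorem evalNat_single (H : ℕ → ℕ) (k : ℕ) : evalNat H (Pi.single k 1) = H k := by
  rw [evalNat_eq_sum (n := k + 1) H fun j hj => Pi.single_eq_of_ne (by omega) _,
    Finset.sum_range_succ, Finset.sum_eq_zero fun j hj => ?_]
  · simp
  · rw [Pi.single_eq_of_ne (Finset.mem_range.1 hj).ne, zero_mul]

/-- If `H k < G k`, the expansion of `H k` in `G` uses only indices below `k`, where the two
sequences agree. It is then a second expansion of `H k` in `H`, besides the single digit 1 at `k`.
-/
theorem IsFundamentalSeq.not_lt (hL : IsAdmissible L) {G H : ℕ → ℕ}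
    (hG : IsFundamentalSeq (collection L) G) (hH : IsFundamentalSeq (collection L) H) {k : ℕ}
    (h : ∀ j < k, G j = H j) : ¬ H k < G k := by
  intro hlt
  obtain ⟨μ, ⟨hμ, hμG⟩, _⟩ := hG.2.2 (H k) (hH.2.1 k)
  obtain ⟨n, hn⟩ := exists_support_bound hL hμ
  have hsupp : ∀ j, k ≤ j → μ j = 0 := by
    intro j hj
    by_contra hne
    have hjn : j ∈ Finset.range n := by
      rw [Finset.mem_range]; by_contra h'; exact hne (hn j (by omega))
    have h1 : μ j * G j ≤ H k := by
      rw [← hμG, evalNat_eq_sum G hn]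
      exact Finset.single_le_sum (f := fun i => μ i * G i) (fun _ _ => Nat.zero_le _) hjn
    have h2 := Nat.le_mul_of_pos_left (G j) (Nat.pos_of_ne_zero hne)
    have h3 := hG.1.monotone hj
    omega
  have hμH : evalNat H μ = H k := by
    rw [← hμG, evalNat_eq_sum G hsupp, evalNat_eq_sum H hsupp]
    exact Finset.sum_congr rfl fun j hj => by rw [h j (Finset.mem_range.1 hj)]
  have := (hH.2.2 (H k) (hH.2.1 k)).unique ⟨hμ, hμH⟩
    ⟨single_mem_collection hL k, evalNat_single H k⟩
  have := hsupp k le_rfl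
  simp_all

theorem fundSeq_eq (hL : IsAdmissible L) : fundSeq L = fun m => cnt (betaStar L) m 0 := by
  have hH := isFundamentalSeq_cnt hL
  have hG : IsFundamentalSeq (collection L) (fundSeq L) := Classical.epsilon_spec ⟨_, hH⟩
  funext k
  induction k using Nat.strong_induction_on with
  | _ k ih =>
    exact le_antisymm (not_lt.1 (hG.not_lt hL hH ih))
      (not_lt.1 (hH.not_lt hL hG fun j hj => (ih j hj).symm))

/-! ### Ceilings in the collection -/

/-- `c` is the smallest member of `E` that is not below `μ`. -/
def IsCeil (E : Set Coeff) (μ c : Coeff) : Prop := c ∈ E ∧ ∀ τ ∈ E, LtA τ μ ↔ LtA τ c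

/-- Evaluation identifies the collection with ℕ, so the largest member below `μ` is the one whose
value is one less than that of `c`; it exists because `c` is nonzero. Both choices in the definition
of `bar` are unique. -/
theorem bar_eq_of_isCeil (hL : IsAdmissible L) {μ c : Coeff} (h : IsCeil (collection L) μ c)
    (h0 : c ≠ 0) : bar (collection L) μ = c := by
  obtain ⟨hc, hiff⟩ := h
  set e := evalNat fun m => cnt (betaStar L) m 0 with he
  have hz : (0 : Coeff) ∈ collection L := mem_collection_of_legal (n := 0) (fun _ _ => rfl)
    (by convert legal_zero using 1; funext k; simp [rev])
  have hpos : 0 < e c := Nat.pos_of_ne_zero fun h =>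
    h0 (evalNat_injOn hL hc hz (h.trans (evalNat_zero _).symm))
  obtain ⟨ν, hν, hνe⟩ := exists_evalNat_eq hL (e c - 1)
  have hlt : LtA ν c := (evalNat_lt_iff hL hν hc).1 (by
    simp only [he] at hpos hνe; omega)
  have hlarge : IsLargestBelow (collection L) μ ν := by
    refine ⟨hν, (hiff ν hν).2 hlt, fun τ hτ hτμ => ?_⟩
    have h1 := evalNat_lt_of_ltA hL hτ hc ((hiff τ hτ).1 hτμ)
    rcases ltA_trichotomy hL hτ hν with h | h | h
    · exact Or.inr h
    · exact Or.inl h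
    · have h2 := evalNat_lt_of_ltA hL hν hτ h
      simp only [he] at hpos hνe; omega
  have hsucc : IsImmediateSucc (collection L) ν c := by
    refine ⟨hc, hlt, fun τ hτ hντ => ?_⟩
    have h1 := evalNat_lt_of_ltA hL hν hτ hντ
    rcases ltA_trichotomy hL hτ hc with h | h | h
    · have h2 := evalNat_lt_of_ltA hL hτ hc h
      simp only [he] at hpos hνe; omega
    · exact Or.inl h
    · exact Or.inr h
  obtain ⟨ν', h1, h2⟩ : ∃ ν, IsLargestBelow (collection L) μ ν ∧
      IsImmediateSucc (collection L) ν (bar (collection L) μ) :=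
    Classical.epsilon_spec (p := fun ν' => ∃ ν, IsLargestBelow (collection L) μ ν ∧
      IsImmediateSucc (collection L) ν ν') ⟨c, ν, hlarge, hsucc⟩
  have hνν' : ν' = ν := by
    rcases hlarge.2.2 ν' h1.1 h1.2.1 with h | h
    · exact h
    · rcases h1.2.2 ν hν hlarge.2.1 with h' | h'
      · exact h'.symm
      · exact absurd h' (ltA_asymm h)
  subst hνν'
  rcases hsucc.2.2 _ h2.1 h2.2.1 with h | h
  · exact h
  · rcases h2.2.2 c hc hlt with h' | h'
    · exact h'.symm
    · exact absurd h' (ltA_asymm h)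

/-- The integers counted correspond to the members of the smaller collection below `μ`, that is,
below `c`. Evaluated in their own fundamental sequence, these fill an initial segment of ℕ of length
the value of `c`. -/
theorem zCount_eq_of_isCeil {L' : List ℕ} (hL : IsAdmissible L) (hL' : IsAdmissible L')
    (hsub : collection L ⊆ collection L') {μ c : Coeff} (hμ : μ ∈ collection L')
    (h : IsCeil (collection L) μ c) :
    zCount L L' (evalNat (fundSeq L') μ) = evalNat (fundSeq L) c := by
  obtain ⟨hc, hiff⟩ := h
  rw [zCount, fundSeq_eq hL, fundSeq_eq hL']
  have h1 : {m : ℕ | m < evalNat (fun m => cnt (betaStar L') m 0) μ ∧ ∃ ε ∈ collection L,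
      evalNat (fun m => cnt (betaStar L') m 0) ε = m} =
      (evalNat fun m => cnt (betaStar L') m 0) '' {ε | ε ∈ collection L ∧ LtA ε c} := by
    ext m
    constructor
    · rintro ⟨hm, ε, hε, rfl⟩
      exact ⟨ε, ⟨hε, (hiff ε hε).1 ((evalNat_lt_iff hL' (hsub hε) hμ).1 hm)⟩, rfl⟩
    · rintro ⟨ε, ⟨hε, hlt⟩, rfl⟩
      exact ⟨evalNat_lt_of_ltA hL' (hsub hε) hμ ((hiff ε hε).2 hlt), ε, hε, rfl⟩
  have h2 : (evalNat fun m => cnt (betaStar L) m 0) '' {ε | ε ∈ collection L ∧ LtA ε c} =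
      Finset.range (evalNat (fun m => cnt (betaStar L) m 0) c) := by
    ext m
    rw [Finset.coe_range, Set.mem_Iio]
    constructor
    · rintro ⟨ε, ⟨hε, hlt⟩, rfl⟩
      exact evalNat_lt_of_ltA hL hε hc hlt
    · intro hm
      obtain ⟨ε, hε, rfl⟩ := exists_evalNat_eq hL m
      exact ⟨ε, ⟨hε, (evalNat_lt_iff hL hε hc).1 hm⟩, rfl⟩
  rw [h1, ((evalNat_injOn hL').mono fun ε hε => hsub hε.1).ncard_image,
    ← ((evalNat_injOn hL).mono fun ε hε => hε.1).ncard_image, h2,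
    Set.ncard_coe_finset, Finset.card_range]

end Collection

/-! ### Expansions of real numbers -/

/-- The geometric sequence `ω, ω², …`. -/
def geo (ω : ℝ) : ℕ → ℝ := fun k => ω ^ (k + 1)

/-- The digits `β` expand `1` in the base `ω⁻¹`. -/
structure IsBase (β : Coeff) (ω : ℝ) : Prop where
  bdd : ∃ B, ∀ k, β k ≤ B
  freq : ∀ n, ∃ k ≥ n, 0 < β k
  omega_pos : 0 < ω
  omega_lt_one : ω < 1
  sum : evalReal (geo ω) β = 1

theorem summable_digits {ω : ℝ} (h0 : 0 ≤ ω) (h1 : ω < 1) {ε : Coeff} {B : ℕ}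
    (hB : ∀ k, ε k ≤ B) : Summable fun k => (ε k : ℝ) * geo ω k := by
  refine Summable.of_nonneg_of_le (fun k => ?_) (fun k => ?_)
    (((summable_geometric_of_lt_one h0 h1).mul_left ω).mul_left (B : ℝ))
  · exact mul_nonneg (Nat.cast_nonneg _) (pow_nonneg h0 _)
  · rw [geo, pow_succ']
    exact mul_le_mul_of_nonneg_right (by exact_mod_cast hB k) (by positivity)

theorem Legal.apply_le {β ε : Coeff} {s B : ℕ} (hB : ∀ k, β k ≤ B) (h : Legal β s ε) (k : ℕ) :
    ε k ≤ B := (h k).trans (hB _)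

theorem evalReal_geo_shift {ω : ℝ} {ε : Coeff}
    (h : Summable fun k => (ε k : ℝ) * geo ω k) (m : ℕ) :
    evalReal (geo ω) ε =
      ∑ i ∈ Finset.range m, (ε i : ℝ) * geo ω i + ω ^ m * evalReal (geo ω) (shift m ε) := by
  rw [evalReal, ← h.sum_add_tsum_nat_add m, evalReal, ← tsum_mul_left]
  congr 2
  funext k
  rw [shift, geo, geo, add_comm m k]
  ring

theorem evalReal_geo_cons_zero (ω : ℝ) (ε : Coeff) :
    evalReal (geo ω) (cons 0 ε) = ω * evalReal (geo ω) ε := by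
  rw [evalReal, evalReal, ← tsum_mul_left]
  by_cases h : Summable fun k => (cons 0 ε k : ℝ) * geo ω k
  · rw [h.tsum_eq_zero_add]
    simp only [cons, Nat.cast_zero, zero_mul, zero_add]
    exact tsum_congr fun k => by simp only [geo]; ring
  -- Summability is not assumed: if one series diverges so does the other, and both sums take the
  -- default value 0.
  · have h' : ¬ Summable fun k => ω * ((ε k : ℝ) * geo ω k) := by
      intro hs
      apply h
      rw [← summable_nat_add_iff 1]
      exact hs.congr fun k => by simp only [cons, geo]; ring
    rw [tsum_eq_zero_of_not_summable h, tsum_eq_zero_of_not_summable h']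

/-! ### Monotonicity and existence of real expansions -/

section Base

variable {β ε ε' : Coeff} {ω : ℝ}

/-- The value of the reference sequence from position `s` on. -/
def tailValue (β : Coeff) (ω : ℝ) (s : ℕ) : ℝ := evalReal (geo ω) (shift s β)

theorem shift_shift (m n : ℕ) (ε : Coeff) : shift m (shift n ε) = shift (n + m) ε := by
  funext k; simp [shift, add_assoc]

namespace IsBase

theorem geo_pos (b : IsBase β ω) (k : ℕ) : 0 < geo ω k := pow_pos b.omega_pos _

theorem summable (b : IsBase β ω) {s : ℕ} (h : Legal β s ε) :
    Summable fun k => (ε k : ℝ) * geo ω k :=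
  let ⟨_, hB⟩ := b.bdd
  summable_digits b.omega_pos.le b.omega_lt_one (h.apply_le hB)

theorem summable_shift (b : IsBase β ω) (s : ℕ) :
    Summable fun k => (shift s β k : ℝ) * geo ω k :=
  let ⟨_, hB⟩ := b.bdd
  summable_digits b.omega_pos.le b.omega_lt_one fun k => hB (s + k)

theorem evalReal_nonneg (b : IsBase β ω) (ε : Coeff) : 0 ≤ evalReal (geo ω) ε :=
  tsum_nonneg fun k => mul_nonneg (Nat.cast_nonneg _) (b.geo_pos k).le

theorem tailValue_succ (b : IsBase β ω) (s : ℕ) :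
    tailValue β ω s = ω * (β s + tailValue β ω (s + 1)) := by
  rw [tailValue, evalReal_geo_shift (b.summable_shift s) 1, shift_shift, tailValue]
  simp [geo, shift]
  ring

theorem tailValue_zero (b : IsBase β ω) : tailValue β ω 0 = 1 := by
  rw [tailValue, ← b.sum]
  congr 1
  funext k
  simp [shift]

theorem tailValue_pos (b : IsBase β ω) (s : ℕ) : 0 < tailValue β ω s := by
  obtain ⟨k, hk, hpos⟩ := b.freq s
  obtain ⟨i, rfl⟩ := Nat.exists_eq_add_of_le hk
  refine (b.summable_shift s).tsum_pos
    (fun k => mul_nonneg (Nat.cast_nonneg _) (b.geo_pos k).le) i ?_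
  exact mul_pos (by exact_mod_cast hpos) (b.geo_pos i)

theorem isPotential (b : IsBase β ω) (n : ℕ) :
    Potential β (geo ω) (fun s k => ω ^ k * tailValue β ω s) n where
  step s k _ := by simp only [b.tailValue_succ s, geo]; ring
  zero k _ := by simp only [b.tailValue_zero, geo, mul_one]
  nonneg s k := mul_nonneg (pow_nonneg b.omega_pos.le _) (b.tailValue_pos s).le

/-- The value of the first `k` digits plus the largest value that the others can have. -/
def upper (β : Coeff) (ω : ℝ) (ε : Coeff) (k : ℕ) : ℝ :=
  potential β (geo ω) (fun s k => ω ^ k * tailValue β ω s) ε k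

theorem evalReal_le_upper (b : IsBase β ω) (h : Legal β 0 ε) (k : ℕ) :
    evalReal (geo ω) ε ≤ upper β ω ε k := by
  refine le_of_tendsto (b.summable h).hasSum.tendsto_sum_nat ?_
  filter_upwards [eventually_ge_atTop k] with m hm
  refine le_trans ?_ ((b.isPotential m).antitone h hm le_rfl)
  exact le_add_of_nonneg_right ((b.isPotential m).nonneg _ _)

/-- The reset at `m` gives up a tail of `β`, whose value is positive because `β` is nonzero
infinitely often. -/
theorem evalReal_lt_upper (b : IsBase β ω) (h : Legal β 0 ε) {k m : ℕ} (hm : k ≤ m)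
    (hr : ε m < β (state β ε 0 m)) : evalReal (geo ω) ε < upper β ω ε k := by
  have h1 := b.evalReal_le_upper h (m + 1)
  have h2 := (b.isPotential (m + 1)).succ_of_lt (Nat.lt_succ_self m) hr
  have h3 := (b.isPotential (m + 1)).antitone h hm (Nat.le_succ m)
  have h4 : 0 < ω ^ (m + 1) * tailValue β ω (state β ε 0 m + 1) :=
    mul_pos (pow_pos b.omega_pos _) (b.tailValue_pos _)
  unfold upper at h1 ⊢
  linarith

theorem upper_zero (b : IsBase β ω) (ε : Coeff) : upper β ω ε 0 = 1 := by
  simp [upper, potential, b.tailValue_zero]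

theorem upper_le_of_lt (b : IsBase β ω) (h' : Legal β 0 ε') {k : ℕ}
    (heq : ∀ j < k, ε j = ε' j) (hlt : ε k < ε' k) :
    upper β ω ε (k + 1) ≤ evalReal (geo ω) ε' := by
  refine ((b.isPotential (k + 1)).le_of_lt h' (Nat.lt_succ_self k) heq hlt).trans ?_
  exact (b.summable h').sum_le_tsum _ fun i _ => mul_nonneg (Nat.cast_nonneg _) (b.geo_pos i).le

theorem evalReal_le_one (b : IsBase β ω) (h : Legal β 0 ε) : evalReal (geo ω) ε ≤ 1 :=
  (b.evalReal_le_upper h 0).trans_eq (b.upper_zero ε)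

theorem evalReal_mono (b : IsBase β ω) (h : Legal β 0 ε) (h' : Legal β 0 ε')
    (hle : toLex ε ≤ toLex ε') : evalReal (geo ω) ε ≤ evalReal (geo ω) ε' := by
  rcases hle.eq_or_lt with heq | hlt
  · rw [toLex.injective heq]
  · obtain ⟨k, h1, h2⟩ : LtD ε ε' := hlt
    exact (b.evalReal_le_upper h (k + 1)).trans (b.upper_le_of_lt h' h1 h2)

/-- Infinitely many resets in the smaller sequence exclude a tail `β`, which could have the same
value as a carry. -/
theorem evalReal_strictMono (b : IsBase β ω) (h : Legal β 0 ε) (h' : Legal β 0 ε')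
    (hr : ∀ n, ∃ k ≥ n, ε k < β (state β ε 0 k)) (hlt : LtD ε ε') :
    evalReal (geo ω) ε < evalReal (geo ω) ε' := by
  obtain ⟨k, h1, h2⟩ := hlt
  obtain ⟨m, hm, hm'⟩ := hr (k + 1)
  exact (b.evalReal_lt_upper h hm hm').trans_le (b.upper_le_of_lt h' h1 h2)

theorem tailValue_le (b : IsBase β ω) : ∃ K, ∀ s, tailValue β ω s ≤ K := by
  obtain ⟨B, hB⟩ := b.bdd
  refine ⟨∑' k, (B : ℝ) * geo ω k, fun s => ?_⟩
  refine (b.summable_shift s).tsum_le_tsum (fun k => ?_)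
    (summable_digits (ε := fun _ => B) b.omega_pos.le b.omega_lt_one fun _ => le_rfl)
  exact mul_le_mul_of_nonneg_right (by exact_mod_cast hB _) (b.geo_pos k).le

end IsBase

/-- The state and the rescaled remainder after `k` steps of the greedy expansion of `y`. -/
def greedy (β : Coeff) (ω y : ℝ) : ℕ → ℕ × ℝ
  | 0 => (0, y)
  | k + 1 => if (β (greedy β ω y k).1 : ℝ) ≤ (greedy β ω y k).2 / ω then
      ((greedy β ω y k).1 + 1, (greedy β ω y k).2 / ω - β (greedy β ω y k).1)
    else (0, (greedy β ω y k).2 / ω - ⌊(greedy β ω y k).2 / ω⌋₊)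

/-- The digits of the greedy expansion of `y`. -/
def greedyDigit (β : Coeff) (ω y : ℝ) : Coeff := fun k =>
  min (β (greedy β ω y k).1) ⌊(greedy β ω y k).2 / ω⌋₊

namespace IsBase

/-- The greedy algorithm keeps the rescaled remainder nonnegative and strictly below the value of
the tail of `β` from the current state. The bounds give convergence; the strictness gives infinitely
many resets. -/
theorem exists_expansion (b : IsBase β ω) {y : ℝ} (hy : y ∈ Set.Ioo (0 : ℝ) 1) :
    ∃ ε, Legal β 0 ε ∧ (∀ n, ∃ k ≥ n, ε k < β (state β ε 0 k)) ∧
      evalReal (geo ω) ε = y := by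
  set g := greedy β ω y with hg
  set d := greedyDigit β ω y with hd
  have hω := b.omega_pos
  have hinv : ∀ k, 0 ≤ (g k).2 ∧ (g k).2 < tailValue β ω (g k).1 := by
    intro k
    induction k with
    | zero => exact ⟨hy.1.le, by rw [show (g 0).1 = 0 from rfl, b.tailValue_zero]; exact hy.2⟩
    | succ k ih =>
      have h1 : (g k).2 / ω < β (g k).1 + tailValue β ω ((g k).1 + 1) := by
        rw [div_lt_iff₀ hω, mul_comm, ← b.tailValue_succ]; exact ih.2
      have h2 : g (k + 1) = _ := greedy.eq_2 β ω y k
      rw [← hg] at h2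
      rw [h2]
      split_ifs with h
      · exact ⟨by linarith, by linarith⟩
      · have h3 := Nat.floor_le (div_nonneg ih.1 hω.le)
        have h4 := Nat.lt_floor_add_one ((g k).2 / ω)
        refine ⟨by linarith, ?_⟩
        rw [b.tailValue_zero]
        linarith
  have hcase : ∀ k, (d k = β (g k).1 ∧ g (k + 1) = ((g k).1 + 1, (g k).2 / ω - d k)) ∨
      (d k < β (g k).1 ∧ g (k + 1) = (0, (g k).2 / ω - d k)) := by
    intro k
    have h2 : g (k + 1) = _ := greedy.eq_2 β ω y k
    rw [← hg] at h2
    have hdk : d k = min (β (g k).1) ⌊(g k).2 / ω⌋₊ := rfl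
    by_cases h : (β (g k).1 : ℝ) ≤ (g k).2 / ω
    · left
      rw [if_pos h] at h2
      have : d k = β (g k).1 := by rw [hdk, min_eq_left (Nat.le_floor h)]
      exact ⟨this, by rw [h2, this]⟩
    · right
      rw [if_neg h] at h2
      have h3 : ⌊(g k).2 / ω⌋₊ < β (g k).1 :=
        (Nat.floor_lt (div_nonneg (hinv k).1 hω.le)).2 (not_le.1 h)
      have : d k = ⌊(g k).2 / ω⌋₊ := by rw [hdk, min_eq_right h3.le]
      exact ⟨this ▸ h3, by rw [h2, this]⟩
  have hstate : ∀ k, state β d 0 k = (g k).1 := by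
    intro k
    induction k with
    | zero => rfl
    | succ k ih =>
      rcases hcase k with ⟨h1, h2⟩ | ⟨h1, h2⟩
      · rw [state_succ_of_eq (by rw [ih]; exact h1), ih, h2]
      · rw [state_succ_of_lt (by rw [ih]; exact h1), h2]
  have hlegal : Legal β 0 d := fun k => by
    rw [hstate]
    exact (hcase k).elim (fun h => h.1.le) fun h => h.1.le
  have hrem : ∀ k, y = ∑ i ∈ Finset.range k, (d i : ℝ) * geo ω i + ω ^ k * (g k).2 := by
    intro k
    induction k with
    | zero => simp [hg, greedy]
    | succ k ih =>
      have : (g (k + 1)).2 = (g k).2 / ω - d k := by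
        rcases hcase k with ⟨_, h2⟩ | ⟨_, h2⟩ <;> rw [h2]
      rw [Finset.sum_range_succ, this, geo, ih]
      field_simp
      ring
  have hval : evalReal (geo ω) d = y := by
    obtain ⟨K, hK⟩ := b.tailValue_le
    refine tendsto_nhds_unique (b.summable hlegal).hasSum.tendsto_sum_nat ?_
    have h1 : Tendsto (fun k => ω ^ k * (g k).2) atTop (𝓝 0) := by
      refine squeeze_zero (fun k => mul_nonneg (pow_nonneg hω.le _) (hinv k).1)
        (fun k => mul_le_mul_of_nonneg_left ((hinv k).2.le.trans (hK _)) (pow_nonneg hω.le _)) ?_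
      simpa using (tendsto_pow_atTop_nhds_zero_of_lt_one hω.le b.omega_lt_one).mul_const K
    have h2 := (tendsto_const_nhds (x := y)).sub h1
    rw [sub_zero] at h2
    refine h2.congr fun k => ?_
    have := hrem k
    linarith
  refine ⟨d, hlegal, fun n => ?_, hval⟩
  -- If resets stopped at `n`, the remaining digits would be a tail of `β` and the remainder would
  -- equal `tailValue`, against the strict invariant.
  by_contra hno
  push Not at hno
  have heq : ∀ k, n ≤ k → d k = β (state β d 0 k) := fun k hk => le_antisymm (hlegal k) (hno k hk)
  have hshift : shift n d = shift (g n).1 β := by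
    funext i
    have := heq (n + i) (by omega)
    rw [state_of_no_reset fun t h1 _ => heq t h1, hstate] at this
    exact this
  have h1 := evalReal_geo_shift (b.summable hlegal) n
  rw [hval, hshift] at h1
  have h2 := hrem n
  have h3 := mul_lt_mul_of_pos_left (hinv n).2 (pow_pos hω n)
  rw [tailValue] at h3
  linarith

end IsBase

end Base

/-! ### Averaging recurrences -/

section Averaging

variable {N : ℕ} {p a : ℕ → ℝ}

/-- Each new term gives weight `p 0` to its predecessor and averages terms at most `hi` otherwise,
so at least the fraction `p 0` of the gap below `hi` survives each step. The recurrence is required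
only up to `K`, so that reversed finite segments are covered. -/
theorem averaging_upper (hp : ∀ k, 0 ≤ p k) (hN : 0 < N) (hsum : ∑ k ∈ Finset.range N, p k = 1)
    {K i : ℕ} (hrec : ∀ n < K, a (n + N) = ∑ k ∈ Finset.range N, p k * a (n + N - 1 - k))
    {hi : ℝ} (hw : ∀ j < N, a (i + j) ≤ hi) (j : ℕ) (hj : i + j ≤ K) :
    a (i + (N - 1) + j) ≤ hi - p 0 ^ j * (hi - a (i + (N - 1))) := by
  induction j using Nat.strong_induction_on with
  | _ j ih =>
    cases j with
    | zero => simp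
    | succ j =>
      have hle : ∀ m, i ≤ m → m ≤ i + (N - 1) + j → a m ≤ hi := by
        intro m h1 h2
        rcases lt_or_ge m (i + N) with h | h
        · have := hw (m - i) (by omega)
          rwa [Nat.add_sub_cancel' h1] at this
        · have := ih (m - (i + (N - 1))) (by omega) (by omega)
          rw [Nat.add_sub_cancel' (by omega)] at this
          have h3 := mul_nonneg (pow_nonneg (hp 0) (m - (i + (N - 1))))
            (sub_nonneg.2 (hw (N - 1) (by omega)))
          linarith
      rw [show i + (N - 1) + (j + 1) = i + j + N by omega, hrec _ (by omega)]
      obtain ⟨M, rfl⟩ := Nat.exists_eq_add_of_le' (show 1 ≤ N from hN)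
      rw [Finset.sum_range_succ'] at hsum ⊢
      have h1 : ∑ k ∈ Finset.range M, p (k + 1) * a (i + j + (M + 1) - 1 - (k + 1)) ≤
          ∑ k ∈ Finset.range M, p (k + 1) * hi :=
        Finset.sum_le_sum fun k hk => mul_le_mul_of_nonneg_left
          (hle _ (by have := Finset.mem_range.1 hk; omega) (by omega)) (hp _)
      rw [← Finset.sum_mul] at h1
      have h2 := mul_le_mul_of_nonneg_left (ih j (by omega) (by omega)) (hp 0)
      rw [show i + j + (M + 1) - 1 - 0 = i + (M + 1 - 1) + j by omega, pow_succ]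
      have h3 : ∑ k ∈ Finset.range M, p (k + 1) = 1 - p 0 := by linarith
      rw [h3] at h1
      nlinarith

theorem averaging_lower (hp : ∀ k, 0 ≤ p k) (hN : 0 < N) (hsum : ∑ k ∈ Finset.range N, p k = 1)
    {K i : ℕ} (hrec : ∀ n < K, a (n + N) = ∑ k ∈ Finset.range N, p k * a (n + N - 1 - k))
    {lo : ℝ} (hw : ∀ j < N, lo ≤ a (i + j)) (j : ℕ) (hj : i + j ≤ K) :
    lo + p 0 ^ j * (a (i + (N - 1)) - lo) ≤ a (i + (N - 1) + j) := by
  have := averaging_upper (a := fun n => -a n) hp hN hsum (K := K) (i := i) (hi := -lo)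
    (fun n hn => by
      rw [hrec n hn, ← Finset.sum_neg_distrib]
      exact Finset.sum_congr rfl fun k _ => by ring)
    (fun j hj => neg_le_neg (hw j hj)) j hj
  linarith

/-- The last term of a window pulls all terms of the next one towards itself from both sides,
shrinking the range by the factor `1 - p 0 ^ N`. -/
theorem averaging_window (hp : ∀ k, 0 ≤ p k) (hN : 0 < N)
    (hsum : ∑ k ∈ Finset.range N, p k = 1) {K : ℕ}
    (hrec : ∀ n < K, a (n + N) = ∑ k ∈ Finset.range N, p k * a (n + N - 1 - k))
    {lo hi : ℝ} (hw : ∀ j < N, lo ≤ a j ∧ a j ≤ hi) (J : ℕ) (hJ : J * N ≤ K) :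
    ∃ lo' hi', lo ≤ lo' ∧ hi' ≤ hi ∧ hi' - lo' ≤ (1 - p 0 ^ N) ^ J * (hi - lo) ∧
      ∀ j < N, lo' ≤ a (J * N + j) ∧ a (J * N + j) ≤ hi' := by
  have hp1 : p 0 ≤ 1 := by
    rw [← hsum]
    exact Finset.single_le_sum (fun k _ => hp k) (Finset.mem_range.2 hN)
  induction J with
  | zero => exact ⟨lo, hi, le_rfl, le_rfl, by simp, by simpa using hw⟩
  | succ J ih =>
    rw [Nat.succ_mul] at hJ
    obtain ⟨lo', hi', h1, h2, h3, h4⟩ := ih (by omega)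
    set x := a (J * N + (N - 1)) with hx
    have hx' := h4 (N - 1) (by omega)
    rw [← hx] at hx'
    refine ⟨lo' + p 0 ^ N * (x - lo'), hi' - p 0 ^ N * (hi' - x), ?_, ?_, ?_, fun j hj => ?_⟩
    · have := mul_nonneg (pow_nonneg (hp 0) N) (sub_nonneg.2 hx'.1)
      linarith
    · have := mul_nonneg (pow_nonneg (hp 0) N) (sub_nonneg.2 hx'.2)
      linarith
    · have h5 := mul_le_mul_of_nonneg_left h3 (sub_nonneg.2 (pow_le_one₀ (n := N) (hp 0) hp1))
      rw [pow_succ]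
      linarith
    · have e : (J + 1) * N + j = J * N + (N - 1) + (j + 1) := by rw [Nat.succ_mul]; omega
      have h5 := averaging_upper hp hN hsum hrec (fun j hj => (h4 j hj).2) (j + 1) (by omega)
      have h6 := averaging_lower hp hN hsum hrec (fun j hj => (h4 j hj).1) (j + 1) (by omega)
      rw [e]
      rw [← hx] at h5 h6
      have h7 : p 0 ^ N ≤ p 0 ^ (j + 1) := pow_le_pow_of_le_one (hp 0) hp1 hj
      have h8 := mul_le_mul_of_nonneg_right h7 (sub_nonneg.2 hx'.1)
      have h9 := mul_le_mul_of_nonneg_right h7 (sub_nonneg.2 hx'.2)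
      exact ⟨by linarith, by linarith⟩

theorem tendsto_contraction (hp : ∀ k, 0 ≤ p k) (hp0 : 0 < p 0) (hN : 0 < N)
    (hsum : ∑ k ∈ Finset.range N, p k = 1) (C : ℝ) :
    Tendsto (fun J : ℕ => (1 - p 0 ^ N) ^ J * C) atTop (𝓝 0) := by
  have hp1 : p 0 ≤ 1 := by
    rw [← hsum]
    exact Finset.single_le_sum (fun k _ => hp k) (Finset.mem_range.2 hN)
  have h1 := pow_pos hp0 N
  have h2 := pow_le_one₀ (n := N) (hp 0) hp1
  simpa using (tendsto_pow_atTop_nhds_zero_of_lt_one (r := 1 - p 0 ^ N) (by linarith)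
    (by linarith)).mul_const C

/-- A positive solution of an averaging recurrence has a positive limit. -/
theorem exists_tendsto_of_averaging (hp : ∀ k, 0 ≤ p k) (hp0 : 0 < p 0) (hN : 0 < N)
    (hsum : ∑ k ∈ Finset.range N, p k = 1)
    (hrec : ∀ n, a (n + N) = ∑ k ∈ Finset.range N, p k * a (n + N - 1 - k))
    (ha : ∀ n, 0 < a n) : ∃ α, 0 < α ∧ Tendsto a atTop (𝓝 α) := by
  have hne : (Finset.range N).Nonempty := Finset.nonempty_range_iff.2 hN.ne'
  obtain ⟨i, -, hi⟩ := Finset.exists_min_image (Finset.range N) a hne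
  obtain ⟨i', -, hi'⟩ := Finset.exists_max_image (Finset.range N) a hne
  have hw : ∀ j < N, a i ≤ a j ∧ a j ≤ a i' := fun j hj =>
    ⟨hi j (Finset.mem_range.2 hj), hi' j (Finset.mem_range.2 hj)⟩
  have key : ∀ J, ∃ lo' hi', a i ≤ lo' ∧ hi' - lo' ≤ (1 - p 0 ^ N) ^ J * (a i' - a i) ∧
      ∀ m ≥ J * N, lo' ≤ a m ∧ a m ≤ hi' := by
    intro J
    obtain ⟨lo', hi', h1, -, h3, h4⟩ :=
      averaging_window hp hN hsum (K := J * N) (fun n _ => hrec n) hw J le_rfl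
    refine ⟨lo', hi', h1, h3, fun m hm => ?_⟩
    rcases lt_or_ge m (J * N + N) with h | h
    · have := h4 (m - J * N) (by omega)
      rwa [Nat.add_sub_cancel' hm] at this
    · have hx := h4 (N - 1) (by omega)
      have e : J * N + (N - 1) + (m - (J * N + (N - 1))) = m := by omega
      have h5 := averaging_upper hp hN hsum (K := m) (fun n _ => hrec n)
        (fun j hj => (h4 j hj).2) (m - (J * N + (N - 1))) (by omega)
      have h6 := averaging_lower hp hN hsum (K := m) (fun n _ => hrec n)
        (fun j hj => (h4 j hj).1) (m - (J * N + (N - 1))) (by omega)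
      rw [e] at h5 h6
      have h7 := mul_nonneg (pow_nonneg (hp 0) (m - (J * N + (N - 1)))) (sub_nonneg.2 hx.1)
      have h8 := mul_nonneg (pow_nonneg (hp 0) (m - (J * N + (N - 1)))) (sub_nonneg.2 hx.2)
      exact ⟨by linarith, by linarith⟩
  have hcauchy : CauchySeq a := by
    rw [Metric.cauchySeq_iff']
    intro δ hδ
    obtain ⟨J, hJ⟩ := ((tendsto_contraction hp hp0 hN hsum (a i' - a i)).eventually
      (gt_mem_nhds hδ)).exists
    obtain ⟨lo', hi', -, h3, h4⟩ := key J
    refine ⟨J * N, fun m hm => ?_⟩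
    have h5 := h4 m hm
    have h6 := h4 _ le_rfl
    rw [Real.dist_eq, abs_lt]
    exact ⟨by linarith, by linarith⟩
  obtain ⟨α, hα⟩ := cauchySeq_tendsto_of_complete hcauchy
  obtain ⟨lo', hi', h1, -, h4⟩ := key 0
  refine ⟨α, (ha i).trans_le (ge_of_tendsto' hα fun m => h1.trans (h4 m (by omega)).1), hα⟩

/-- A positive solution of a backward averaging recurrence is constant. -/
theorem eq_of_backward_averaging (hp : ∀ k, 0 ≤ p k) (hp0 : 0 < p 0) (hN : 2 ≤ N)
    (hsum : ∑ k ∈ Finset.range N, p k = 1) {b : ℕ → ℝ}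
    (hrec : ∀ n, b n = ∑ k ∈ Finset.range N, p k * b (n + 1 + k))
    (hb : ∀ n, 0 < b n) (n : ℕ) : b n = b 0 := by
  -- With the tail sums of the weights as coefficients, `S` is conserved by the recurrence. Since `r
  -- 0 = 1`, it bounds `b`.
  set r : ℕ → ℝ := fun k => ∑ j ∈ Finset.Ico k N, p j with hr
  set S : ℕ → ℝ := fun n => ∑ k ∈ Finset.range N, r k * b (n + k) with hS
  have hr0 : r 0 = 1 := by rw [hr, ← hsum, Finset.range_eq_Ico]
  have hrN : r N = 0 := by simp [hr]
  have hrs : ∀ k < N, r k = p k + r (k + 1) := fun k hk =>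
    Finset.sum_eq_sum_Ico_succ_bot hk p
  have hrpos : ∀ k, 0 ≤ r k := fun k => Finset.sum_nonneg fun j _ => hp j
  have hconst : ∀ n, S (n + 1) = S n := by
    intro n
    have h1 : S n + r N * b (n + N) =
        ∑ k ∈ Finset.range N, r (k + 1) * b (n + (k + 1)) + r 0 * b (n + 0) := by
      rw [← Finset.sum_range_succ' (fun k => r k * b (n + k)), Finset.sum_range_succ]
    rw [hrN, zero_mul, add_zero, hr0, one_mul, add_zero, hrec n, ← Finset.sum_add_distrib] at h1
    rw [h1]
    refine Finset.sum_congr rfl fun k hk => ?_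
    rw [hrs k (Finset.mem_range.1 hk), show n + (k + 1) = n + 1 + k by omega]
    ring
  have hS0 : ∀ n, S n = S 0 := by
    intro n
    induction n with
    | zero => rfl
    | succ n ih => rw [hconst, ih]
  have hbound : ∀ n, b n ≤ S 0 := by
    intro n
    rw [← hS0 n]
    have := Finset.single_le_sum (f := fun k => r k * b (n + k)) (s := Finset.range N)
      (fun k _ => mul_nonneg (hrpos k) (hb _).le) (Finset.mem_range.2 (show 0 < N by omega))
    simpa [hr0] using this
  have hstep : ∀ n, b (n + 1) = b n := by
    intro n
    have key : ∀ J : ℕ, |b (n + 1) - b n| ≤ (1 - p 0 ^ N) ^ J * (S 0 - 0) := by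
      intro J
      -- Read backwards from an arbitrarily distant index, `b` satisfies the forward recurrence with
      -- range at most `S 0`. The indices `n` and `n + 1` lie in one window because `N ≥ 2`.
      have hw := averaging_window (a := fun i => b (n + J * N + (N - 1) - i)) hp
        (by omega) hsum (K := J * N) (lo := 0) (hi := S 0) (fun i hi => ?_)
        (fun j _ => ⟨(hb _).le, hbound _⟩) J le_rfl
      · obtain ⟨lo', hi', -, -, h3, h4⟩ := hw
        have h5 := h4 (N - 1) (by omega)
        have h6 := h4 (N - 2) (by omega)
        rw [show n + J * N + (N - 1) - (J * N + (N - 1)) = n by omega] at h5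
        rw [show n + J * N + (N - 1) - (J * N + (N - 2)) = n + 1 by omega] at h6
        rw [abs_le]
        exact ⟨by linarith, by linarith⟩
      · rw [hrec]
        refine Finset.sum_congr rfl fun k hk => ?_
        have := Finset.mem_range.1 hk
        congr 2
        omega
    have h0 := ge_of_tendsto' (tendsto_contraction hp hp0 (by omega) hsum (S 0 - 0)) key
    exact sub_eq_zero.1 (abs_nonpos_iff.1 h0)
  induction n with
  | zero => rfl
  | succ n ih => rw [hstep, ih]

end Averaging

/-! ### The dominant zero -/

section Phi

variable {L : List ℕ}

theorem betaStar_of_lt {k : ℕ} (h : k < L.length) : betaStar L k = L.getD k 0 := by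
  rw [betaStar, Nat.mod_eq_of_lt h]

theorem charPoly_isRoot_iff (hL : IsAdmissible L) {x : ℝ} (hx : 0 < x) :
    (charPoly L).IsRoot x ↔
      ∑ k ∈ Finset.range L.length, (betaStar L k : ℝ) * geo x⁻¹ k + x⁻¹ ^ L.length = 1 := by
  obtain ⟨M, hM⟩ := Nat.exists_eq_add_of_le' (show 1 ≤ L.length by have := hL.1; omega)
  have hIcc : Finset.Icc 1 (L.length - 1) = Finset.Ico 1 (M + 1) := by
    ext k; simp only [Finset.mem_Icc, Finset.mem_Ico]; omega
  rw [Polynomial.IsRoot, charPoly, hIcc, Finset.sum_Ico_eq_sum_range]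
  simp only [Polynomial.eval_sub, Polynomial.eval_pow, Polynomial.eval_X,
    Polynomial.eval_finsetSum, Polynomial.eval_mul, Polynomial.eval_C]
  have h1 : ∑ k ∈ Finset.range (M + 1 - 1), (L.getD (1 + k - 1) 0 : ℝ) * x ^ (L.length - (1 + k)) =
      x ^ L.length * ∑ k ∈ Finset.range M, (betaStar L k : ℝ) * geo x⁻¹ k := by
    rw [Finset.mul_sum]
    refine Finset.sum_congr (by simp) fun k hk => ?_
    have hk' : k < L.length := by
      have := Finset.mem_range.1 hk
      omega
    rw [betaStar_of_lt hk', geo, show 1 + k - 1 = k by omega, inv_pow,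
      show x ^ L.length = x ^ (L.length - (1 + k)) * x ^ (k + 1) by
        rw [← pow_add]; congr 1; omega]
    field_simp
  have h2 : (1 + (L.getD (L.length - 1) 0 : ℝ)) =
      x ^ L.length * ((betaStar L M : ℝ) * geo x⁻¹ M + x⁻¹ ^ L.length) := by
    rw [betaStar_of_lt (by omega), geo, hM, inv_pow, Nat.add_sub_cancel]
    field_simp
    ring
  rw [h1, h2]
  conv_rhs => rw [hM, Finset.sum_range_succ, ← hM]
  have hxN := pow_pos hx L.length
  constructor
  · intro h
    have : x ^ L.length * (∑ k ∈ Finset.range M, (betaStar L k : ℝ) * geo x⁻¹ k +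
        (betaStar L M : ℝ) * geo x⁻¹ M + x⁻¹ ^ L.length - 1) = 0 := by linarith
    rcases mul_eq_zero.1 this with h' | h'
    · exact absurd h' hxN.ne'
    · linarith
  · intro h
    linear_combination (-x ^ L.length) * h

theorem exists_root (hL : IsAdmissible L) : ∃ x : ℝ, 0 < x ∧ (charPoly L).IsRoot x := by
  have hN : L.length ≠ 0 := by have := hL.1; omega
  set f : ℝ → ℝ := fun t =>
    ∑ k ∈ Finset.range L.length, (betaStar L k : ℝ) * geo t k + t ^ L.length with hf
  have hcont : ContinuousOn f (Set.Icc 0 1) := by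
    apply Continuous.continuousOn
    simp only [hf, geo]
    fun_prop
  have h0 : f 0 = 0 := by simp [hf, geo, hN]
  have h1 : 1 ≤ f 1 := by
    simp only [hf, geo, one_pow]
    have : 0 ≤ ∑ k ∈ Finset.range L.length, (betaStar L k : ℝ) * 1 :=
      Finset.sum_nonneg fun k _ => by positivity
    linarith
  obtain ⟨t, ht, hft⟩ := intermediate_value_Icc zero_le_one hcont
    (show (1 : ℝ) ∈ Set.Icc (f 0) (f 1) from ⟨by rw [h0]; exact zero_le_one, h1⟩)
  have htpos : 0 < t := lt_of_le_of_ne ht.1 (by rintro rfl; rw [h0] at hft; exact zero_ne_one hft)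
  refine ⟨t⁻¹, inv_pos.2 htpos, (charPoly_isRoot_iff hL (inv_pos.2 htpos)).2 ?_⟩
  rw [inv_inv]
  exact hft

theorem phi_spec (hL : IsAdmissible L) : 0 < phi L ∧ (charPoly L).IsRoot (phi L) :=
  Classical.epsilon_spec (exists_root hL)

theorem sum_betaStar_geo (hL : IsAdmissible L) :
    ∑ k ∈ Finset.range L.length, (betaStar L k : ℝ) * geo (phi L)⁻¹ k +
      (phi L)⁻¹ ^ L.length = 1 :=
  (charPoly_isRoot_iff hL (phi_spec hL).1).1 (phi_spec hL).2

theorem inv_phi_lt_one (hL : IsAdmissible L) : (phi L)⁻¹ < 1 := by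
  have hpos := inv_pos.2 (phi_spec hL).1
  by_contra h
  push Not at h
  have h1 := sum_betaStar_geo hL
  have hN : 0 < L.length := by have := hL.1; omega
  have h2 := Finset.single_le_sum (f := fun k => (betaStar L k : ℝ) * geo (phi L)⁻¹ k)
    (s := Finset.range L.length)
    (fun k _ => mul_nonneg (Nat.cast_nonneg _) (pow_nonneg hpos.le _)) (Finset.mem_range.2 hN)
  have h3 : (1 : ℝ) ≤ betaStar L 0 := by exact_mod_cast betaStar_zero_pos hL
  have h4 : 1 ≤ (phi L)⁻¹ ^ L.length := one_le_pow₀ h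
  simp only [geo, zero_add, pow_one] at h1 h2
  nlinarith

theorem betaStar_le (L : List ℕ) : ∃ B, ∀ k, betaStar L k ≤ B := by
  refine ⟨L.sum, fun k => ?_⟩
  rw [betaStar]
  rcases lt_or_ge (k % L.length) L.length with h | h
  · rw [List.getD_eq_getElem _ _ h]
    exact List.le_sum_of_mem (List.getElem_mem h)
  · rw [List.getD_eq_default _ _ h]; exact Nat.zero_le _

theorem shift_length_betaStar (L : List ℕ) : shift L.length (betaStar L) = betaStar L := by
  funext k
  rw [shift, add_comm, betaStar_add_length]

theorem isBase (hL : IsAdmissible L) : IsBase (betaStar L) (phi L)⁻¹ where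
  bdd := betaStar_le L
  freq := exists_betaStar_pos hL
  omega_pos := inv_pos.2 (phi_spec hL).1
  omega_lt_one := inv_phi_lt_one hL
  sum := by
    obtain ⟨B, hB⟩ := betaStar_le L
    have hpos := inv_pos.2 (phi_spec hL).1
    have h1 := evalReal_geo_shift (summable_digits hpos.le (inv_phi_lt_one hL) hB) L.length
    rw [shift_length_betaStar] at h1
    have h2 := sum_betaStar_geo hL
    have h3 := pow_lt_one₀ hpos.le (inv_phi_lt_one hL) (n := L.length)
      (by have := hL.1; omega)
    -- With ω the inverse of φ and N the period, periodicity makes the value v of `betaStar L`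
    -- satisfy v = (1 - ω^N) + ω^N v.
    have h4 : (1 - (phi L)⁻¹ ^ L.length) * (evalReal (geo (phi L)⁻¹) (betaStar L) - 1) = 0 := by
      linear_combination h1 + h2
    rcases mul_eq_zero.1 h4 with h | h <;> linarith

/-- The averaging weights of the recurrence determined by `L`. -/
def avgWeight (L : List ℕ) (k : ℕ) : ℝ :=
  (betaStar L k : ℝ) * geo (phi L)⁻¹ k + if k = L.length - 1 then (phi L)⁻¹ ^ L.length else 0

theorem sum_avgWeight_mul (hL : IsAdmissible L) (f : ℕ → ℝ) :
    ∑ k ∈ Finset.range L.length, avgWeight L k * f k =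
      ∑ k ∈ Finset.range L.length, (betaStar L k : ℝ) * geo (phi L)⁻¹ k * f k +
        (phi L)⁻¹ ^ L.length * f (L.length - 1) := by
  have : L.length - 1 ∈ Finset.range L.length := by
    rw [Finset.mem_range]; have := hL.1; omega
  simp only [avgWeight, add_mul, Finset.sum_add_distrib, ite_mul, zero_mul, Finset.sum_ite_eq',
    this, if_true]

theorem sum_avgWeight (hL : IsAdmissible L) :
    ∑ k ∈ Finset.range L.length, avgWeight L k = 1 := by
  have := sum_avgWeight_mul hL fun _ => 1
  simp only [mul_one] at this
  rw [this, sum_betaStar_geo hL]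

theorem avgWeight_nonneg (hL : IsAdmissible L) (k : ℕ) : 0 ≤ avgWeight L k := by
  have hpos := inv_pos.2 (phi_spec hL).1
  refine add_nonneg (mul_nonneg (Nat.cast_nonneg _) (pow_nonneg hpos.le _)) ?_
  split_ifs <;> positivity

theorem avgWeight_zero_pos (hL : IsAdmissible L) : 0 < avgWeight L 0 := by
  have hpos := inv_pos.2 (phi_spec hL).1
  refine add_pos_of_pos_of_nonneg (mul_pos ?_ (pow_pos hpos _)) ?_
  · exact_mod_cast betaStar_zero_pos hL
  · split_ifs <;> positivity

theorem cnt_add_eq (β : Coeff) (j m s : ℕ) : cnt β (m + j) s =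
    ∑ k ∈ Finset.range j, β (s + k) * cnt β (m + j - 1 - k) 0 + cnt β m (s + j) := by
  induction j generalizing s with
  | zero => simp
  | succ j ih =>
    rw [← add_assoc, cnt, ih (s + 1), Finset.sum_range_succ', ← add_assoc,
      add_comm (β s * _)]
    simp only [add_zero, Nat.add_sub_cancel, Nat.sub_zero]
    refine congrArg₂ (· + ·) (congrArg₂ (· + ·) (Finset.sum_congr rfl fun k _ => ?_) rfl) ?_
    · rw [show s + 1 + k = s + (k + 1) by omega, show m + j - 1 - k = m + j - (k + 1) by omega]
    · rw [show s + 1 + j = s + (j + 1) by omega]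

theorem cnt_betaStar_add_length (L : List ℕ) (m s : ℕ) :
    cnt (betaStar L) m (s + L.length) = cnt (betaStar L) m s := by
  induction m generalizing s with
  | zero => rfl
  | succ m ih =>
    rw [cnt, cnt, betaStar_add_length, show s + L.length + 1 = s + 1 + L.length by omega, ih]

/-- Splitting off the first N digits gives a linear recurrence for the number of words, closed by
periodicity. Division by φ^n turns its coefficients into `avgWeight`, which sum to 1 by the equation
for φ. -/
theorem exists_tendsto_fundSeq (hL : IsAdmissible L) :
    ∃ α : ℝ, 0 < α ∧ Tendsto (fun n : ℕ => (fundSeq L n : ℝ) / phi L ^ n) atTop (𝓝 α) := by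
  have hφ := (phi_spec hL).1
  have hN : 0 < L.length := by have := hL.1; omega
  refine exists_tendsto_of_averaging (avgWeight_nonneg hL) (avgWeight_zero_pos hL) hN
    (sum_avgWeight hL) (fun n => ?_) fun n => ?_
  · have h1 := cnt_add_eq (betaStar L) L.length n 0
    rw [cnt_betaStar_add_length] at h1
    simp only [zero_add] at h1
    rw [sum_avgWeight_mul hL, fundSeq_eq hL]
    dsimp only
    rw [h1]
    push_cast
    rw [add_div, Finset.sum_div]
    congr 1
    · refine Finset.sum_congr rfl fun k hk => ?_
      have hk' := Finset.mem_range.1 hk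
      rw [geo, inv_pow, show phi L ^ (n + L.length) = phi L ^ (n + L.length - 1 - k) *
        phi L ^ (k + 1) by rw [← pow_add]; congr 1; omega]
      field_simp
    · rw [show n + L.length - 1 - (L.length - 1) = n by omega, inv_pow, pow_add]
      field_simp
  · rw [fundSeq_eq hL]
    exact div_pos (by exact_mod_cast cnt_pos n 0) (pow_pos hφ n)

end Phi

/-! ### The fundamental sequence for the unit interval -/

section Legality

variable {β ε : Coeff}

theorem state_of_zeros (h0 : 0 < β 0) {n : ℕ} (h : ∀ k < n, ε k = 0) : state β ε 0 n = 0 := by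
  induction n with
  | zero => rfl
  | succ n ih =>
    have := ih fun k hk => h k (by omega)
    rw [state_succ_of_lt]
    rw [this, h n (by omega)]
    exact h0

/-- The first `n` digits of `ε`. -/
def trunc (n : ℕ) (ε : Coeff) : Coeff := fun k => if k < n then ε k else 0

theorem trunc_of_lt {n k : ℕ} (h : k < n) : trunc n ε k = ε k := if_pos h

theorem trunc_of_le {n k : ℕ} (h : n ≤ k) : trunc n ε k = 0 := if_neg h.not_gt

theorem Legal.trunc {s : ℕ} (h : Legal β s ε) (n : ℕ) : Legal β s (trunc n ε) := by
  refine legal_of_shift (m := n) (fun i hi => ?_) ?_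
  · rw [trunc_of_lt hi, state_congr (ε' := ε) fun j hj => trunc_of_lt (by omega)]
    exact h i
  · convert legal_zero using 1
    funext k
    exact trunc_of_le (by omega)

/-- Final zeros without a reset would match zeros of `β` forever. -/
theorem exists_reset_of_finite (hfreq : ∀ n, ∃ k ≥ n, 0 < β k) {n : ℕ}
    (h : ∀ k, n ≤ k → ε k = 0) (m : ℕ) : ∃ k ≥ m, ε k < β (state β ε 0 k) := by
  by_contra hno
  push Not at hno
  have h0 : ∀ k, max m n ≤ k → β (state β ε 0 k) = 0 := fun k hk => by
    have := hno k (by omega)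
    rw [h k (by omega)] at this
    omega
  obtain ⟨j, hj, hpos⟩ := hfreq (state β ε 0 (max m n))
  obtain ⟨i, rfl⟩ := Nat.exists_eq_add_of_le hj
  have h1 := h0 (max m n + i) (by omega)
  rw [state_of_no_reset fun t h2 _ => by rw [h t (by omega), h0 t h2]] at h1
  omega

end Legality

section Star

variable {L : List ℕ}

theorem mem_collectionStar_of_finite (hL : IsAdmissible L) {ε : Coeff} (hne : ε ≠ 0)
    (h : Legal (betaStar L) 0 ε) {n : ℕ} (hn : ∀ k, n ≤ k → ε k = 0) : ε ∈ collectionStar L :=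
  (mem_collectionStar_iff hL).2
    ⟨hne, h, exists_reset_of_finite (exists_betaStar_pos hL) hn⟩

theorem legal_of_mem_star (hL : IsAdmissible L) {ε : Coeff} (h : ε ∈ collectionStar L) :
    Legal (betaStar L) 0 ε := ((mem_collectionStar_iff hL).1 h).2.1

theorem ltD_asymm {ε ε' : Coeff} (h : LtD ε ε') : ¬ LtD ε' ε :=
  lt_asymm (a := toLex ε) (b := toLex ε') h

theorem evalReal_lt_of_ltD (hL : IsAdmissible L) {ε ε' : Coeff} (h : ε ∈ collectionStar L)
    (h' : ε' ∈ collectionStar L) (hlt : LtD ε ε') :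
    evalReal (geo (phi L)⁻¹) ε < evalReal (geo (phi L)⁻¹) ε' :=
  (isBase hL).evalReal_strictMono (legal_of_mem_star hL h) (legal_of_mem_star hL h')
    ((mem_collectionStar_iff hL).1 h).2.2 hlt

theorem evalReal_mem_Ioo (hL : IsAdmissible L) {ε : Coeff} (h : ε ∈ collectionStar L) :
    evalReal (geo (phi L)⁻¹) ε ∈ Set.Ioo (0 : ℝ) 1 := by
  have b := isBase hL
  obtain ⟨hne, hl, hr⟩ := (mem_collectionStar_iff hL).1 h
  constructor
  · obtain ⟨k, hk⟩ := Function.ne_iff.1 hne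
    refine (b.summable hl).tsum_pos (fun k => mul_nonneg (Nat.cast_nonneg _) (b.geo_pos k).le) k ?_
    exact mul_pos (by exact_mod_cast Nat.pos_of_ne_zero hk) (b.geo_pos k)
  · obtain ⟨k, hk, hk'⟩ := hr 0
    exact (b.evalReal_lt_upper hl hk hk').trans_eq (b.upper_zero ε)

theorem exists_evalReal_eq (hL : IsAdmissible L) {y : ℝ} (hy : y ∈ Set.Ioo (0 : ℝ) 1) :
    ∃ ε ∈ collectionStar L, evalReal (geo (phi L)⁻¹) ε = y := by
  obtain ⟨ε, h1, h2, h3⟩ := (isBase hL).exists_expansion hy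
  refine ⟨ε, (mem_collectionStar_iff hL).2 ⟨?_, h1, h2⟩, h3⟩
  rintro rfl
  rw [← h3] at hy
  simp [evalReal] at hy

theorem isFundamentalSeqStar_geo (hL : IsAdmissible L) :
    IsFundamentalSeqStar (collectionStar L) (geo (phi L)⁻¹) := by
  have b := isBase hL
  refine ⟨?_, fun k => ⟨b.geo_pos k, pow_lt_one₀ b.omega_pos.le b.omega_lt_one (by omega)⟩,
    ⟨fun ε hε => evalReal_mem_Ioo hL hε, ?_, fun y hy => exists_evalReal_eq hL hy⟩, ?_⟩
  · exact strictAnti_nat_of_succ_lt fun k =>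
      pow_lt_pow_right_of_lt_one₀ b.omega_pos b.omega_lt_one (by omega)
  · intro ε hε ε' hε' heq
    rcases ltD_trichotomy ε ε' with h | h | h
    · exact absurd heq (evalReal_lt_of_ltD hL hε hε' h).ne
    · exact h
    · exact absurd heq (evalReal_lt_of_ltD hL hε' hε h).ne'
  · refine fun ε hε ε' hε' => ⟨evalReal_lt_of_ltD hL hε hε', fun hlt => ?_⟩
    rcases ltD_trichotomy ε ε' with h | rfl | h
    · exact h
    · exact absurd hlt (lt_irrefl _)
    · exact absurd hlt (evalReal_lt_of_ltD hL hε' hε h).asymm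

/-- The digits `β` placed at the positions `n, …, n + K - 1`. -/
def segment (β : Coeff) (n K : ℕ) : Coeff :=
  fun k => if n ≤ k ∧ k < n + K then β (k - n) else 0

theorem segment_mem (hL : IsAdmissible L) (n : ℕ) {K : ℕ} (hK : 0 < K) :
    segment (betaStar L) n K ∈ collectionStar L := by
  have h0 := betaStar_zero_pos hL
  refine mem_collectionStar_of_finite hL (fun h => ?_) ?_ (n := n + K)
    fun k hk => if_neg (by omega)
  · have := congrFun h n
    rw [segment, if_pos (by omega), Nat.sub_self, Pi.zero_apply] at this
    omega
  · have hz : ∀ k < n, segment (betaStar L) n K k = 0 := fun k hk => if_neg (by omega)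
    refine legal_of_shift (m := n) (fun i hi => by rw [hz i hi]; exact Nat.zero_le _) ?_
    rw [state_of_zeros h0 hz]
    convert legal_self.trunc K using 1
    funext k
    simp only [shift, segment, trunc]
    by_cases h : k < K
    · rw [if_pos h, if_pos (by omega), Nat.add_sub_cancel_left]
    · rw [if_neg h, if_neg (by omega)]

theorem evalReal_segment (β : Coeff) (Q : ℕ → ℝ) (n K : ℕ) :
    evalReal Q (segment β n K) = ∑ k ∈ Finset.range K, (β k : ℝ) * Q (n + k) := by
  rw [evalReal, tsum_eq_sum (s := Finset.range (n + K)), Finset.sum_range_add,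
    Finset.sum_eq_zero fun k hk => ?_, zero_add]
  · refine Finset.sum_congr rfl fun k hk => ?_
    have := Finset.mem_range.1 hk
    rw [segment, if_pos (by omega), Nat.add_sub_cancel_left]
  · have := Finset.mem_range.1 hk
    rw [segment, if_neg (by omega), Nat.cast_zero, zero_mul]
  · intro k hk
    have : ¬ k < n + K := by simpa using hk
    rw [segment, if_neg (by omega), Nat.cast_zero, zero_mul]

/-- Suppose the sum of `β` from `n` were below `U`, and take a member starting at `n` with that
value. Its digits are at most `β`, and not equal to `β`, since it has resets; so it lies strictly
below some finite segment of `β`, whose value does not exceed the sum. -/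
theorem IsFundamentalSeqStar.summable_and_tsum_eq (hL : IsAdmissible L) {Q : ℕ → ℝ}
    (hQ : IsFundamentalSeqStar (collectionStar L) Q) {n : ℕ} {U : ℝ}
    (h1 : ∀ K, 0 < K → evalReal Q (segment (betaStar L) n K) ≤ U)
    (h2 : ∀ y, 0 < y → y < U → ∃ ε ∈ collectionStar L, (∀ k < n, ε k = 0) ∧ evalReal Q ε = y)
    (hU : 0 < U) :
    Summable (fun k => (betaStar L k : ℝ) * Q (n + k)) ∧
      ∑' k, (betaStar L k : ℝ) * Q (n + k) = U := by
  have hnn : ∀ k, 0 ≤ (betaStar L k : ℝ) * Q (n + k) := fun k =>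
    mul_nonneg (Nat.cast_nonneg _) (hQ.2.1 _).1.le
  have hpart : ∀ K, ∑ k ∈ Finset.range K, (betaStar L k : ℝ) * Q (n + k) ≤ U := by
    intro K
    rcases Nat.eq_zero_or_pos K with rfl | hK
    · simpa using hU.le
    · rw [← evalReal_segment]; exact h1 K hK
  have hs := summable_of_sum_range_le hnn hpart
  refine ⟨hs, le_antisymm (hs.tsum_le_of_sum_range_le hpart) ?_⟩
  by_contra hlt
  push Not at hlt
  have hpos : 0 < ∑' k, (betaStar L k : ℝ) * Q (n + k) :=
    hs.tsum_pos hnn 0 (mul_pos (by exact_mod_cast betaStar_zero_pos hL) (hQ.2.1 _).1)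
  obtain ⟨ε, hε, hz, heval⟩ := h2 _ hpos hlt
  have hst := state_of_zeros (betaStar_zero_pos hL) hz
  obtain ⟨-, hl, hr⟩ := (mem_collectionStar_iff hL).1 hε
  have hl' := hl.shift n
  rw [hst] at hl'
  rcases hl'.le_self.eq_or_lt with heq | hlt'
  · obtain ⟨k, hk, hk'⟩ := hr n
    obtain ⟨i, rfl⟩ := Nat.exists_eq_add_of_le hk
    rw [state_add, hst, toLex.injective heq, state_self] at hk'
    have : ε (n + i) = betaStar L i := congrFun (toLex.injective heq) i
    omega
  · obtain ⟨i, hi, hi'⟩ : LtD (shift n ε) (betaStar L) := hlt'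
    have hlt2 : LtD ε (segment (betaStar L) n (i + 1)) := by
      refine ⟨n + i, fun j hj => ?_, ?_⟩
      · rcases lt_or_ge j n with h | h
        · rw [hz j h, segment, if_neg (by omega)]
        · obtain ⟨t, rfl⟩ := Nat.exists_eq_add_of_le h
          rw [segment, if_pos (by omega), Nat.add_sub_cancel_left]
          exact hi t (by omega)
      · rw [segment, if_pos (by omega), Nat.add_sub_cancel_left]
        exact hi'
    have h3 := (hQ.2.2.2 _ hε _ (segment_mem hL n (Nat.succ_pos i))).1 hlt2
    rw [heval, evalReal_segment] at h3
    exact absurd (hs.sum_le_tsum (Finset.range (i + 1)) fun k _ => hnn k) (not_le.2 h3)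

theorem evalReal_unit (Q : ℕ → ℝ) (n : ℕ) : evalReal Q (Pi.single n 1) = Q n := by
  rw [evalReal, tsum_eq_single n]
  · simp
  · intro k hk
    rw [Pi.single_eq_of_ne hk, Nat.cast_zero, zero_mul]

theorem unit_mem_star (hL : IsAdmissible L) (n : ℕ) :
    (Pi.single n 1 : Coeff) ∈ collectionStar L := by
  have h0 := betaStar_zero_pos hL
  refine mem_collectionStar_of_finite hL (fun h => ?_) ?_ (n := n + 1)
    fun k hk => Pi.single_eq_of_ne (by omega) _
  · simpa using congrFun h n
  · have hz : ∀ k < n, (Pi.single n 1 : Coeff) k = 0 := fun k hk => Pi.single_eq_of_ne hk.ne _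
    refine legal_of_shift (m := n) (fun i hi => by rw [hz i hi]; exact Nat.zero_le _) ?_
    rw [state_of_zeros h0 hz]
    convert legal_single h0 using 1
    funext k
    cases k with
    | zero => simp [shift, cons]
    | succ k => exact Pi.single_eq_of_ne (by omega) _

/-- For any fundamental sequence, `β` placed directly after index `n` sums to `Q n`, and placed at
the start it sums to 1. By periodicity the first fact is a backward averaging recurrence for `Q n *
phi L ^ (n + 1)`, which is therefore constant; the second fixes the constant. -/
theorem fundSeqStar_eq (hL : IsAdmissible L) : fundSeqStar L = geo (phi L)⁻¹ := by
  have hQ : IsFundamentalSeqStar (collectionStar L) (fundSeqStar L) :=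
    Classical.epsilon_spec ⟨_, isFundamentalSeqStar_geo hL⟩
  set Q := fundSeqStar L
  have hN := hL.1
  have hφ := (phi_spec hL).1
  have hM0 : ∑' k, (betaStar L k : ℝ) * Q (0 + k) = 1 := by
    refine (hQ.summable_and_tsum_eq hL (fun K hK => ?_) (fun y hy hy' => ?_) one_pos).2
    · exact (hQ.2.2.1.mapsTo (segment_mem hL 0 hK)).2.le
    · obtain ⟨ε, hε, h⟩ := hQ.2.2.1.surjOn ⟨hy, hy'⟩
      exact ⟨ε, hε, by simp, h⟩
  have hM : ∀ n, Summable (fun k => (betaStar L k : ℝ) * Q (n + 1 + k)) ∧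
      ∑' k, (betaStar L k : ℝ) * Q (n + 1 + k) = Q n := by
    intro n
    refine hQ.summable_and_tsum_eq hL (fun K hK => ?_) (fun y hy hy' => ?_) (hQ.2.1 n).1
    · rw [← evalReal_unit Q n]
      refine ((hQ.2.2.2 _ (segment_mem hL _ hK) _ (unit_mem_star hL n)).1
        ⟨n, fun j hj => ?_, ?_⟩).le
      · rw [segment, if_neg (by omega), Pi.single_eq_of_ne hj.ne]
      · rw [segment, if_neg (by omega), Pi.single_eq_same]; exact one_pos
    · obtain ⟨ε, hε, h⟩ := hQ.2.2.1.surjOn ⟨hy, hy'.trans (hQ.2.1 n).2⟩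
      refine ⟨ε, hε, ?_, h⟩
      rw [← h, ← evalReal_unit Q n] at hy'
      obtain ⟨k, hk, hlt⟩ := (hQ.2.2.2 _ hε _ (unit_mem_star hL n)).2 hy'
      obtain rfl : k = n := by
        by_contra hne
        rw [Pi.single_eq_of_ne hne] at hlt
        omega
      rw [Pi.single_eq_same] at hlt
      intro j hj
      rcases Nat.lt_succ_iff_lt_or_eq.1 hj with h' | rfl
      · rw [hk j h', Pi.single_eq_of_ne h'.ne]
      · omega
  have hrec : ∀ n, Q n = ∑ k ∈ Finset.range L.length, (betaStar L k : ℝ) * Q (n + 1 + k) +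
      Q (n + L.length) := by
    intro n
    rw [← (hM n).2, ← (hM n).1.sum_add_tsum_nat_add L.length, ← (hM (n + L.length)).2]
    congr 1
    refine tsum_congr fun k => ?_
    rw [betaStar_add_length]
    congr 2
    omega
  have hb := eq_of_backward_averaging (avgWeight_nonneg hL) (avgWeight_zero_pos hL) hN
    (sum_avgWeight hL) (b := fun n => Q n * phi L ^ (n + 1)) (fun n => ?_)
    (fun n => mul_pos (hQ.2.1 n).1 (pow_pos hφ _))
  · have hQn : ∀ n, Q n = Q 0 * phi L * geo (phi L)⁻¹ n := by
      intro n
      have := hb n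
      rw [geo, inv_pow]
      simp only [zero_add, pow_one] at this
      rw [← this]
      field_simp
    have h1 : Q 0 * phi L = 1 := by
      have h2 := (isBase hL).sum
      rw [evalReal] at h2
      rw [← hM0]
      conv_lhs => rw [← mul_one (Q 0 * phi L), ← h2, ← tsum_mul_left]
      refine tsum_congr fun k => ?_
      rw [zero_add, hQn k]
      ring
    funext n
    rw [hQn n, h1, one_mul]
  · rw [sum_avgWeight_mul hL, hrec n, add_mul, Finset.sum_mul]
    congr 1
    · refine Finset.sum_congr rfl fun k _ => ?_
      rw [geo, inv_pow, show n + 1 + k + 1 = (n + 1) + (k + 1) by omega]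
      field_simp
      ring
    · rw [show n + 1 + (L.length - 1) = n + L.length by omega, inv_pow,
        show n + L.length + 1 = L.length + (n + 1) by omega]
      field_simp
      ring

end Star

/-! ### The largest legal sequence below a given one -/

section Clip

variable {β ε ε' c : Coeff} {j k : ℕ}

/-- `c` is the largest legal sequence that is at most `ε`. -/
def IsClip (β ε c : Coeff) : Prop :=
  Legal β 0 c ∧ toLex c ≤ toLex ε ∧ ∀ τ, Legal β 0 τ → toLex τ ≤ toLex ε → toLex τ ≤ toLex c

theorem IsClip.unique {c' : Coeff} (h : IsClip β ε c) (h' : IsClip β ε c') : c = c' :=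
  toLex.injective (le_antisymm (h'.2.2 c h.1 h.2.1) (h.2.2 c' h'.1 h'.2.1))

theorem Legal.isClip (h : Legal β 0 ε) : IsClip β ε ε := ⟨h, le_rfl, fun _ _ => id⟩

/-- The first digit of `ε` that is too large is at `k`, and the block it belongs to starts at
`j`. -/
def FailsAt (β ε : Coeff) (j k : ℕ) : Prop :=
  (∀ i < k, ε i ≤ β (state β ε 0 i)) ∧ j = k - state β ε 0 k ∧ β (state β ε 0 k) < ε k

theorem exists_failsAt (h : ¬ Legal β 0 ε) : ∃ j k, FailsAt β ε j k := by
  classical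
  have h' : ∃ k, β (state β ε 0 k) < ε k := by simpa [Legal] using h
  exact ⟨_, Nat.find h', fun i hi => not_lt.1 (Nat.find_min h' hi), rfl, Nat.find_spec h'⟩

namespace FailsAt

theorem le (h : FailsAt β ε j k) : j ≤ k := by rw [h.2.1]; omega

theorem eq_of_le (h : FailsAt β ε j k) {t : ℕ} (h1 : j ≤ t) (h2 : t < k) : ε t = β (t - j) := by
  rw [h.2.1] at h1 ⊢
  exact ((state_run k).2 t h1 h2).1

theorem state_eq (h : FailsAt β ε j k) : state β ε 0 j = 0 := by
  rcases h.le.eq_or_lt with rfl | hlt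
  · have h1 := h.2.1
    have h2 := state_le (β := β) (ε := ε) j
    omega
  · have h1 := h.2.1
    have := ((state_run k).2 j h1.ge hlt).2
    rw [this, ← h1, Nat.sub_self]

theorem lt_apply (h : FailsAt β ε j k) : β (k - j) < ε k := by
  have h1 := h.2.2
  have h2 := state_le (β := β) (ε := ε) k
  rwa [h.2.1, Nat.sub_sub_self h2]

theorem congr (h : FailsAt β ε j k) (heq : ∀ i ≤ k, ε i = ε' i) : FailsAt β ε' j k := by
  have hst : ∀ i ≤ k, state β ε' 0 i = state β ε 0 i := fun i hi =>
    (state_congr fun t ht => heq t (by omega)).symm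
  refine ⟨fun i hi => ?_, ?_, ?_⟩
  · rw [← heq i hi.le, hst i hi.le]; exact h.1 i hi
  · rw [hst k le_rfl]; exact h.2.1
  · rw [← heq k le_rfl, hst k le_rfl]; exact h.2.2

theorem digit_lt (h : FailsAt β ε (j + 1) k) : ε j < β (state β ε 0 j) := by
  have h1 := h.state_eq
  have h2 := h.1 j (by have := h.le; omega)
  refine lt_of_le_of_ne h2 fun heq => ?_
  rw [state_succ_of_eq heq] at h1
  omega

end FailsAt

/-- The first `j` digits of `ε` followed by `β`. -/
def clipAt (β : Coeff) (j : ℕ) (ε : Coeff) : Coeff := fun i => if i < j then ε i else β (i - j)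

theorem shift_clipAt (β : Coeff) (j : ℕ) (ε : Coeff) : shift j (clipAt β j ε) = β := by
  funext i
  rw [shift, clipAt, if_neg (by omega), Nat.add_sub_cancel_left]

theorem clipAt_zero (β ε : Coeff) : clipAt β 0 ε = β := by
  funext i; simp [clipAt]

theorem FailsAt.clipAt_lt (h : FailsAt β ε j k) : LtD (clipAt β j ε) ε := by
  have hle := h.le
  refine ⟨k, fun i hi => ?_, ?_⟩
  · rw [clipAt]
    split_ifs with hij
    · rfl
    · exact (h.eq_of_le (by omega) hi).symm
  · rw [clipAt, if_neg (by omega)]; exact h.lt_apply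

/-- A legal sequence that agrees with `ε` before `j` is at most `clipAt β j ε`. -/
theorem FailsAt.le_clipAt_of_eq (h : FailsAt β ε j k) {τ : Coeff} (hτ : Legal β 0 τ)
    (heq : ∀ i < j, τ i = ε i) : toLex τ ≤ toLex (clipAt β j ε) := by
  have hl := hτ.shift j
  rw [state_congr heq, h.state_eq] at hl
  by_contra hlt
  obtain ⟨i, hi, hi'⟩ : LtD (clipAt β j ε) τ := not_le.1 hlt
  rcases lt_or_ge i j with hij | hij
  · rw [clipAt, if_pos hij, heq i hij] at hi'
    exact lt_irrefl _ hi'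
  · refine absurd hl.le_self (not_le.2 (show LtD β (shift j τ) from ⟨i - j, fun t ht => ?_, ?_⟩))
    · have := hi (j + t) (by omega)
      rwa [clipAt, if_neg (by omega), Nat.add_sub_cancel_left] at this
    · rw [clipAt, if_neg (by omega)] at hi'
      rwa [shift, Nat.add_sub_cancel' hij]

/-- The state at `j` is 0, so a legal sequence that agrees with `ε` before `j` continues by at most
`β`. One that falls below `ε` before `j` is smaller already. -/
theorem FailsAt.isClip (h : FailsAt β ε j k) : IsClip β ε (clipAt β j ε) := by
  refine ⟨?_, le_of_lt (a := toLex (clipAt β j ε)) h.clipAt_lt, fun τ hτ hle => ?_⟩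
  · have hst : ∀ i ≤ j, state β (clipAt β j ε) 0 i = state β ε 0 i := fun i hi =>
      state_congr fun t ht => if_pos (by omega)
    refine legal_of_shift (m := j) (fun i hi => ?_) ?_
    · rw [hst i hi.le, clipAt, if_pos hi]
      exact h.1 i (by have := h.le; omega)
    · rw [hst j le_rfl, h.state_eq, shift_clipAt]
      exact legal_self
  · by_cases hall : ∀ i < j, τ i = ε i
    · exact h.le_clipAt_of_eq hτ hall
    · rcases hle.eq_or_lt with heq | hlt
      · exact absurd (fun i _ => congrFun (toLex.injective heq) i) hall
      · obtain ⟨i, hi, hi'⟩ : LtD τ ε := hlt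
        have hij : i < j := by
          by_contra hij
          exact hall fun t ht => hi t (by omega)
        refine le_of_lt (show LtD τ (clipAt β j ε) from ⟨i, fun t ht => ?_, ?_⟩)
        · rw [clipAt, if_pos (by omega)]; exact hi t ht
        · rwa [clipAt, if_pos hij]

theorem exists_isClip (β ε : Coeff) : ∃ c, IsClip β ε c := by
  by_cases h : Legal β 0 ε
  · exact ⟨ε, h.isClip⟩
  · obtain ⟨j, k, h⟩ := exists_failsAt h
    exact ⟨_, h.isClip⟩

/-- The largest legal sequence that is at most `ε`. -/
def clip (β ε : Coeff) : Coeff := (exists_isClip β ε).choose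

theorem isClip_clip (β ε : Coeff) : IsClip β ε (clip β ε) := (exists_isClip β ε).choose_spec

theorem IsClip.eq (h : IsClip β ε c) : clip β ε = c := (isClip_clip β ε).unique h

theorem clip_mono (h : toLex ε ≤ toLex ε') : toLex (clip β ε) ≤ toLex (clip β ε') :=
  (isClip_clip β ε').2.2 _ (isClip_clip β ε).1 ((isClip_clip β ε).2.1.trans h)

theorem clip_of_le (h : toLex β ≤ toLex ε) : clip β ε = β :=
  IsClip.eq ⟨legal_self, h, fun _ hτ _ => hτ.le_self⟩

theorem cons_le_cons {d : ℕ} (h : toLex ε ≤ toLex ε') : toLex (cons d ε) ≤ toLex (cons d ε') := by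
  rcases h.eq_or_lt with heq | hlt
  · rw [toLex.injective heq]
  · obtain ⟨k, hk, hk'⟩ : LtD ε ε' := hlt
    refine le_of_lt (show LtD _ _ from ⟨k + 1, fun i hi => ?_, hk'⟩)
    cases i with
    | zero => rfl
    | succ i => exact hk i (by omega)

theorem cons_shift_one (ε : Coeff) : cons (ε 0) (shift 1 ε) = ε := by
  funext k
  cases k with
  | zero => rfl
  | succ k => simp only [cons, shift, add_comm]

/-- Every competitor must itself start with 0, and this digit leaves the automaton in state 0. -/
theorem clip_cons_zero (h0 : 0 < β 0) (ε : Coeff) : clip β (cons 0 ε) = cons 0 (clip β ε) := by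
  obtain ⟨h1, h2, h3⟩ := isClip_clip β ε
  refine IsClip.eq ⟨legal_cons_of_lt h0 h1, cons_le_cons h2, fun τ hτ hle => ?_⟩
  have hτ0 : τ 0 = 0 := by
    rcases hle.eq_or_lt with heq | hlt
    · exact congrFun (toLex.injective heq) 0
    · obtain ⟨k, hk, hk'⟩ : LtD τ (cons 0 ε) := hlt
      cases k with
      | zero => exact absurd hk' (Nat.not_lt_zero _)
      | succ k => exact hk 0 (by omega)
  have hτ' := cons_shift_one τ
  rw [hτ0] at hτ'
  rw [← hτ'] at hτ hle ⊢
  refine cons_le_cons (h3 _ ((legal_cons_zero h0).1 hτ) ?_)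
  rcases hle.eq_or_lt with heq | hlt
  · refine le_of_eq (congrArg toLex ?_)
    rw [← shift_one_cons 0 (shift 1 τ), toLex.injective heq, shift_one_cons]
  · obtain ⟨k, hk, hk'⟩ : LtD (cons 0 (shift 1 τ)) (cons 0 ε) := hlt
    cases k with
    | zero => exact absurd hk' (lt_irrefl _)
    | succ k => exact le_of_lt (show LtD _ _ from ⟨k, fun i hi => hk (i + 1) (by omega), hk'⟩)

/-! ### Carries: the next legal sequence above the clip -/

/-- The first `j` digits of `ε`, the last of them increased by one. -/
def carry (j : ℕ) (ε : Coeff) : Coeff :=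
  fun i => if i + 1 < j then ε i else if i + 1 = j then ε i + 1 else 0

theorem carry_congr (h : ∀ i < j, ε i = ε' i) : carry j ε = carry j ε' := by
  funext i
  rw [carry, carry]
  split_ifs with h1 h2
  · exact h i (by omega)
  · rw [h i (by omega)]
  · rfl

theorem carry_of_lt {i : ℕ} (h : i < j) : carry (j + 1) ε i = ε i := if_pos (by omega)

theorem carry_self : carry (j + 1) ε j = ε j + 1 := by
  rw [carry, if_neg (by omega), if_pos rfl]

theorem carry_of_ge {i : ℕ} (h : j ≤ i) : carry j ε i = 0 := by
  rw [carry, if_neg (by omega), if_neg (by omega)]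

theorem legal_carry (h : ∀ i < j, ε i ≤ β (state β ε 0 i)) (hlt : ε j < β (state β ε 0 j)) :
    Legal β 0 (carry (j + 1) ε) := by
  have hst : ∀ i ≤ j, state β (carry (j + 1) ε) 0 i = state β ε 0 i := fun i hi =>
    state_congr fun t ht => carry_of_lt (by omega)
  refine legal_of_shift (m := j + 1) (fun i hi => ?_) ?_
  · rw [hst i (by omega)]
    rcases Nat.lt_succ_iff_lt_or_eq.1 hi with h' | rfl
    · rw [carry_of_lt h']
      exact h i h'
    · rw [carry_self]
      exact hlt
  · convert legal_zero using 1
    funext i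
    exact carry_of_ge (by omega)

theorem FailsAt.legal_carry (h : FailsAt β ε (j + 1) k) : Legal β 0 (carry (j + 1) ε) :=
  Zeckendorf.legal_carry (fun i hi => h.1 i (by have := h.le; omega)) h.digit_lt

/-- Both the illegal `ε` and the carry lie above `clipAt β (j + 1) ε`, and no legal sequence lies
strictly between this clip and the carry. -/
theorem FailsAt.ltD_iff_carry (h : FailsAt β ε (j + 1) k) {τ : Coeff} (hτ : Legal β 0 τ) :
    LtD τ ε ↔ LtD τ (carry (j + 1) ε) := by
  constructor
  · intro hlt
    refine lt_of_le_of_lt (h.isClip.2.2 τ hτ (le_of_lt (show toLex τ < toLex ε from hlt)))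
      (show LtD (clipAt β (j + 1) ε) (carry (j + 1) ε) from ⟨j, fun i hi => ?_, ?_⟩)
    · rw [carry_of_lt hi, clipAt, if_pos (by omega)]
    · rw [carry_self, clipAt, if_pos (by omega)]
      omega
  · rintro ⟨i, hi, hi'⟩
    rcases lt_trichotomy i j with hij | rfl | hij
    · exact ⟨i, fun t ht => by rw [hi t ht, carry_of_lt (by omega)],
        by rwa [carry_of_lt hij] at hi'⟩
    · rw [carry_self] at hi'
      rcases Nat.lt_succ_iff_lt_or_eq.1 hi' with h' | h'
      · exact ⟨i, fun t ht => by rw [hi t ht, carry_of_lt ht], h'⟩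
      · refine lt_of_le_of_lt (h.le_clipAt_of_eq hτ fun t ht => ?_)
          (show toLex (clipAt β (i + 1) ε) < toLex ε from h.clipAt_lt)
        rcases Nat.lt_succ_iff_lt_or_eq.1 ht with h'' | rfl
        · rw [hi t h'', carry_of_lt h'']
        · exact h'
    · rw [carry_of_ge (by omega)] at hi'
      exact absurd hi' (Nat.not_lt_zero _)

/-- A full `β` starting after position `j` is worth exactly one unit at position `j`, because `β`
expands 1. -/
theorem FailsAt.evalReal_carry {ω : ℝ} (b : IsBase β ω) (h : FailsAt β ε (j + 1) k) :
    evalReal (geo ω) (carry (j + 1) ε) = evalReal (geo ω) (clip β ε) := by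
  rw [h.isClip.eq, evalReal_geo_shift (b.summable h.legal_carry) (j + 1),
    evalReal_geo_shift (b.summable h.isClip.1) (j + 1), shift_clipAt, b.sum, Finset.sum_range_succ,
    Finset.sum_range_succ, carry_self, clipAt, if_pos (Nat.lt_succ_self j)]
  have h1 : shift (j + 1) (carry (j + 1) ε) = 0 := by
    funext i
    exact carry_of_ge (by omega)
  have h2 : ∀ i ∈ Finset.range j, (carry (j + 1) ε i : ℝ) * geo ω i =
      (clipAt β (j + 1) ε i : ℝ) * geo ω i := by
    intro i hi
    have := Finset.mem_range.1 hi
    rw [carry_of_lt this, clipAt, if_pos (by omega)]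
  rw [h1, Finset.sum_congr rfl h2]
  simp [evalReal, geo, clipAt]
  ring

end Clip

/-! ### Ceilings and their limits -/

section Ceil

variable {L : List ℕ}

theorem not_ltA_of_support {n t : ℕ} {τ ν : Coeff} (hν : ∀ k, n ≤ k → ν k = 0) (ht : n ≤ t)
    (hτ : τ t ≠ 0) : ¬ LtA τ ν := by
  rintro ⟨i, hi, hi'⟩
  have hin : i < n := by
    by_contra h
    rw [hν i (by omega)] at hi'
    omega
  exact hτ ((hi t (by omega)).trans (hν t ht))

theorem isCeil_of_legal {n : ℕ} {μ : Coeff} (hμ : ∀ k, n ≤ k → μ k = 0)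
    (h : Legal (betaStar L) 0 (rev n μ)) : IsCeil (collection L) μ μ :=
  ⟨mem_collection_of_legal hμ h, fun _ _ => Iff.rfl⟩

theorem FailsAt.isCeil (hL : IsAdmissible L) {n j k : ℕ} {μ : Coeff}
    (hμ : ∀ k, n ≤ k → μ k = 0) (h : FailsAt (betaStar L) (rev n μ) (j + 1) k) :
    IsCeil (collection L) μ (rev n (carry (j + 1) (rev n μ))) := by
  have hkn : k < n := by
    by_contra hkn
    have := h.2.2
    rw [rev_apply_of_le _ (by omega)] at this
    omega
  have hle := h.le
  have hrev : rev n (rev n (carry (j + 1) (rev n μ))) = carry (j + 1) (rev n μ) :=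
    rev_rev_of_support fun i hi => carry_of_ge (by omega)
  have hsupp : ∀ i, n ≤ i → rev n (carry (j + 1) (rev n μ)) i = 0 := fun i hi =>
    rev_apply_of_le _ hi
  refine ⟨mem_collection_of_legal hsupp (by rw [hrev]; exact h.legal_carry), fun τ hτ => ?_⟩
  by_cases hτn : ∀ i, n ≤ i → τ i = 0
  · rw [ltA_iff_ltD_rev hτn hμ, ltA_iff_ltD_rev hτn hsupp, hrev]
    exact h.ltD_iff_carry (legal_rev_of_mem hL hτ hτn)
  · push Not at hτn
    obtain ⟨t, ht, hne⟩ := hτn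
    exact iff_of_false (not_ltA_of_support hμ ht hne) (not_ltA_of_support hsupp ht hne)

/-- A leading zero is prepended so that the carry always has a digit to go to, even when the failing
block starts at the top digit of `μ`. This shift accounts for the factor `(phi L)⁻¹`. -/
theorem exists_isCeil (hL : IsAdmissible L) {n : ℕ} {μ : Coeff} (hμ : ∀ k, n ≤ k → μ k = 0) :
    ∃ c, Legal (betaStar L) 0 c ∧ (∀ k, n + 1 ≤ k → c k = 0) ∧
      IsCeil (collection L) μ (rev (n + 1) c) ∧
      evalReal (geo (phi L)⁻¹) c =
        (phi L)⁻¹ * evalReal (geo (phi L)⁻¹) (clip (betaStar L) (rev n μ)) := by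
  have h0 := betaStar_zero_pos hL
  have hμ' : ∀ k, n + 1 ≤ k → μ k = 0 := fun k hk => hμ k (by omega)
  have hcons := rev_succ (hμ n le_rfl)
  rw [← evalReal_geo_cons_zero, ← clip_cons_zero h0, ← hcons]
  by_cases h : Legal (betaStar L) 0 (rev (n + 1) μ)
  · refine ⟨rev (n + 1) μ, h, fun k hk => rev_apply_of_le _ hk, ?_, by rw [h.isClip.eq]⟩
    rw [rev_rev_of_support hμ']
    exact isCeil_of_legal hμ' h
  · obtain ⟨j, k, h⟩ := exists_failsAt h
    have hfirst : rev (n + 1) μ 0 = 0 := by rw [hcons]; rfl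
    have hk : k ≠ 0 := by
      rintro rfl
      have := h.2.2
      rw [hfirst] at this
      omega
    obtain ⟨j, rfl⟩ : ∃ i, j = i + 1 := by
      refine Nat.exists_eq_succ_of_ne_zero ?_
      rintro rfl
      have := h.eq_of_le (t := 0) le_rfl (by omega)
      rw [hfirst] at this
      simp at this
      omega
    have hkn : k < n + 1 := by
      by_contra hkn
      have := h.2.2
      rw [rev_apply_of_le _ (by omega)] at this
      omega
    have hle := h.le
    exact ⟨_, h.legal_carry, fun i hi => carry_of_ge (by omega), h.isCeil hL hμ',
      h.evalReal_carry (isBase hL)⟩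

theorem tendsto_trunc (c : Coeff) : Tendsto (fun n => trunc n c) atTop (𝓝 c) := by
  rw [tendsto_pi_nhds]
  intro k
  refine tendsto_const_nhds.congr' ?_
  filter_upwards [eventually_gt_atTop k] with n hn
  exact (trunc_of_lt hn).symm

/-- For `ε` below `β` the limit is `ε` itself if legal and its carry otherwise, since long
truncations fail at the same place. In the remaining case both sides are the value of `β`. -/
theorem evalReal_revBar (hL : IsAdmissible L) {ε : Coeff} (hε : ε ≠ 0) :
    evalReal (fundSeqStar L) (revBar L ε) =
      evalReal (geo (phi L)⁻¹) (clip (betaStar L) ε) := by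
  have hmax : maxBlockStar L 0 = betaStar L := by
    funext k; simp [maxBlockStar]
  rw [fundSeqStar_eq hL, revBar, hmax]
  have hsupp : ∀ n k, n ≤ k → rev n ε k = 0 := fun n k hk => rev_apply_of_le _ hk
  have hrr : ∀ n ε, rev n (rev n ε) = trunc n ε := rev_rev
  split_ifs with hlt
  · by_cases h : Legal (betaStar L) 0 ε
    · rw [h.isClip.eq]
      congr 1
      refine ((tendsto_trunc ε).congr' ?_).limUnder_eq
      obtain ⟨i, hi⟩ := Function.ne_iff.1 hε
      filter_upwards [eventually_gt_atTop i] with n hn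
      rw [bar_eq_of_isCeil hL (isCeil_of_legal (hsupp n) (by rw [hrr]; exact h.trunc n)), hrr]
      intro h0
      apply hi
      have := congrFun h0 (n - 1 - i)
      rwa [rev_apply_of_lt _ (by omega), show n - 1 - (n - 1 - i) = i by omega] at this
    · obtain ⟨j, k, h⟩ := exists_failsAt h
      obtain ⟨j, rfl⟩ : ∃ i, j = i + 1 := by
        refine Nat.exists_eq_succ_of_ne_zero ?_
        rintro rfl
        have := h.clipAt_lt
        rw [clipAt_zero] at this
        exact ltD_asymm this hlt
      rw [← h.evalReal_carry (isBase hL)]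
      congr 1
      refine ((tendsto_trunc _).congr' ?_).limUnder_eq
      have hle := h.le
      filter_upwards [eventually_gt_atTop k] with n hn
      have hf : FailsAt (betaStar L) (rev n (rev n ε)) (j + 1) k := by
        rw [hrr]
        exact h.congr fun i hi => (trunc_of_lt (by omega)).symm
      have hc : carry (j + 1) (rev n (rev n ε)) = carry (j + 1) ε := by
        rw [hrr]
        exact carry_congr fun i hi => trunc_of_lt (by omega)
      have hceil := hf.isCeil hL (hsupp n)
      rw [hc] at hceil
      rw [bar_eq_of_isCeil hL hceil, hrr]
      intro h0
      have := congrFun h0 (n - 1 - j)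
      rw [rev_apply_of_lt _ (by omega), show n - 1 - (n - 1 - j) = j by omega, carry_self] at this
      exact absurd this (Nat.succ_ne_zero _)
  · rw [clip_of_le (β := betaStar L) (ε := ε) (not_lt.1 hlt)]

end Ceil

/-! ### Inclusion of collections -/

section Inclusion

variable {L L' : List ℕ}

theorem Legal.of_subset (hL' : IsAdmissible L') (hsub : collection L ⊆ collection L')
    {ε : Coeff} {n : ℕ} (hn : ∀ k, n ≤ k → ε k = 0) (h : Legal (betaStar L) 0 ε) :
    Legal (betaStar L') 0 ε := by
  have hs : ∀ k, n ≤ k → rev n ε k = 0 := fun k hk => rev_apply_of_le _ hk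
  have := legal_rev_of_mem hL' (hsub (mem_collection_of_legal hs
    (by rwa [rev_rev_of_support hn]))) hs
  rwa [rev_rev_of_support hn] at this

theorem collectionStar_subset (hL : IsAdmissible L) (hL' : IsAdmissible L')
    (hsub : collection L ⊆ collection L') : collectionStar L ⊆ collectionStar L' := by
  intro ε hε
  obtain ⟨hne, hl, hr⟩ := (mem_collectionStar_iff hL).1 hε
  have hl' : Legal (betaStar L') 0 ε := fun k => by
    have := (hl.trunc (k + 1)).of_subset hL' hsub (fun i hi => trunc_of_le hi) k
    rwa [trunc_of_lt (Nat.lt_succ_self k), state_congr fun i hi => trunc_of_lt (by omega)] at this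
  refine (mem_collectionStar_iff hL').2 ⟨hne, hl', fun n => ?_⟩
  obtain ⟨k, hk, hlt⟩ := hr n
  refine ⟨k, hk, ?_⟩
  -- The digit at a reset for `L` can be raised by one and stay legal for `L`, hence for `L'`; so
  -- the position is also a reset for `L'`.
  have := (legal_carry (fun i _ => hl i) hlt).of_subset hL' hsub (fun i hi => carry_of_ge hi) k
  rwa [carry_self, state_congr fun i hi => carry_of_lt hi] at this

theorem cons_zero_mem_star (hL : IsAdmissible L) {ε : Coeff} (hε : ε ∈ collectionStar L) :
    cons 0 ε ∈ collectionStar L := by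
  have h0 := betaStar_zero_pos hL
  obtain ⟨hne, hl, hr⟩ := (mem_collectionStar_iff hL).1 hε
  refine (mem_collectionStar_iff hL).2 ⟨fun h => hne ?_, legal_cons_of_lt h0 hl, fun n => ?_⟩
  · funext k
    exact congrFun h (k + 1)
  · obtain ⟨k, hk, hlt⟩ := hr n
    refine ⟨1 + k, by omega, ?_⟩
    rw [state_add, shift_one_cons, state_succ_of_lt (k := 0) h0, add_comm 1 k]
    exact hlt

end Inclusion

/-! ### The limit function -/

section Limit

variable {L L' : List ℕ}

theorem expansion_spec (hL : IsAdmissible L) {y : ℝ} (hy : y ∈ Set.Ioo (0 : ℝ) 1) :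
    expansion L y ∈ collectionStar L ∧ evalReal (geo (phi L)⁻¹) (expansion L y) = y := by
  obtain ⟨ε, h⟩ := exists_evalReal_eq hL hy
  have h' : ∃ ε, ε ∈ collectionStar L ∧ evalReal (fundSeqStar L) ε = y :=
    ⟨ε, by rwa [fundSeqStar_eq hL]⟩
  have h2 : expansion L y ∈ collectionStar L ∧ evalReal (fundSeqStar L) (expansion L y) = y :=
    Classical.epsilon_spec h'
  rwa [fundSeqStar_eq hL] at h2

theorem expansion_evalReal (hL : IsAdmissible L) {ε : Coeff} (hε : ε ∈ collectionStar L) :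
    expansion L (evalReal (geo (phi L)⁻¹) ε) = ε := by
  have h := expansion_spec hL (evalReal_mem_Ioo hL hε)
  exact (isFundamentalSeqStar_geo hL).2.2.1.injOn h.1 hε h.2

/-- The value in the base of `L` of the largest `L`-legal sequence below the `L'`-expansion
of `y`. -/
def clipValue (L L' : List ℕ) (y : ℝ) : ℝ :=
  evalReal (geo (phi L)⁻¹) (clip (betaStar L) (expansion L' y))

theorem clipValue_nonneg (hL : IsAdmissible L) (y : ℝ) : 0 ≤ clipValue L L' y :=
  (isBase hL).evalReal_nonneg _

theorem clipValue_le_one (hL : IsAdmissible L) (y : ℝ) : clipValue L L' y ≤ 1 :=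
  (isBase hL).evalReal_le_one (isClip_clip _ _).1

theorem clipValue_mono (hL : IsAdmissible L) (hL' : IsAdmissible L') {y y' : ℝ}
    (hy : y ∈ Set.Ioo (0 : ℝ) 1) (hy' : y' ∈ Set.Ioo (0 : ℝ) 1) (hle : y ≤ y') :
    clipValue L L' y ≤ clipValue L L' y' := by
  refine (isBase hL).evalReal_mono (isClip_clip _ _).1 (isClip_clip _ _).1 (clip_mono ?_)
  obtain ⟨h1, h2⟩ := expansion_spec hL' hy
  obtain ⟨h1', h2'⟩ := expansion_spec hL' hy'
  by_contra hlt
  have := evalReal_lt_of_ltD hL' h1' h1 (not_le.1 hlt)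
  linarith

theorem clipValue_surjOn (hL : IsAdmissible L) (hL' : IsAdmissible L')
    (hsub : collection L ⊆ collection L') :
    Set.SurjOn (clipValue L L') (Set.Ioo 0 1) (Set.Ioo 0 1) := by
  intro v hv
  obtain ⟨ε, hε, rfl⟩ := exists_evalReal_eq hL hv
  have hε' := collectionStar_subset hL hL' hsub hε
  refine ⟨evalReal (geo (phi L')⁻¹) ε, evalReal_mem_Ioo hL' hε', ?_⟩
  rw [clipValue, expansion_evalReal hL' hε', (legal_of_mem_star hL hε).isClip.eq]

/-- Extended by the identity outside (0,1), the function is monotone and surjective on ℝ, hence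
continuous, and compactness of [0,1] makes it uniformly continuous there. -/
theorem clipValue_uniformContinuousOn (hL : IsAdmissible L) (hL' : IsAdmissible L')
    (hsub : collection L ⊆ collection L') :
    UniformContinuousOn (clipValue L L') (Set.Ioo 0 1) := by
  classical
  set F : ℝ → ℝ := fun y => if y ∈ Set.Ioo (0 : ℝ) 1 then clipValue L L' y else y with hF
  have hmono : Monotone F := by
    intro y y' hle
    simp only [hF]
    split_ifs with h h' h'
    · exact clipValue_mono hL hL' h h' hle
    · refine (clipValue_le_one hL y).trans ?_
      by_contra hlt
      exact h' ⟨h.1.trans_le hle, not_le.1 hlt⟩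
    · refine le_trans ?_ (clipValue_nonneg hL y')
      by_contra hlt
      exact h ⟨not_le.1 hlt, hle.trans_lt h'.2⟩
    · exact hle
  have hsurj : Function.Surjective F := by
    intro v
    by_cases hv : v ∈ Set.Ioo (0 : ℝ) 1
    · obtain ⟨y, hy, rfl⟩ := clipValue_surjOn hL hL' hsub hv
      exact ⟨y, if_pos hy⟩
    · exact ⟨v, if_neg hv⟩
  have hunif := (isCompact_Icc (a := (0 : ℝ)) (b := 1)).uniformContinuousOn_of_continuous
    (hmono.continuous_of_surjective hsurj).continuousOn
  refine (hunif.mono Set.Ioo_subset_Icc_self).congr fun y hy => ?_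
  exact if_pos hy

theorem clipValue_mul (hL : IsAdmissible L) (hL' : IsAdmissible L') {y : ℝ}
    (hy : y ∈ Set.Ioo (0 : ℝ) 1) :
    clipValue L L' ((phi L')⁻¹ * y) = (phi L)⁻¹ * clipValue L L' y := by
  obtain ⟨h1, h2⟩ := expansion_spec hL' hy
  have h3 := expansion_evalReal hL' (cons_zero_mem_star hL' h1)
  rw [evalReal_geo_cons_zero, h2] at h3
  rw [clipValue, h3, clip_cons_zero (betaStar_zero_pos hL), evalReal_geo_cons_zero, clipValue]

theorem mul_mem_Ioo (hL' : IsAdmissible L') {y : ℝ} (hy : y ∈ Set.Ioo (0 : ℝ) 1) (k : ℕ) :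
    (phi L')⁻¹ ^ k * y ∈ Set.Ioo (0 : ℝ) 1 := by
  have b := isBase hL'
  have h1 := pow_pos b.omega_pos k
  have h2 := pow_le_one₀ (n := k) b.omega_pos.le b.omega_lt_one.le
  exact ⟨mul_pos h1 hy.1, by nlinarith [hy.1, hy.2]⟩

theorem clipValue_pow_mul (hL : IsAdmissible L) (hL' : IsAdmissible L') {y : ℝ}
    (hy : y ∈ Set.Ioo (0 : ℝ) 1) (k : ℕ) :
    clipValue L L' ((phi L')⁻¹ ^ k * y) = (phi L)⁻¹ ^ k * clipValue L L' y := by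
  induction k with
  | zero => simp
  | succ k ih =>
    rw [pow_succ', mul_assoc, clipValue_mul hL hL' (mul_mem_Ioo hL' hy k), ih, pow_succ', mul_assoc]

theorem one_lt_phi (hL : IsAdmissible L) : 1 < phi L := by
  have := (one_lt_inv₀ (isBase hL).omega_pos).2 (isBase hL).omega_lt_one
  rwa [inv_inv] at this

theorem phi_rpow_gam (hL : IsAdmissible L) (hL' : IsAdmissible L') :
    phi L' ^ gam L L' = phi L :=
  Real.rpow_logb (phi_spec hL').1 (one_lt_phi hL').ne' (phi_spec hL).1

theorem mul_pow_rpow_gam (hL : IsAdmissible L) (hL' : IsAdmissible L') {y : ℝ} (hy : 0 ≤ y)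
    (k : ℕ) : ((phi L')⁻¹ ^ k * y) ^ gam L L' = (phi L)⁻¹ ^ k * y ^ gam L L' := by
  have hφ := (phi_spec hL').1
  rw [Real.mul_rpow (by positivity) hy, ← Real.rpow_natCast_mul (by positivity), mul_comm (k : ℝ),
    Real.rpow_mul_natCast (by positivity), Real.inv_rpow hφ.le, phi_rpow_gam hL hL']

/-- `clipValue L L' y / y ^ γ`. -/
def ratio (L L' : List ℕ) (y : ℝ) : ℝ := clipValue L L' y / y ^ gam L L'

theorem ratio_pow_mul (hL : IsAdmissible L) (hL' : IsAdmissible L') {y : ℝ}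
    (hy : y ∈ Set.Ioo (0 : ℝ) 1) (k : ℕ) :
    ratio L L' ((phi L')⁻¹ ^ k * y) = ratio L L' y := by
  rw [ratio, clipValue_pow_mul hL hL' hy, mul_pow_rpow_gam hL hL' hy.1.le, ratio]
  exact mul_div_mul_left _ _ (pow_pos (isBase hL).omega_pos k).ne'

theorem ratio_rpow_congr (hL : IsAdmissible L) (hL' : IsAdmissible L') {s t : ℝ} {i : ℤ}
    (hs : s < 0) (ht : t < 0) (h : s = t + i) :
    ratio L L' (phi L' ^ s) = ratio L L' (phi L' ^ t) := by
  have hφ := (phi_spec hL').1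
  have hmem : ∀ {u : ℝ}, u < 0 → phi L' ^ u ∈ Set.Ioo (0 : ℝ) 1 := fun hu =>
    ⟨Real.rpow_pos_of_pos hφ _, Real.rpow_lt_one_of_one_lt_of_neg (one_lt_phi hL') hu⟩
  have key : ∀ {u v : ℝ} {k : ℕ}, v < 0 → u = v - k →
      ratio L L' (phi L' ^ u) = ratio L L' (phi L' ^ v) := by
    intro u v k hv huv
    rw [← ratio_pow_mul hL hL' (hmem hv) k, huv, Real.rpow_sub hφ, Real.rpow_natCast, inv_pow,
      div_eq_mul_inv, mul_comm]
  obtain ⟨k, rfl | rfl⟩ := i.eq_nat_or_neg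
  · exact (key hs (by rw [h]; push_cast; ring)).symm
  · exact key ht (by rw [h]; push_cast; ring)

theorem scaleIndex_spec (hL' : IsAdmissible L') {y : ℝ} (hy : y ∈ Set.Ioo (0 : ℝ) 1) :
    1 ≤ scaleIndex L' y ∧ (phi L')⁻¹ ^ scaleIndex L' y ≤ y ∧
      y < (phi L')⁻¹ ^ (scaleIndex L' y - 1) := by
  classical
  have b := isBase hL'
  have hex : ∃ n : ℕ, (phi L')⁻¹ ^ n ≤ y :=
    let ⟨n, hn⟩ := exists_pow_lt_of_lt_one hy.1 b.omega_lt_one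
    ⟨n, hn.le⟩
  have h1 : Nat.find hex ≠ 0 := fun h0 => by
    have := Nat.find_spec hex
    rw [h0, pow_zero] at this
    exact absurd this (not_le.2 hy.2)
  exact Classical.epsilon_spec (p := fun n : ℕ => 1 ≤ n ∧ (phi L')⁻¹ ^ n ≤ y ∧
    y < (phi L')⁻¹ ^ (n - 1)) ⟨Nat.find hex, by omega, Nat.find_spec hex,
      not_le.1 (Nat.find_min hex (by omega))⟩

/-- The rescaling in `deltaStar` is immaterial because `ratio` is invariant under multiplication by
powers of `(phi L')⁻¹`. -/
theorem deltaStar_eq (hL : IsAdmissible L) (hL' : IsAdmissible L') {y : ℝ}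
    (hy : y ∈ Set.Ioo (0 : ℝ) 1) : deltaStar L L' y = ratio L L' y := by
  obtain ⟨-, -, h2⟩ := scaleIndex_spec hL' hy
  have hpos := pow_pos (isBase hL').omega_pos (scaleIndex L' y - 1)
  have hz : y / (phi L')⁻¹ ^ (scaleIndex L' y - 1) ∈ Set.Ioo (0 : ℝ) 1 :=
    ⟨div_pos hy.1 hpos, (div_lt_one hpos).2 h2⟩
  have h3 := ratio_pow_mul hL hL' hz (scaleIndex L' y - 1)
  rw [mul_div_cancel₀ _ hpos.ne'] at h3
  rw [deltaStar, deltaStarOne, evalReal_revBar hL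
    ((mem_collectionStar_iff hL').1 (expansion_spec hL' hz).1).1, h3]
  rfl

end Limit

/-! ### Error terms -/

section Error

/-- The convolution of a null sequence with a summable geometric one tends to 0 by dominated
convergence. -/
theorem tendsto_sum_geometric {ω : ℝ} (h0 : 0 < ω) (h1 : ω < 1) {η : ℕ → ℝ}
    (hη : Tendsto η atTop (𝓝 0)) :
    Tendsto (fun m => ∑ i ∈ Finset.range m, η (m - 1 - i) * ω ^ i) atTop (𝓝 0) := by
  obtain ⟨K, hK⟩ := hη.abs.bddAbove_range
  have hK' : ∀ i, |η i| ≤ K := fun i => hK ⟨i, rfl⟩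
  have hlim : Tendsto (fun m => ∑' i, if i < m then η (m - 1 - i) * ω ^ i else 0) atTop
      (𝓝 (∑' _ : ℕ, (0 : ℝ))) := by
    refine tendsto_tsum_of_dominated_convergence (bound := fun i => K * ω ^ i)
      ((summable_geometric_of_lt_one h0.le h1).mul_left K) (fun i => ?_)
      (Eventually.of_forall fun m i => ?_)
    · have h2 : Tendsto (fun m => η (m - 1 - i) * ω ^ i) atTop (𝓝 0) := by
        have h3 : Tendsto (fun m : ℕ => m - 1 - i) atTop atTop :=
          (tendsto_sub_atTop_nat i).comp (tendsto_sub_atTop_nat 1)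
        simpa using (hη.comp h3).mul_const (ω ^ i)
      refine h2.congr' ?_
      filter_upwards [eventually_gt_atTop i] with m hm
      rw [if_pos hm]
    · have hp := pow_pos h0 i
      split_ifs
      · rw [norm_mul, Real.norm_eq_abs, Real.norm_eq_abs, abs_of_pos hp]
        exact mul_le_mul_of_nonneg_right (hK' _) hp.le
      · rw [norm_zero]
        exact mul_nonneg ((abs_nonneg _).trans (hK' 0)) hp.le
  rw [tsum_zero] at hlim
  refine hlim.congr fun m => ?_
  rw [tsum_eq_sum (s := Finset.range m)]
  · exact Finset.sum_congr rfl fun i hi => if_pos (Finset.mem_range.1 hi)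
  · exact fun i hi => if_neg fun h => hi (Finset.mem_range.2 h)

variable {L : List ℕ}

/-- The accumulated deviation of `H_i` from `α φ^i` for `i < m`. -/
def deviation (L : List ℕ) (α : ℝ) (m : ℕ) : ℝ :=
  ∑ i ∈ Finset.range m, |(fundSeq L i : ℝ) - α * phi L ^ i|

theorem tendsto_deviation (hL : IsAdmissible L) {α : ℝ}
    (hα : Tendsto (fun n : ℕ => (fundSeq L n : ℝ) / phi L ^ n) atTop (𝓝 α)) :
    Tendsto (fun m => deviation L α m / phi L ^ m) atTop (𝓝 0) := by
  have b := isBase hL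
  have hφ := (phi_spec hL).1
  have hη : Tendsto (fun n : ℕ => |(fundSeq L n : ℝ) / phi L ^ n - α|) atTop (𝓝 0) := by
    simpa using (hα.sub_const α).abs
  have := (tendsto_sum_geometric b.omega_pos b.omega_lt_one hη).const_mul (phi L)⁻¹
  rw [mul_zero] at this
  refine this.congr fun m => ?_
  rw [deviation, ← Finset.sum_range_reflect (fun i => |_ - _|), Finset.sum_div, Finset.mul_sum]
  refine Finset.sum_congr rfl fun i hi => ?_
  have hi' := Finset.mem_range.1 hi
  have hp := pow_pos hφ (m - 1 - i)
  have e : (fundSeq L (m - 1 - i) : ℝ) - α * phi L ^ (m - 1 - i) =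
      phi L ^ (m - 1 - i) * ((fundSeq L (m - 1 - i) : ℝ) / phi L ^ (m - 1 - i) - α) := by
    field_simp
  rw [e, abs_mul, abs_of_pos hp, show phi L ^ m = phi L ^ (m - 1 - i) * (phi L ^ i * phi L) by
    rw [← pow_succ, ← pow_add]; congr 1; omega, inv_pow]
  generalize |(fundSeq L (m - 1 - i) : ℝ) / phi L ^ (m - 1 - i) - α| = A
  field_simp

theorem abs_evalNat_sub_le (hL : IsAdmissible L) {B : ℕ} (hB : ∀ k, betaStar L k ≤ B) {c : Coeff}
    (hc : Legal (betaStar L) 0 c) {m : ℕ} (hm : ∀ k, m ≤ k → c k = 0) (α : ℝ) :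
    |(evalNat (fundSeq L) (rev m c) : ℝ) - α * phi L ^ m * evalReal (geo (phi L)⁻¹) c| ≤
      B * deviation L α m := by
  have hφ := (phi_spec hL).1
  have h1 : (evalNat (fundSeq L) (rev m c) : ℝ) =
      ∑ i ∈ Finset.range m, (c (m - 1 - i) : ℝ) * fundSeq L i := by
    rw [evalNat_eq_sum _ fun k hk => rev_apply_of_le c hk]
    push_cast
    refine Finset.sum_congr rfl fun i hi => ?_
    rw [rev_apply_of_lt _ (Finset.mem_range.1 hi)]
  have h2 : α * phi L ^ m * evalReal (geo (phi L)⁻¹) c =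
      ∑ i ∈ Finset.range m, (c (m - 1 - i) : ℝ) * (α * phi L ^ i) := by
    rw [evalReal, tsum_eq_sum (s := Finset.range m) fun k hk => ?_, ← Finset.sum_range_reflect,
      Finset.mul_sum]
    · refine Finset.sum_congr rfl fun i hi => ?_
      have hi' := Finset.mem_range.1 hi
      rw [geo, show m - 1 - i + 1 = m - i by omega, inv_pow,
        show phi L ^ m = phi L ^ i * phi L ^ (m - i) by rw [← pow_add]; congr 1; omega]
      field_simp
    · rw [hm k (by simpa using hk), Nat.cast_zero, zero_mul]
  rw [h1, h2, ← Finset.sum_sub_distrib, deviation, Finset.mul_sum]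
  refine (Finset.abs_sum_le_sum_abs _ _).trans (Finset.sum_le_sum fun i _ => ?_)
  rw [← mul_sub, abs_mul, Nat.abs_cast]
  exact mul_le_mul_of_nonneg_right (by exact_mod_cast hc.apply_le hB _) (abs_nonneg _)

/-- The error is negligible against the scale `s`, and `g` is at least a fixed multiple of `s`. In
the applications `s` is a power of φ, or constant. -/
theorem tendsto_div_one {ι : Type*} {l : Filter ι} {f g s e : ι → ℝ} {r : ℝ} (hr : 0 < r)
    (hs : ∀ᶠ x in l, 0 < s x) (hg : ∀ᶠ x in l, r * s x ≤ g x)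
    (hfg : ∀ᶠ x in l, |f x - g x| ≤ e x * s x) (he : Tendsto e l (𝓝 0)) :
    Tendsto (fun x => f x / g x) l (𝓝 1) := by
  rw [tendsto_iff_norm_sub_tendsto_zero]
  have he' : Tendsto (fun x => e x / r) l (𝓝 0) := by simpa using he.div_const r
  refine squeeze_zero' (Eventually.of_forall fun x => norm_nonneg _) ?_ he'
  filter_upwards [hs, hg, hfg] with x h1 h2 h3
  have hgpos : 0 < g x := (mul_pos hr h1).trans_le h2
  rw [Real.norm_eq_abs, div_sub_one hgpos.ne', abs_div, abs_of_pos hgpos, div_le_div_iff₀ hgpos hr]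
  have he0 : 0 ≤ e x := by
    by_contra hneg
    have := (abs_nonneg _).trans h3
    nlinarith
  nlinarith

end Error

/-! ### The leading index of a coefficient function -/

section Order

variable {L : List ℕ} {μ : Coeff}

theorem ord_spec {n : ℕ} (hn : ∀ k, n ≤ k → μ k = 0) (hne : μ ≠ 0) :
    ∃ m, ord μ = m + 1 ∧ μ m ≠ 0 ∧ ∀ k, ord μ ≤ k → μ k = 0 := by
  have hbdd : BddAbove {n | ∃ k, n = k + 1 ∧ μ k ≠ 0} := by
    refine ⟨n, ?_⟩
    rintro _ ⟨k, rfl, hk⟩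
    by_contra h
    exact hk (hn k (by omega))
  obtain ⟨i, hi⟩ := Function.ne_iff.1 hne
  have hset : {n | ∃ k, n = k + 1 ∧ μ k ≠ 0}.Nonempty := ⟨i + 1, i, rfl, hi⟩
  obtain ⟨m, hm, hm'⟩ := Nat.sSup_mem hset hbdd
  refine ⟨m, hm, hm', fun k hk => ?_⟩
  by_contra h
  have := le_csSup hbdd ⟨k, rfl, h⟩
  rw [ord] at hk
  omega

theorem evalNat_lt_fundSeq (hL : IsAdmissible L) (hμ : μ ∈ collection L) {n : ℕ}
    (hn : ∀ k, n ≤ k → μ k = 0) : evalNat (fundSeq L) μ < fundSeq L n := by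
  rw [fundSeq_eq hL, evalNat_cnt _ hn]
  exact wordValue_lt (legal_rev_of_mem hL hμ hn) n

end Order

/-! ### The asymptotic formulas -/

section Main

variable {L L' : List ℕ}

/-- The data of a nonzero member of the collection read from its leading digit. -/
theorem rev_ord_mem_star (hL : IsAdmissible L) {μ : Coeff} (hμ : μ ∈ collection L) (hne : μ ≠ 0) :
    rev (ord μ) μ ∈ collectionStar L ∧ (∀ k, ord μ ≤ k → μ k = 0) ∧ 0 < rev (ord μ) μ 0 := by
  obtain ⟨n, hn⟩ := exists_support_bound hL hμ
  obtain ⟨m, h1, h2, h3⟩ := ord_spec hn hne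
  have h4 : 0 < rev (ord μ) μ 0 := by
    rw [rev_apply_of_lt _ (by omega), h1]
    exact Nat.pos_of_ne_zero h2
  refine ⟨mem_collectionStar_of_finite hL (fun h => ?_) (legal_rev_of_mem hL hμ h3)
    fun k hk => rev_apply_of_le _ hk, h3, h4⟩
  rw [h] at h4
  exact lt_irrefl _ h4

theorem inv_phi_le_evalReal (hL : IsAdmissible L) {ε : Coeff} (hl : Legal (betaStar L) 0 ε)
    (h : 0 < ε 0) : (phi L)⁻¹ ≤ evalReal (geo (phi L)⁻¹) ε := by
  have b := isBase hL
  refine le_trans ?_ ((b.summable hl).le_tsum 0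
    fun k _ => mul_nonneg (Nat.cast_nonneg _) (b.geo_pos k).le)
  have h1 : (1 : ℝ) ≤ ε 0 := by exact_mod_cast h
  have := mul_le_mul_of_nonneg_right h1 (b.geo_pos 0).le
  simpa [geo] using this

/-- The word with the single leading digit 1 is legal and at most `ε`, hence at most its clip. This
bound keeps the denominators in the asymptotics away from 0. -/
theorem inv_phi_le_evalReal_clip (hL : IsAdmissible L) {ε : Coeff} (h : 0 < ε 0) :
    (phi L)⁻¹ ≤ evalReal (geo (phi L)⁻¹) (clip (betaStar L) ε) := by
  have h1 : toLex (cons 1 0) ≤ toLex ε := by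
    rcases Nat.lt_or_ge 1 (ε 0) with h' | h'
    · exact le_of_lt (show LtD (cons 1 0) ε from ⟨0, by simp, h'⟩)
    · rw [← cons_shift_one ε, show ε 0 = 1 by omega]
      refine cons_le_cons (not_lt.1 ?_)
      rintro ⟨k, _, hk⟩
      exact Nat.not_lt_zero _ hk
  have h2 := legal_single (betaStar_zero_pos hL)
  exact (inv_phi_le_evalReal hL h2 one_pos).trans
    ((isBase hL).evalReal_mono h2 (isClip_clip _ _).1 ((isClip_clip _ _).2.2 _ h2 h1))

variable {α α' : ℝ} {μ : ℕ → Coeff}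

/-- The members `μ x` of the collection represent the positive integers `x`. -/
def Represents (L' : List ℕ) (μ : ℕ → Coeff) : Prop :=
  ∀ x : ℕ, 0 < x → μ x ∈ collection L' ∧ evalNat (fundSeq L') (μ x) = x

/-- The number `∑ rev_n(μ) Q` attached to `x`. -/
def leading (L' : List ℕ) (μ : ℕ → Coeff) (x : ℕ) : ℝ :=
  evalReal (geo (phi L')⁻¹) (rev (ord (μ x)) (μ x))

theorem expansion_ne_zero (hμ : Represents L' μ) {x : ℕ} (hx : 0 < x) : μ x ≠ 0 := fun h => by
  have := (hμ x hx).2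
  rw [h, evalNat_zero] at this
  omega

theorem leading_mem (hL' : IsAdmissible L') (hμ : Represents L' μ) {x : ℕ} (hx : 0 < x) :
    leading L' μ x ∈ Set.Ioo (0 : ℝ) 1 :=
  evalReal_mem_Ioo hL' (rev_ord_mem_star hL' (hμ x hx).1 (expansion_ne_zero hμ hx)).1

theorem inv_phi_le_leading (hL' : IsAdmissible L') (hμ : Represents L' μ) {x : ℕ} (hx : 0 < x) :
    (phi L')⁻¹ ≤ leading L' μ x := by
  obtain ⟨h1, -, h3⟩ := rev_ord_mem_star hL' (hμ x hx).1 (expansion_ne_zero hμ hx)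
  exact inv_phi_le_evalReal hL' (legal_of_mem_star hL' h1) h3

theorem tendsto_ord (hL' : IsAdmissible L') (hμ : Represents L' μ) :
    Tendsto (fun x => ord (μ x)) atTop atTop := by
  refine tendsto_atTop.2 fun M => ?_
  filter_upwards [eventually_ge_atTop (fundSeq L' M), eventually_gt_atTop 0] with x hx hx0
  by_contra hlt
  obtain ⟨-, h2, -⟩ := rev_ord_mem_star hL' (hμ x hx0).1 (expansion_ne_zero hμ hx0)
  have h3 := evalNat_lt_fundSeq hL' (hμ x hx0).1 (n := M) fun k hk => h2 k (by omega)
  rw [(hμ x hx0).2] at h3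
  omega

theorem tendsto_div_leading (hL' : IsAdmissible L') (hα0' : 0 < α')
    (hα' : Tendsto (fun n : ℕ => (fundSeq L' n : ℝ) / phi L' ^ n) atTop (𝓝 α'))
    (hμ : Represents L' μ) :
    Tendsto
    (fun x : ℕ => (x : ℝ) / (α' * phi L' ^ ord (μ x) * leading L' μ x)) atTop (𝓝 1) := by
  have b := isBase hL'
  have hφ := (phi_spec hL').1
  obtain ⟨B, hB⟩ := b.bdd
  refine tendsto_div_one (s := fun x => phi L' ^ ord (μ x))
    (e := fun x => B * (deviation L' α' (ord (μ x)) / phi L' ^ ord (μ x)))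
    (r := α' * (phi L')⁻¹) (mul_pos hα0' b.omega_pos) (Eventually.of_forall fun x => pow_pos hφ _)
    ?_ ?_ ?_
  · filter_upwards [eventually_gt_atTop 0] with x hx
    have h1 := mul_le_mul_of_nonneg_left (inv_phi_le_leading hL' hμ hx)
      (mul_pos hα0' (pow_pos hφ (ord (μ x)))).le
    linarith
  · filter_upwards [eventually_gt_atTop 0] with x hx
    obtain ⟨h1, h2, -⟩ := rev_ord_mem_star hL' (hμ x hx).1 (expansion_ne_zero hμ hx)
    have h3 := abs_evalNat_sub_le hL' hB (legal_of_mem_star hL' h1)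
      (fun k hk => rev_apply_of_le _ hk) α'
    rw [rev_rev_of_support h2, (hμ x hx).2] at h3
    refine h3.trans_eq ?_
    have := pow_pos hφ (ord (μ x))
    field_simp
  · simpa using ((tendsto_deviation hL' hα').comp (tendsto_ord hL' hμ)).const_mul (B : ℝ)

theorem clipValue_leading (hL' : IsAdmissible L') (hμ : Represents L' μ) {x : ℕ} (hx : 0 < x) :
    clipValue L L' (leading L' μ x) =
    evalReal (geo (phi L)⁻¹) (clip (betaStar L) (rev (ord (μ x)) (μ x))) := by
  rw [clipValue, leading,
    expansion_evalReal hL' (rev_ord_mem_star hL' (hμ x hx).1 (expansion_ne_zero hμ hx)).1]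

theorem inv_phi_le_clipValue_leading (hL : IsAdmissible L) (hL' : IsAdmissible L')
    (hμ : Represents L' μ) {x : ℕ} (hx : 0 < x) :
    (phi L)⁻¹ ≤ clipValue L L' (leading L' μ x) := by
  rw [clipValue_leading hL' hμ hx]
  exact inv_phi_le_evalReal_clip hL
    (rev_ord_mem_star hL' (hμ x hx).1 (expansion_ne_zero hμ hx)).2.2

theorem tendsto_zCount_div (hL : IsAdmissible L) (hL' : IsAdmissible L')
    (hsub : collection L ⊆ collection L') (hα0 : 0 < α)
    (hα : Tendsto (fun n : ℕ => (fundSeq L n : ℝ) / phi L ^ n) atTop (𝓝 α))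
    (hμ : Represents L' μ) :
    Tendsto (fun x : ℕ => (zCount L L' x : ℝ) /
    (α * phi L ^ ord (μ x) * clipValue L L' (leading L' μ x))) atTop (𝓝 1) := by
  have b := isBase hL
  have hφ := (phi_spec hL).1
  obtain ⟨B, hB⟩ := b.bdd
  refine tendsto_div_one (s := fun x => phi L ^ ord (μ x))
    -- The ceiling has room for one digit more than `μ x`, so the deviation is taken up to `ord (μ
    -- x) + 1`, and the factor `phi L` restores the scale.
    (e := fun x => (B * phi L) * (deviation L α (ord (μ x) + 1) / phi L ^ (ord (μ x) + 1)))
    (r := α * (phi L)⁻¹) (mul_pos hα0 b.omega_pos) (Eventually.of_forall fun x => pow_pos hφ _)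
    ?_ ?_ ?_
  · filter_upwards [eventually_gt_atTop 0] with x hx
    have h1 := mul_le_mul_of_nonneg_left (inv_phi_le_clipValue_leading hL hL' hμ hx)
      (mul_pos hα0 (pow_pos hφ (ord (μ x)))).le
    linarith
  · filter_upwards [eventually_gt_atTop 0] with x hx
    obtain ⟨-, h2, -⟩ := rev_ord_mem_star hL' (hμ x hx).1 (expansion_ne_zero hμ hx)
    obtain ⟨c, hc, hsupp, hceil, hval⟩ := exists_isCeil hL h2
    have h3 := abs_evalNat_sub_le hL hB hc hsupp α
    have h4 := zCount_eq_of_isCeil hL hL' hsub (hμ x hx).1 hceil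
    rw [(hμ x hx).2] at h4
    rw [← h4, hval, ← clipValue_leading hL' hμ hx] at h3
    have hp := pow_pos hφ (ord (μ x))
    have e1 : α * phi L ^ (ord (μ x) + 1) * ((phi L)⁻¹ * clipValue L L' (leading L' μ x)) =
        α * phi L ^ ord (μ x) * clipValue L L' (leading L' μ x) := by
      rw [pow_succ]; field_simp
    rw [e1] at h3
    refine h3.trans_eq ?_
    rw [pow_succ]
    field_simp
  · have h1 : Tendsto (fun x => ord (μ x) + 1) atTop atTop :=
      (tendsto_add_atTop_nat 1).comp (tendsto_ord hL' hμ)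
    simpa using ((tendsto_deviation hL hα).comp h1).const_mul (B * phi L)

theorem delta_isEquivalent_leading (hL : IsAdmissible L) (hL' : IsAdmissible L')
    (hsub : collection L ⊆ collection L') (hα0 : 0 < α) (hα0' : 0 < α')
    (hα : Tendsto (fun n : ℕ => (fundSeq L n : ℝ) / phi L ^ n) atTop (𝓝 α))
    (hα' : Tendsto (fun n : ℕ => (fundSeq L' n : ℝ) / phi L' ^ n) atTop (𝓝 α'))
    (hμ : Represents L' μ)
    :
    (fun x : ℕ => delta L L' x) ~[atTop]
      fun x : ℕ => α / α' ^ gam L L' * ratio L L' (leading L' μ x) := by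
  have b := isBase hL
  have hφ := (phi_spec hL).1
  have hφ' := (phi_spec hL').1
  have hu := tendsto_zCount_div hL hL' hsub hα0 hα hμ
  have hv := (tendsto_div_leading hL' hα0' hα' hμ).rpow_const (p := gam L L') (Or.inl one_ne_zero)
  have huv := hu.div hv (by simp)
  simp only [Real.one_rpow, div_one] at huv
  have hpos : ∀ x, 0 < x → 0 < leading L' μ x ∧ 0 < clipValue L L' (leading L' μ x) := fun x hx =>
    ⟨(leading_mem hL' hμ hx).1, b.omega_pos.trans_le (inv_phi_le_clipValue_leading hL hL' hμ hx)⟩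
  refine isEquivalent_of_tendsto_one (huv.congr' ?_)
  filter_upwards [eventually_gt_atTop 0] with x hx
  obtain ⟨h1, h2⟩ := hpos x hx
  have hx' : (0 : ℝ) < x := by exact_mod_cast hx
  have hp := pow_pos hφ (ord (μ x))
  have hp' := pow_pos hφ' (ord (μ x))
  -- By the choice of γ the powers of φ̃ from the denominator cancel those of φ from the count.
  have e1 : (phi L' ^ ord (μ x)) ^ gam L L' = phi L ^ ord (μ x) := by
    rw [← Real.rpow_natCast_mul hφ'.le, mul_comm, Real.rpow_mul_natCast hφ'.le,
      phi_rpow_gam hL hL']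
  have h3 := Real.rpow_pos_of_pos hα0' (gam L L')
  have h4 := Real.rpow_pos_of_pos h1 (gam L L')
  have h5 := Real.rpow_pos_of_pos hx' (gam L L')
  simp only [Pi.div_apply]
  rw [Real.div_rpow hx'.le (by positivity), Real.mul_rpow (by positivity) h1.le,
    Real.mul_rpow hα0'.le hp'.le, e1, delta, ratio]
  field_simp

/-- Both arguments may be rescaled by powers of φ̃. After this they differ by a quantity tending to
0, and uniform continuity of `clipValue`, with its positive lower bound on the points used, turns
this into a quotient tending to 1. -/
theorem ratio_leading_isEquivalent (hL : IsAdmissible L) (hL' : IsAdmissible L')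
    (hsub : collection L ⊆ collection L') (hα0' : 0 < α')
    (hα' : Tendsto (fun n : ℕ => (fundSeq L' n : ℝ) / phi L' ^ n) atTop (𝓝 α'))
    (hμ : Represents L' μ)
    :
    (fun x : ℕ => ratio L L' (leading L' μ x)) ~[atTop]
      fun x : ℕ => ratio L L' (phi L' ^ (Int.fract (Real.logb (phi L') ((x : ℝ) / α')) - 1)) := by
  have b := isBase hL
  have b' := isBase hL'
  have hφ' := (phi_spec hL').1
  set y := leading L' μ with hy
  -- The exponent `ord (μ x) + 1` keeps `w x` in (0,1) eventually; with `ord (μ x)` it could exceed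
  -- 1 when the leading value is close to 1.
  set w : ℕ → ℝ := fun x => (x : ℝ) / (α' * phi L' ^ (ord (μ x) + 1)) with hw
  have hv := tendsto_div_leading hL' hα0' hα' hμ
  have hwy : ∀ x, 0 < x → w x = ((phi L')⁻¹ * y x) *
      ((x : ℝ) / (α' * phi L' ^ ord (μ x) * y x)) := by
    intro x hx
    have h1 := (leading_mem hL' hμ hx).1
    rw [← hy] at h1
    have hp' := pow_pos hφ' (ord (μ x))
    simp only [hw, pow_succ]
    field_simp
  have hymem : ∀ x, 0 < x → (phi L')⁻¹ * y x ∈ Set.Ioo (0 : ℝ) 1 := fun x hx => by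
    simpa using mul_mem_Ioo hL' (leading_mem hL' hμ hx) 1
  have hwpos : ∀ x, 0 < x → 0 < w x := fun x hx =>
    div_pos (by exact_mod_cast hx) (mul_pos hα0' (pow_pos hφ' _))
  have hwmem : ∀ᶠ x in atTop, w x ∈ Set.Ioo (0 : ℝ) 1 := by
    filter_upwards [hv.eventually (gt_mem_nhds (one_lt_phi hL')), eventually_gt_atTop 0]
      with x hx hx0
    refine ⟨hwpos x hx0, ?_⟩
    have h1 := (leading_mem hL' hμ hx0)
    rw [← hy] at h1
    have h2 : (phi L')⁻¹ * y x < (phi L')⁻¹ := by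
      simpa using mul_lt_mul_of_pos_left h1.2 b'.omega_pos
    rw [hwy x hx0]
    calc _ < ((phi L')⁻¹ * y x) * phi L' := mul_lt_mul_of_pos_left hx (hymem x hx0).1
      _ < (phi L')⁻¹ * phi L' := mul_lt_mul_of_pos_right h2 hφ'
      _ = 1 := inv_mul_cancel₀ hφ'.ne'
  have hdist : Tendsto (fun x => w x - (phi L')⁻¹ * y x) atTop (𝓝 0) := by
    have h1 : Tendsto (fun x : ℕ => |(x : ℝ) / (α' * phi L' ^ ord (μ x) * y x) - 1|) atTop
        (𝓝 0) := by
      simpa using (hv.sub_const 1).abs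
    refine squeeze_zero_norm' ?_ h1
    filter_upwards [eventually_gt_atTop 0] with x hx
    have h2 := hymem x hx
    rw [hwy x hx, ← mul_sub_one, norm_mul, Real.norm_eq_abs, Real.norm_eq_abs, abs_of_pos h2.1]
    exact mul_le_of_le_one_left (abs_nonneg _) h2.2.le
  have hclip : Tendsto (fun x => |clipValue L L' (w x) - clipValue L L' ((phi L')⁻¹ * y x)|) atTop
      (𝓝 0) := by
    rw [Metric.tendsto_nhds]
    intro δ hδ
    obtain ⟨η, hη, h⟩ := Metric.uniformContinuousOn_iff.1
      (clipValue_uniformContinuousOn hL hL' hsub) δ hδ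
    filter_upwards [hwmem, eventually_gt_atTop 0, Metric.tendsto_nhds.1 hdist η hη] with x h1 h2 h3
    have := h _ h1 _ (hymem x h2) (by rwa [Real.dist_eq, ← sub_zero (w x - _), ← Real.dist_eq])
    rwa [Real.dist_eq, sub_zero, abs_abs, ← Real.dist_eq]
  have hcpos : ∀ x, 0 < x → (phi L)⁻¹ * (phi L)⁻¹ ≤ clipValue L L' ((phi L')⁻¹ * y x) := by
    intro x hx
    rw [clipValue_mul hL hL' (leading_mem hL' hμ hx)]
    exact mul_le_mul_of_nonneg_left (inv_phi_le_clipValue_leading hL hL' hμ hx) b.omega_pos.le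
  have hcdiv : Tendsto (fun x => clipValue L L' (w x) / clipValue L L' ((phi L')⁻¹ * y x)) atTop
      (𝓝 1) := by
    refine tendsto_div_one (s := fun _ => 1) (r := (phi L)⁻¹ * (phi L)⁻¹)
      (mul_pos b.omega_pos b.omega_pos) (Eventually.of_forall fun _ => one_pos) ?_
      (Eventually.of_forall fun x => (mul_one _).ge) hclip
    filter_upwards [eventually_gt_atTop 0] with x hx
    rw [mul_one]
    exact hcpos x hx
  have hquot := hcdiv.div (hv.rpow_const (p := gam L L') (Or.inl one_ne_zero)) (by simp)
  simp only [Real.one_rpow, div_one] at hquot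
  refine IsEquivalent.symm (isEquivalent_of_tendsto_one (hquot.congr' ?_))
  filter_upwards [hwmem, eventually_gt_atTop 0] with x h1 hx
  have h2 := hymem x hx
  have hyx := leading_mem hL' hμ hx
  rw [← hy] at hyx
  have hc := (mul_pos b.omega_pos b.omega_pos).trans_le (hcpos x hx)
  have hx' : (0 : ℝ) < x := by exact_mod_cast hx
  have hxα : 0 < (x : ℝ) / α' := div_pos hx' hα0'
  have hwrpow : w x = phi L' ^ (Real.logb (phi L') ((x : ℝ) / α') - (ord (μ x) + 1 : ℕ)) := by
    rw [Real.rpow_sub hφ', Real.rpow_natCast, Real.rpow_logb hφ' (one_lt_phi hL').ne' hxα, hw]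
    have hp' := pow_pos hφ' (ord (μ x) + 1)
    field_simp
  have hneg : Real.logb (phi L') ((x : ℝ) / α') - (ord (μ x) + 1 : ℕ) < 0 := by
    by_contra hge
    have := Real.one_le_rpow (one_lt_phi hL').le (not_lt.1 hge)
    rw [← hwrpow] at this
    exact absurd h1.2 (not_lt.2 this)
  have hfract : ratio L L' (phi L' ^ (Int.fract (Real.logb (phi L') ((x : ℝ) / α')) - 1)) =
      ratio L L' (w x) := by
    rw [hwrpow]
    -- The exponents of φ̃ on the two sides differ by this integer, so the ratios coincide.
    refine ratio_rpow_congr hL hL' (i := (ord (μ x) : ℤ) -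
      ⌊Real.logb (phi L') ((x : ℝ) / α')⌋) (by
        have := Int.fract_lt_one (Real.logb (phi L') ((x : ℝ) / α')); linarith) hneg ?_
    rw [Int.fract]
    push_cast
    ring
  have hscale : ratio L L' (y x) = ratio L L' ((phi L')⁻¹ * y x) := by
    have := ratio_pow_mul hL hL' hyx 1
    rw [pow_one] at this
    exact this.symm
  simp only [Pi.div_apply]
  rw [hfract, hscale, ratio, ratio]
  have h3 : 0 < (x : ℝ) / (α' * phi L' ^ ord (μ x) * y x) :=
    div_pos hx' (mul_pos (mul_pos hα0' (pow_pos hφ' _)) hyx.1)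
  have hwg : w x ^ gam L L' = ((phi L')⁻¹ * y x) ^ gam L L' *
      ((x : ℝ) / (α' * phi L' ^ ord (μ x) * y x)) ^ gam L L' := by
    rw [← Real.mul_rpow h2.1.le h3.le, ← hwy x hx]
  have h4 := Real.rpow_pos_of_pos h2.1 (gam L L')
  have h5 := Real.rpow_pos_of_pos h3 (gam L L')
  rw [hwg, ← hy]
  generalize ((x : ℝ) / (α' * phi L' ^ ord (μ x) * y x)) ^ gam L L' = A at *
  generalize ((phi L')⁻¹ * y x) ^ gam L L' = C at *
  field_simp

end Main

end Zeckendorf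

end

theorem mainTheorem10 (L L' : List ℕ)
    (hL : Zeckendorf.IsAdmissible L) (hL' : Zeckendorf.IsAdmissible L')
    (hsub : Zeckendorf.collection L ⊂ Zeckendorf.collection L') :
    ∃ α α' : ℝ, 0 < α ∧ 0 < α' ∧
      Tendsto (fun n : ℕ => (Zeckendorf.fundSeq L n : ℝ) / Zeckendorf.phi L ^ n) atTop (𝓝 α) ∧
      Tendsto (fun n : ℕ => (Zeckendorf.fundSeq L' n : ℝ) / Zeckendorf.phi L' ^ n)
        atTop (𝓝 α') ∧
      (∀ μ : ℕ → Zeckendorf.Coeff,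
        (∀ x : ℕ, 0 < x → μ x ∈ Zeckendorf.collection L' ∧
          Zeckendorf.evalNat (Zeckendorf.fundSeq L') (μ x) = x) →
        (fun x : ℕ => Zeckendorf.delta L L' x) ~[atTop]
          fun x : ℕ => α / α' ^ Zeckendorf.gam L L' *
            Zeckendorf.deltaStar L L'
              (Zeckendorf.evalReal (Zeckendorf.fundSeqStar L')
                (Zeckendorf.rev (Zeckendorf.ord (μ x)) (μ x)))) ∧
      (fun x : ℕ => Zeckendorf.delta L L' x) ~[atTop]
        fun x : ℕ => α / α' ^ Zeckendorf.gam L L' *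
          Zeckendorf.deltaStar L L'
            (Zeckendorf.phi L' ^
              (Int.fract (Real.logb (Zeckendorf.phi L') ((x : ℝ) / α')) - 1)) := by
  obtain ⟨α, hα0, hα⟩ := Zeckendorf.exists_tendsto_fundSeq hL
  obtain ⟨α', hα0', hα'⟩ := Zeckendorf.exists_tendsto_fundSeq hL'
  refine ⟨α, α', hα0, hα0', hα, hα', fun μ hμ => ?_, ?_⟩
  · refine (Zeckendorf.delta_isEquivalent_leading hL hL' hsub.1 hα0 hα0' hα hα' hμ).congr_right ?_
    filter_upwards [eventually_gt_atTop 0] with x hx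
    rw [Zeckendorf.fundSeqStar_eq hL']
    exact congrArg _ (Zeckendorf.deltaStar_eq hL hL' (Zeckendorf.leading_mem hL' hμ hx)).symm
  -- The second formula does not mention expansions, so some choice of them is fixed to pass through
  -- the first.
  · choose μ hμ using fun x : ℕ => Zeckendorf.exists_evalNat_eq hL' x
    have hμ' : Zeckendorf.Represents L' μ := fun x _ => by
      rw [Zeckendorf.fundSeq_eq hL']; exact hμ x
    refine (Zeckendorf.delta_isEquivalent_leading hL hL' hsub.1 hα0 hα0' hα hα' hμ').trans
      ((IsEquivalent.refl.mul
        (Zeckendorf.ratio_leading_isEquivalent hL hL' hsub.1 hα0' hα' hμ')).congr_right ?_)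
    refine Eventually.of_forall fun x => congrArg _ (Zeckendorf.deltaStar_eq hL hL' ⟨?_, ?_⟩).symm
    · exact Real.rpow_pos_of_pos (Zeckendorf.phi_spec hL').1 _
    · exact Real.rpow_lt_one_of_one_lt_of_neg (Zeckendorf.one_lt_phi hL')
        (by linarith [Int.fract_lt_one (Real.logb (Zeckendorf.phi L') ((x : ℝ) / α'))])
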